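/- **Setting.** Let $n\in\mathbb N$, $n\ge 1$, $0<\alpha<\infty$, $1<s\le n/\alpha$. Let $G_\alpha=\mathcal F^{-1}[(1+|\cdot|^2)^{-\alpha/2}]$ be the Bessel kernel on $\mathbb R^n$ and, for $E\subseteq\mathbb R^n$, $$\mathcal C(E)=\inf\{\|f\|_{L^s}^s : f\ge 0 \text{ measurable},\ G_\alpha * f\ge 1 \text{ on } E\}$$ the Bessel capacity. Functions are Lebesgue measurable on $\mathbb R^n$ and identified when equal almost everywhere. For $1<p,q<\infty$ let $$\|f\|_{L^{p,q}}=p^{1/q}\Bigl(\int_0^\infty |\{|f|>t\}|^{q/p}\,t^{q}\,\tfrac{dt}{t}\Bigr)^{1/q},\qquad \|f\|_{M^{p,q}}=\sup_K\frac{\|f\chi_K\|_{L^{p,q}}}{\mathcal C(K)^{1/q}},\qquad \|f\|_{\mathcal M^{p,q}}=\sup_K\frac{\|f\chi_K\|_{L^{p,q}}}{\mathcal C(K)^{1/p}},$$ where $K$ runs over the compact sets with $\mathcal C(K)\neq 0$; $M^{p,q}$ and $\mathcal M^{p,q}$ are the spaces of all $f$ for which these are finite. Write $p'=p/(p-1)$.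 A measurable function $b$ is a $B^{p,q}$ block (resp. $\mathcal B^{p,q}$ block) if $\{b\ne0\}\subseteq E$ for some bounded set $E$ with $\mathcal C(E)^{1/q'}\|b\|_{L^{p,q}}\le 1$ (resp. $\mathcal C(E)^{1/p'}\|b\|_{L^{p,q}}\le 1$). The space $B^{p,q}$ (resp. $\mathcal B^{p,q}$) consists of all $f=\sum_k\lambda_k b_k$, convergent almost everywhere, with $\{\lambda_k\}\in\ell^1$ and all $b_k$ being $B^{p,q}$ (resp. $\mathcal B^{p,q}$) blocks; its (semi)norm is the infimum of $\sum_k|\lambda_k|$ over all such decompositions, set to be $\infty$ if there is none. For such a space $X$, $X^*$ denotes the continuous linear functionals on $X$, and $X^*\approx Y$ means: for every $\mathcal L\in X^*$ there is a unique $g\in Y$ with $\mathcal L(f)=\int fg\,dx$ for all $f\in X$; every $g\in Y$ defines in this way (with absolutely convergent integrals) an element of $X^*$; and $c^{-1}\|g\|_Y\le\|\mathcal L\|\le c\|g\|_Y$ for a constant $c>0$. The Köthe dual $X'$ is the space of all $f$ with $\|f\|_{X'}=\sup\{\int|fg|\,dx:\|g\|_X\le1\}<\infty$, and $Y\approx Z$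 between function spaces means that $\|\cdot\|_Y$ and $\|\cdot\|_Z$ are bounded by constant multiples of each other. **Theorem 1.2.** Let $1<p<\infty$ and $1<q<\infty$. Then $$(B^{p',q'})^*\approx M^{p,q}\approx(B^{p',q'})',\qquad(\mathcal B^{p',q'})^*\approx\mathcal M^{p,q}\approx(\mathcal B^{p',q'})'.$$ Moreover, $\mathcal B^{p',q'}$ is a Banach space, and $B^{p',q'}$ is a Banach space provided that $\frac{n-\alpha s}{n}\le\frac qp$ (which always holds when $\alpha s=n$). -/

import Mathlib

open MeasureTheory Filter Topology Set
open scoped ENNReal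

noncomputable section

/-! ### Euclidean space and measurable functions -/

/-- The Euclidean space `ℝⁿ`. -/
abbrev Rn (n : ℕ) : Type := EuclideanSpace ℝ (Fin n)

/-- Lebesgue measurable real functions on `ℝⁿ`, identified when they agree almost everywhere. -/
abbrev MeasFun (n : ℕ) : Type := Rn n →ₘ[(volume : Measure (Rn n))] ℝ

/-! ### Bessel kernels and Bessel capacities -/

/-- The integrand in the heat-semigroup formula for the Bessel kernel `G_α`. -/
def besselIntegrand (n : ℕ) (α : ℝ) (x : Rn n) (t : ℝ) : ℝ :=
  t ^ (α / 2 - 1) * Real.exp (-t) / Real.Gamma (α / 2) *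
    ((4 * Real.pi * t) ^ (-(n : ℝ) / 2) * Real.exp (-‖x‖ ^ 2 / (4 * t)))

/-- The Bessel kernel
`G_α(x) = Γ(α/2)⁻¹ ∫₀^∞ t^{α/2-1} e^{-t} (4πt)^{-n/2} e^{-|x|²/(4t)} dt`,
that is, the inverse Fourier transform of `(1 + |ξ|²)^{-α/2}`; see `integrable_besselKernel` and
`fourier_besselKernel` below. -/
def besselKernel (n : ℕ) (α : ℝ) (x : Rn n) : ℝ≥0∞ :=
  ∫⁻ t in Ioi (0 : ℝ), ENNReal.ofReal (besselIntegrand n α x t)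

lemma besselIntegrand_nonneg (n : ℕ) {α : ℝ} (hα : 0 < α) (x : Rn n) {t : ℝ} (ht : 0 < t) :
    0 ≤ besselIntegrand n α x t := by
  have := Real.Gamma_pos_of_pos (half_pos hα)
  unfold besselIntegrand
  positivity

lemma measurable_besselIntegrand (n : ℕ) (α : ℝ) :
    Measurable (fun z : ℝ × Rn n => besselIntegrand n α z.2 z.1) := by
  unfold besselIntegrand
  fun_prop

/-- The Gaussian integral with a Fourier phase. -/
lemma integral_heat (n : ℕ) {t : ℝ} (ht : 0 < t) (ξ : Rn n) :
    ∫ x : Rn n, Complex.exp (-Complex.I * (inner ℝ x ξ : ℝ)) *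
      (((4 * Real.pi * t) ^ (-(n : ℝ) / 2) * Real.exp (-‖x‖ ^ 2 / (4 * t)) : ℝ) : ℂ) =
      ((Real.exp (-(t * ‖ξ‖ ^ 2)) : ℝ) : ℂ) := by
  have hb : 0 < ((1 / (4 * t) : ℝ) : ℂ).re := by
    rw [Complex.ofReal_re]; positivity
  have key := GaussianFourier.integral_cexp_neg_mul_sq_norm_add hb (-Complex.I) ξ
  have h4 : (0 : ℝ) < 4 * Real.pi * t := by positivity
  have htc : (t : ℂ) ≠ 0 := by exact_mod_cast ht.ne'
  have e1 : ∀ x : Rn n, Complex.exp (-Complex.I * (inner ℝ x ξ : ℝ)) *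
      (((4 * Real.pi * t) ^ (-(n : ℝ) / 2) * Real.exp (-‖x‖ ^ 2 / (4 * t)) : ℝ) : ℂ) =
      (((4 * Real.pi * t) ^ (-(n : ℝ) / 2) : ℝ) : ℂ) *
      Complex.exp (-((1 / (4 * t) : ℝ) : ℂ) * ‖x‖ ^ 2 + -Complex.I * (inner ℝ ξ x : ℝ)) := by
    intro x
    rw [Complex.exp_add, real_inner_comm]
    push_cast
    have : -(‖x‖ : ℂ) ^ 2 / (4 * t) = -(1 / (4 * t)) * ‖x‖ ^ 2 := by ring
    rw [this]
    ring
  simp_rw [e1]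
  rw [integral_const_mul, key]
  have e2 : (Real.pi : ℂ) / ((1 / (4 * t) : ℝ) : ℂ) = ((4 * Real.pi * t : ℝ) : ℂ) := by
    push_cast
    field_simp
  have e3 : ((Module.finrank ℝ (Rn n) : ℂ) / 2) = (((n : ℝ) / 2 : ℝ) : ℂ) := by
    simp
  rw [e2, e3, ← Complex.ofReal_cpow h4.le, ← mul_assoc, ← Complex.ofReal_mul,
    ← Real.rpow_add h4]
  have e4 : -(n : ℝ) / 2 + n / 2 = 0 := by ring
  rw [e4, Real.rpow_zero, Complex.ofReal_one, one_mul, Complex.ofReal_exp]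
  congr 1
  push_cast
  rw [neg_sq, Complex.I_sq]
  field_simp

lemma integral_heat_real (n : ℕ) {t : ℝ} (ht : 0 < t) :
    ∫ x : Rn n, (4 * Real.pi * t) ^ (-(n : ℝ) / 2) * Real.exp (-‖x‖ ^ 2 / (4 * t)) = 1 := by
  have h := integral_heat n ht (0 : Rn n)
  simp only [inner_zero_right, Complex.ofReal_zero, mul_zero, Complex.exp_zero, one_mul,
    norm_zero, ne_eq, OfNat.ofNat_ne_zero, not_false_eq_true, zero_pow, neg_zero,
    Real.exp_zero] at h
  rw [integral_complex_ofReal] at h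
  exact_mod_cast h

lemma integrable_heat (n : ℕ) {t : ℝ} (ht : 0 < t) :
    Integrable (fun x : Rn n =>
      (4 * Real.pi * t) ^ (-(n : ℝ) / 2) * Real.exp (-‖x‖ ^ 2 / (4 * t))) := by
  by_contra h
  have := integral_heat_real n ht
  rw [integral_undef h] at this
  exact zero_ne_one this

lemma integrable_besselIntegrand_prod (n : ℕ) {α : ℝ} (hα : 0 < α) :
    Integrable (fun z : ℝ × Rn n => besselIntegrand n α z.2 z.1)
      ((volume.restrict (Ioi (0 : ℝ))).prod volume) := by
  rw [integrable_prod_iff (measurable_besselIntegrand n α).aestronglyMeasurable]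
  refine ⟨(ae_restrict_iff' measurableSet_Ioi).2 (ae_of_all _ fun t ht => ?_), ?_⟩
  · exact (integrable_heat n ht).const_mul
      (t ^ (α / 2 - 1) * Real.exp (-t) / Real.Gamma (α / 2))
  · have hG := Real.GammaIntegral_convergent (half_pos hα)
    have : IntegrableOn (fun t : ℝ => Real.exp (-t) * t ^ (α / 2 - 1) / Real.Gamma (α / 2))
      (Ioi 0) := hG.div_const _
    refine this.congr_fun (fun t ht => ?_) measurableSet_Ioi
    have : ∀ x : Rn n, ‖besselIntegrand n α x t‖ = besselIntegrand n α x t := fun x =>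
      Real.norm_of_nonneg (besselIntegrand_nonneg n hα x ht)
    simp only [this]
    simp only [besselIntegrand]
    rw [integral_const_mul, integral_heat_real n ht]
    ring

lemma besselKernel_toReal (n : ℕ) {α : ℝ} (hα : 0 < α) (x : Rn n) :
    (besselKernel n α x).toReal = ∫ t in Ioi (0 : ℝ), besselIntegrand n α x t := by
  rw [integral_eq_lintegral_of_nonneg_ae]
  · rfl
  · exact (ae_restrict_iff' measurableSet_Ioi).2
      (ae_of_all _ fun t ht => besselIntegrand_nonneg n hα x ht)
  · exact ((measurable_besselIntegrand n α).comp
      (measurable_id.prodMk measurable_const)).aestronglyMeasurable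

/-- The Bessel kernel is integrable. -/
lemma integrable_besselKernel (n : ℕ) {α : ℝ} (hα : 0 < α) :
    Integrable (fun x : Rn n => (besselKernel n α x).toReal) := by
  simp_rw [besselKernel_toReal n hα]
  exact (integrable_besselIntegrand_prod n hα).integral_prod_right

/-- The Fourier transform of the Bessel kernel `G_α` is `(1 + |ξ|²)^{-α/2}`. -/
lemma fourier_besselKernel (n : ℕ) {α : ℝ} (hα : 0 < α) (ξ : Rn n) :
    ∫ x : Rn n, Complex.exp (-Complex.I * (inner ℝ x ξ : ℝ)) * ((besselKernel n α x).toReal : ℂ)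
      = (((1 + ‖ξ‖ ^ 2) ^ (-α / 2) : ℝ) : ℂ) := by
  have hint : Integrable (fun z : ℝ × Rn n => Complex.exp (-Complex.I * (inner ℝ z.2 ξ : ℝ)) *
      (besselIntegrand n α z.2 z.1 : ℂ)) ((volume.restrict (Ioi (0 : ℝ))).prod volume) := by
    refine ((integrable_besselIntegrand_prod n hα).ofReal (𝕜 := ℂ)).bdd_mul (c := 1) ?_ ?_
    · exact Continuous.aestronglyMeasurable (by fun_prop)
    · refine ae_of_all _ fun z => le_of_eq ?_
      rw [Complex.norm_exp]
      simp
  have h1 : ∀ x : Rn n, Complex.exp (-Complex.I * (inner ℝ x ξ : ℝ)) *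
      ((besselKernel n α x).toReal : ℂ) = ∫ t in Ioi (0 : ℝ),
        Complex.exp (-Complex.I * (inner ℝ x ξ : ℝ)) * (besselIntegrand n α x t : ℂ) := by
    intro x
    rw [integral_const_mul, integral_complex_ofReal, besselKernel_toReal n hα]
  simp_rw [h1]
  rw [← integral_integral_swap hint]
  have h2 : ∀ t ∈ Ioi (0 : ℝ), ∫ x : Rn n, Complex.exp (-Complex.I * (inner ℝ x ξ : ℝ)) *
      (besselIntegrand n α x t : ℂ) =
      ((t ^ (α / 2 - 1) * Real.exp (-((1 + ‖ξ‖ ^ 2) * t)) / Real.Gamma (α / 2) : ℝ) : ℂ) := by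
    intro t ht
    have : ∀ x : Rn n, Complex.exp (-Complex.I * (inner ℝ x ξ : ℝ)) *
        (besselIntegrand n α x t : ℂ) =
        ((t ^ (α / 2 - 1) * Real.exp (-t) / Real.Gamma (α / 2) : ℝ) : ℂ) *
        (Complex.exp (-Complex.I * (inner ℝ x ξ : ℝ)) *
        (((4 * Real.pi * t) ^ (-(n : ℝ) / 2) * Real.exp (-‖x‖ ^ 2 / (4 * t)) : ℝ) : ℂ)) := by
      intro x
      rw [besselIntegrand, Complex.ofReal_mul]
      ring
    simp_rw [this]
    rw [integral_const_mul, integral_heat n ht, ← Complex.ofReal_mul]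
    congr 1
    have : -((1 + ‖ξ‖ ^ 2) * t) = -t + -(t * ‖ξ‖ ^ 2) := by ring
    rw [this, Real.exp_add]
    ring
  rw [setIntegral_congr_fun measurableSet_Ioi h2, integral_complex_ofReal]
  congr 1
  have hpos : (0 : ℝ) < 1 + ‖ξ‖ ^ 2 := by positivity
  rw [integral_div, Real.integral_rpow_mul_exp_neg_mul_Ioi (half_pos hα) hpos,
    mul_div_assoc, div_self (Real.Gamma_pos_of_pos (half_pos hα)).ne', mul_one,
    one_div, Real.inv_rpow hpos.le, ← Real.rpow_neg hpos.le]
  congr 1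
  ring

/-- The Bessel potential `G_α * f` of a nonnegative function. -/
def besselPotential (n : ℕ) (α : ℝ) (f : Rn n → ℝ≥0∞) (x : Rn n) : ℝ≥0∞ :=
  ∫⁻ y, besselKernel n α (x - y) * f y

/-- The Bessel capacity `Cap_{α,s}(E)` of an arbitrary set `E ⊆ ℝⁿ`. -/
def besselCap (n : ℕ) (α s : ℝ) (E : Set (Rn n)) : ℝ≥0∞ :=
  ⨅ (f : Rn n → ℝ≥0∞) (_ : Measurable f) (_ : ∀ x ∈ E, 1 ≤ besselPotential n α f x),
    ∫⁻ x, f x ^ s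

/-! ### Lorentz quasi-norms and Sobolev multiplier spaces -/

/-- The Lorentz quasi-norm
`‖f‖_{L^{p,q}} = p^{1/q} (∫₀^∞ |{|f| > t}|^{q/p} t^q dt/t)^{1/q}` on `ℝⁿ`. -/
def lorentzNorm (n : ℕ) (p q : ℝ) (f : Rn n → ℝ) : ℝ≥0∞ :=
  ENNReal.ofReal p ^ (1 / q) *
    (∫⁻ t in Ioi (0 : ℝ),
      volume {x : Rn n | t < |f x|} ^ (q / p) * ENNReal.ofReal (t ^ q / t)) ^ (1 / q)

/-- `sup_K ‖f χ_K‖_{L^{p,q}} / Cap_{α,s}(K)^{1/r}` over the compact sets `K ⊆ ℝⁿ` of nonzero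
capacity.  It is the functional `‖f‖_{M^{p,q}}` for `r = q`, and the functional
`‖f‖_{𝓜^{p,q}}` for `r = p`; the spaces consist of the `f` at which it is finite. -/
def multNorm (n : ℕ) (α s r p q : ℝ) (f : MeasFun n) : ℝ≥0∞ :=
  ⨆ (K : Set (Rn n)) (_ : IsCompact K) (_ : besselCap n α s K ≠ 0),
    lorentzNorm n p q (K.indicator f) / besselCap n α s K ^ (1 / r)

/-! ### Block spaces -/

/-- `b` is a block: `b` vanishes off a bounded set `E` with
`Cap_{α,s}(E)^{1/r'} ‖b‖_{L^{p,q}} ≤ 1`.  These are the `B^{p,q}` blocks for `r = q`, and the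
`𝓑^{p,q}` blocks for `r = p`. -/
def IsBlock (n : ℕ) (α s r p q : ℝ) (b : Rn n → ℝ) : Prop :=
  AEStronglyMeasurable b (volume : Measure (Rn n)) ∧
    ∃ E : Set (Rn n), Bornology.IsBounded E ∧ {x | b x ≠ 0} ⊆ E ∧
      besselCap n α s E ^ (1 / r.conjExponent) * lorentzNorm n p q b ≤ 1

/-- `f = ∑ₖ λₖ bₖ` is a block decomposition: `λ ∈ ℓ¹`, every `bₖ` is a block, and the series
converges to `f` almost everywhere. -/
def IsBlockDecomp (n : ℕ) (α s r p q : ℝ) (f : MeasFun n) (l : ℕ → ℝ) (b : ℕ → Rn n → ℝ) :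
    Prop :=
  Summable (fun k => |l k|) ∧ (∀ k, IsBlock n α s r p q (b k)) ∧
    ∀ᵐ x : Rn n, Tendsto (fun N => ∑ k ∈ Finset.range N, l k * b k x) atTop (𝓝 (f x))

/-- The block norm: the infimum of `∑ₖ |λₖ|` over all block decompositions (`∞` if there is none).
It is `‖f‖_{B^{p,q}}` for `r = q` and `‖f‖_{𝓑^{p,q}}` for `r = p`. -/
def blockNorm (n : ℕ) (α s r p q : ℝ) (f : MeasFun n) : ℝ≥0∞ :=
  ⨅ (l : ℕ → ℝ) (b : ℕ → Rn n → ℝ) (_ : IsBlockDecomp n α s r p q f l b),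
    ∑' k, ENNReal.ofReal |l k|

section BlockLemmas

variable {n : ℕ} {α s r p q : ℝ}

lemma IsBlockDecomp.blockNorm_le {f : MeasFun n} {l : ℕ → ℝ} {b : ℕ → Rn n → ℝ}
    (h : IsBlockDecomp n α s r p q f l b) :
    blockNorm n α s r p q f ≤ ∑' k, ENNReal.ofReal |l k| :=
  iInf_le_of_le l (iInf_le_of_le b (iInf_le _ h))

lemma blockNorm_lt_top_iff {f : MeasFun n} :
    blockNorm n α s r p q f < ∞ ↔ ∃ l b, IsBlockDecomp n α s r p q f l b := by
  constructor
  · intro h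
    simp only [blockNorm, iInf_lt_iff] at h
    obtain ⟨l, b, hd, -⟩ := h
    exact ⟨l, b, hd⟩
  · rintro ⟨l, b, hd⟩
    refine hd.blockNorm_le.trans_lt (lt_top_iff_ne_top.2 ?_)
    exact hd.1.tsum_ofReal_ne_top

lemma isBlock_zero (hq : 0 < q) (hpq : 0 < q / p) : IsBlock n α s r p q (fun _ => 0) := by
  refine ⟨aestronglyMeasurable_const, ∅, Bornology.isBounded_empty, by simp, ?_⟩
  have h0 : lorentzNorm n p q (fun _ => 0) = 0 := by
    have : ∀ t ∈ Ioi (0 : ℝ), volume {x : Rn n | t < |(0 : ℝ)|} ^ (q / p) *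
        ENNReal.ofReal (t ^ q / t) = 0 := by
      intro t ht
      have : {x : Rn n | t < |(0 : ℝ)|} = ∅ := by
        ext x
        simpa using le_of_lt ht
      rw [this, measure_empty, ENNReal.zero_rpow_of_pos hpq, zero_mul]
    rw [lorentzNorm, setLIntegral_congr_fun measurableSet_Ioi this, lintegral_zero,
      ENNReal.zero_rpow_of_pos (by positivity), mul_zero]
  rw [h0, mul_zero]
  exact zero_le_one

lemma isBlockDecomp_zero (hq : 0 < q) (hpq : 0 < q / p) :
    IsBlockDecomp n α s r p q (0 : MeasFun n) (fun _ => 0) (fun _ _ => 0) := by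
  refine ⟨by simp, fun _ => isBlock_zero hq hpq, ?_⟩
  filter_upwards [AEEqFun.coeFn_zero (α := Rn n) (β := ℝ) (μ := volume)] with x hx
  simp [hx]

lemma IsBlockDecomp.smul {f : MeasFun n} {l : ℕ → ℝ} {b : ℕ → Rn n → ℝ}
    (h : IsBlockDecomp n α s r p q f l b) (c : ℝ) :
    IsBlockDecomp n α s r p q (c • f) (fun k => c * l k) b := by
  refine ⟨?_, h.2.1, ?_⟩
  · simp_rw [abs_mul]
    exact h.1.mul_left _
  · filter_upwards [h.2.2, AEEqFun.coeFn_smul c f] with x hx hc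
    rw [hc]
    simp_rw [mul_assoc, ← Finset.mul_sum]
    exact hx.const_mul c

/-- Interleaving two sequences. -/
def interleave {β : Type*} (u v : ℕ → β) (k : ℕ) : β := if Even k then u (k / 2) else v (k / 2)

lemma interleave_even {β : Type*} (u v : ℕ → β) (k : ℕ) : interleave u v (2 * k) = u k := by
  simp [interleave]

lemma interleave_odd {β : Type*} (u v : ℕ → β) (k : ℕ) : interleave u v (2 * k + 1) = v k := by
  have h1 : ¬ Even (2 * k + 1) := by simp
  have h2 : (2 * k + 1) / 2 = k := by omega
  rw [interleave, if_neg h1, h2]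

lemma sum_interleave (u v : ℕ → ℝ) (N : ℕ) :
    ∑ k ∈ Finset.range N, interleave u v k =
      ∑ k ∈ Finset.range ((N + 1) / 2), u k + ∑ k ∈ Finset.range (N / 2), v k := by
  induction N with
  | zero => simp
  | succ N ih =>
    rw [Finset.sum_range_succ, ih]
    rcases Nat.even_or_odd' N with ⟨m, rfl | rfl⟩
    · have a1 : (2 * m + 1) / 2 = m := by omega
      have a2 : (2 * m) / 2 = m := by omega
      have a3 : (2 * m + 1 + 1) / 2 = m + 1 := by omega
      rw [a1, a2, a3, interleave_even, Finset.sum_range_succ]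
      ring
    · have a1 : (2 * m + 1) / 2 = m := by omega
      have a2 : (2 * m + 1 + 1) / 2 = m + 1 := by omega
      have a3 : (2 * m + 1 + 1 + 1) / 2 = m + 1 := by omega
      rw [a1, a2, a3, interleave_odd, Finset.sum_range_succ (fun k => v k)]
      ring

lemma tendsto_sum_interleave {u v : ℕ → ℝ} {a c : ℝ}
    (hu : Tendsto (fun N => ∑ k ∈ Finset.range N, u k) atTop (𝓝 a))
    (hv : Tendsto (fun N => ∑ k ∈ Finset.range N, v k) atTop (𝓝 c)) :
    Tendsto (fun N => ∑ k ∈ Finset.range N, interleave u v k) atTop (𝓝 (a + c)) := by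
  simp_rw [sum_interleave]
  have h2 : Tendsto (fun N : ℕ => N / 2) atTop atTop :=
    tendsto_atTop_atTop.2 fun b => ⟨2 * b, fun N hN => by omega⟩
  have h1 : Tendsto (fun N : ℕ => (N + 1) / 2) atTop atTop :=
    tendsto_atTop_atTop.2 fun b => ⟨2 * b, fun N hN => by omega⟩
  exact (hu.comp h1).add (hv.comp h2)

lemma IsBlockDecomp.add {f g : MeasFun n} {l m : ℕ → ℝ} {b d : ℕ → Rn n → ℝ}
    (hf : IsBlockDecomp n α s r p q f l b) (hg : IsBlockDecomp n α s r p q g m d) :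
    IsBlockDecomp n α s r p q (f + g) (interleave l m) (interleave b d) := by
  refine ⟨?_, ?_, ?_⟩
  · have : (fun k => |interleave l m k|) = interleave (fun k => |l k|) (fun k => |m k|) := by
      funext k
      simp only [interleave]
      split_ifs <;> rfl
    rw [this]
    refine ((hasSum_iff_tendsto_nat_of_nonneg (fun k => ?_) _).2
      (tendsto_sum_interleave hf.1.hasSum.tendsto_sum_nat
        hg.1.hasSum.tendsto_sum_nat)).summable
    simp only [interleave]
    split_ifs <;> exact abs_nonneg _
  · intro k
    simp only [interleave]
    split_ifs
    · exact hf.2.1 _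
    · exact hg.2.1 _
  · filter_upwards [hf.2.2, hg.2.2, AEEqFun.coeFn_add f g] with x h1 h2 h3
    rw [h3]
    have : (fun k => interleave l m k * interleave b d k x) =
        interleave (fun k => l k * b k x) (fun k => m k * d k x) := by
      funext k
      simp only [interleave]
      split_ifs <;> rfl
    have h4 := tendsto_sum_interleave h1 h2
    rw [← this] at h4
    exact h4

lemma tsum_interleave {l m : ℕ → ℝ} (hl : Summable fun k => |l k|) (hm : Summable fun k => |m k|) :
    ∑' k, ENNReal.ofReal |interleave l m k| =
      ∑' k, ENNReal.ofReal |l k| + ∑' k, ENNReal.ofReal |m k| := by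
  have e : (fun k => |interleave l m k|) = interleave (fun k => |l k|) (fun k => |m k|) := by
    funext k
    simp only [interleave]
    split_ifs <;> rfl
  have hs : HasSum (fun k => |interleave l m k|) (∑' k, |l k| + ∑' k, |m k|) := by
    refine (hasSum_iff_tendsto_nat_of_nonneg (fun k => abs_nonneg _) _).2 ?_
    rw [e]
    exact tendsto_sum_interleave hl.hasSum.tendsto_sum_nat hm.hasSum.tendsto_sum_nat
  rw [← ENNReal.ofReal_tsum_of_nonneg (fun _ => abs_nonneg _) hs.summable, hs.tsum_eq,
    ENNReal.ofReal_add (tsum_nonneg fun _ => abs_nonneg _) (tsum_nonneg fun _ => abs_nonneg _),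
    ENNReal.ofReal_tsum_of_nonneg (fun _ => abs_nonneg _) hl,
    ENNReal.ofReal_tsum_of_nonneg (fun _ => abs_nonneg _) hm]

lemma blockNorm_add_le (f g : MeasFun n) :
    blockNorm n α s r p q (f + g) ≤ blockNorm n α s r p q f + blockNorm n α s r p q g := by
  conv_rhs => simp only [blockNorm]
  simp only [ENNReal.iInf_add, ENNReal.add_iInf, le_iInf_iff]
  intro m d hg l b hf
  exact (hf.add hg).blockNorm_le.trans_eq (tsum_interleave hf.1 hg.1)

lemma blockNorm_smul_le (c : ℝ) {f : MeasFun n} (hf : blockNorm n α s r p q f < ∞) :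
    blockNorm n α s r p q (c • f) ≤ ENNReal.ofReal |c| * blockNorm n α s r p q f := by
  have hne : Nonempty {x : (ℕ → ℝ) × (ℕ → Rn n → ℝ) //
      IsBlockDecomp n α s r p q f x.1 x.2} := by
    obtain ⟨l, b, h⟩ := blockNorm_lt_top_iff.1 hf
    exact ⟨⟨(l, b), h⟩⟩
  have e : blockNorm n α s r p q f = ⨅ x : {x : (ℕ → ℝ) × (ℕ → Rn n → ℝ) //
      IsBlockDecomp n α s r p q f x.1 x.2}, ∑' k, ENNReal.ofReal |x.1.1 k| := by
    simp only [blockNorm, iInf_subtype, iInf_prod]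
  rw [e, ENNReal.mul_iInf fun h => absurd h ENNReal.ofReal_ne_top]
  refine le_iInf fun x => ((x.2.smul c).blockNorm_le).trans_eq ?_
  simp_rw [abs_mul, ENNReal.ofReal_mul (abs_nonneg c), ENNReal.tsum_mul_left]

lemma blockNorm_zero (hq : 0 < q) (hpq : 0 < q / p) :
    blockNorm n α s r p q (0 : MeasFun n) = 0 := by
  refine le_antisymm ((isBlockDecomp_zero hq hpq).blockNorm_le.trans_eq ?_) bot_le
  simp

end BlockLemmas

/-! ### The block space as a seminormed space -/

instance instFactConjExponent {p : ℝ} [h : Fact (1 < p)] : Fact (1 < p.conjExponent) :=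
  ⟨(Real.HolderConjugate.conjExponent h.out).symm.lt⟩

section BlockSpace

variable (n : ℕ) (α s r p q : ℝ) [hp : Fact (1 < p)] [hq : Fact (1 < q)]

/-- The block space as a vector space: the (classes of) functions that have a block decomposition,
equivalently those with finite block norm. -/
def blockSubmodule : Submodule ℝ (MeasFun n) where
  carrier := {f | ∃ l b, IsBlockDecomp n α s r p q f l b}
  zero_mem' := ⟨_, _, isBlockDecomp_zero (zero_lt_one.trans hq.out)
    (div_pos (zero_lt_one.trans hq.out) (zero_lt_one.trans hp.out))⟩
  add_mem' := by
    rintro f g ⟨l, b, hf⟩ ⟨m, d, hg⟩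
    exact ⟨_, _, hf.add hg⟩
  smul_mem' := by
    rintro c f ⟨l, b, hf⟩
    exact ⟨_, _, hf.smul c⟩

/-- The block space, with its block norm: this is `B^{p,q}` for `r = q` and `𝓑^{p,q}` for
`r = p`. -/
def BlockSpace : Type := blockSubmodule n α s r p q

instance : AddCommGroup (BlockSpace n α s r p q) :=
  inferInstanceAs (AddCommGroup (blockSubmodule n α s r p q))

instance : Module ℝ (BlockSpace n α s r p q) :=
  inferInstanceAs (Module ℝ (blockSubmodule n α s r p q))

/-- The block norm as a seminorm on the block space. -/
def blockSeminorm : Seminorm ℝ (BlockSpace n α s r p q) :=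
  Seminorm.ofSMulLE (fun f => (blockNorm n α s r p q f.1).toReal)
    (by
      change (blockNorm n α s r p q (0 : MeasFun n)).toReal = 0
      rw [blockNorm_zero (zero_lt_one.trans hq.out)
        (div_pos (zero_lt_one.trans hq.out) (zero_lt_one.trans hp.out)), ENNReal.toReal_zero])
    (by
      intro f g
      have hf := blockNorm_lt_top_iff.2 f.2
      have hg := blockNorm_lt_top_iff.2 g.2
      rw [← ENNReal.toReal_add hf.ne hg.ne]
      exact ENNReal.toReal_mono (ENNReal.add_lt_top.2 ⟨hf, hg⟩).ne (blockNorm_add_le f.1 g.1))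
    (by
      intro c f
      have hf := blockNorm_lt_top_iff.2 f.2
      have h := ENNReal.toReal_mono (ENNReal.mul_lt_top ENNReal.ofReal_lt_top hf).ne
        (blockNorm_smul_le c hf)
      rw [ENNReal.toReal_mul, ENNReal.toReal_ofReal (abs_nonneg c)] at h
      exact h)

instance : SeminormedAddCommGroup (BlockSpace n α s r p q) :=
  (blockSeminorm n α s r p q).toAddGroupSeminorm.toSeminormedAddCommGroup

instance : NormedSpace ℝ (BlockSpace n α s r p q) where
  norm_smul_le c f := (map_smul_eq_mul (blockSeminorm n α s r p q) c f).le

lemma BlockSpace.norm_def (f : BlockSpace n α s r p q) :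
    ‖f‖ = (blockNorm n α s r p q f.1).toReal := rfl

end BlockSpace

/-! ### Duality, Köthe duality and isomorphism -/

section Duality

variable {n : ℕ} {α s r p q : ℝ} [Fact (1 < p)] [Fact (1 < q)]

/-- `L(f) = ∫ f g` for all `f` in the block space (the integrals being absolutely convergent). -/
def Represents (g : MeasFun n) (L : BlockSpace n α s r p q →L[ℝ] ℝ) : Prop :=
  ∀ f : BlockSpace n α s r p q,
    Integrable (fun x => f.1 x * g x) ∧ L f = ∫ x, f.1 x * g x

end Duality

/-- `X* ≈ Y` through the integral pairing, for `X` a block space and `Y = {g | N g < ∞}`: each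
continuous linear functional on `X` is represented by a unique `g ∈ Y`, each `g ∈ Y` represents
a continuous linear functional, and the operator norm of the functional is comparable to `N g`. -/
def DualIsomorphic (n : ℕ) (α s r p q : ℝ) [Fact (1 < p)] [Fact (1 < q)]
    (N : MeasFun n → ℝ≥0∞) : Prop :=
  (∀ L : BlockSpace n α s r p q →L[ℝ] ℝ, ∃! g : MeasFun n, N g < ∞ ∧ Represents g L) ∧
  (∀ g : MeasFun n, N g < ∞ → ∃ L : BlockSpace n α s r p q →L[ℝ] ℝ, Represents g L) ∧
  ∃ c : ℝ, 0 < c ∧ ∀ (g : MeasFun n) (L : BlockSpace n α s r p q →L[ℝ] ℝ),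
    N g < ∞ → Represents g L → c⁻¹ * (N g).toReal ≤ ‖L‖ ∧ ‖L‖ ≤ c * (N g).toReal

/-- The Köthe dual functional `‖f‖_{X'} = sup {∫ |f g| : ‖g‖_X ≤ 1}`. -/
def kotheNorm (n : ℕ) (N : MeasFun n → ℝ≥0∞) (f : MeasFun n) : ℝ≥0∞ :=
  ⨆ (g : MeasFun n) (_ : N g ≤ 1), ∫⁻ x, ENNReal.ofReal |f x * g x|

/-- `X ↪ Y`: there is `c > 0` with `‖f‖_Y ≤ c ‖f‖_X` for all `f`. -/
def Embeds (n : ℕ) (N₁ N₂ : MeasFun n → ℝ≥0∞) : Prop :=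
  ∃ c : ℝ, 0 < c ∧ ∀ f, N₂ f ≤ ENNReal.ofReal c * N₁ f

/-- `X ≈ Y`: both `X ↪ Y` and `Y ↪ X`. -/
def Isomorphic (n : ℕ) (N₁ N₂ : MeasFun n → ℝ≥0∞) : Prop :=
  Embeds n N₁ N₂ ∧ Embeds n N₂ N₁

/-- A seminormed space is a Banach space: its seminorm is a norm, and it is complete. -/
def IsBanach (X : Type*) [SeminormedAddCommGroup X] : Prop :=
  (∀ f : X, ‖f‖ = 0 → f = 0) ∧ CompleteSpace X

end

/-! ### Power integrals -/

/-! Both scales of spaces are handled at once. A parameter `r` (equal to `q` for $B$, $M$ and to `p`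
for $\mathcal B$, $\mathcal M$) records the power of the capacity, and every duality statement is
proved for arbitrary `r` with conjugate `r'`.

Upper bounds come from Hölder's inequality in Lorentz spaces (`lintegral_mul_le_distrib`, through
decreasing rearrangements). For a block $b$ on $E$ and a multiplier $g$, it gives
$\int|bg|\le\|g\|$, since $\mathcal C(K)\le\mathcal C(E)$ for compact $K\subseteq\{b\ne0\}$; summing
over a decomposition gives `lintegral_mul_le_multNorm_mul_blockNorm`. Lower bounds come from a
norming property: $\|g\chi_K\|_{L^{p,q}}$ is controlled by testing $g$ against nonnegative simple
functions supported in $K$ (`lorentzNorm_indicator_le_of_forall_simpleFunc`). Such a test function,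
suitably normalised, is itself a block. These two facts give the Köthe dual and the comparison of
norms.

It remains to represent a functional $L$. On each ball $A\mapsto L(\chi_{A\cap B})$ is a signed
measure absolutely continuous with respect to Lebesgue measure. The Radon–Nikodym densities glue to
one function $g$, the norming property shows that $g$ is a multiplier, and $L$ is integration
against $g$ because bounded simple functions with bounded support determine a functional
(`eq_zero_of_simpleFunc`).

For the Banach property it suffices that indicators of balls are multipliers: then the block norm
dominates the $L^1$ norm on every ball, which makes it a norm and makes absolutely convergent series
of block functions converge almost everywhere (`exists_blockSpace_series`). This multiplier property
amounts to $|K\cap B|^{r/p}\le C\,\mathcal C(K)$. For $r=p$ it follows from Young's inequality. For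
$r=q<p$ it is a Sobolev type estimate (`volume_rpow_le_besselCap`), which is where $(n-\alpha
s)/n\le q/p$ enters; for $r=q>p$ the boundedness of $B$ supplies the missing power. -/

lemma lintegral_Ioo_rpow {q b : ℝ} (hq : 0 < q) (hb : 0 ≤ b) :
    ∫⁻ s in Ioo 0 b, ENNReal.ofReal (s ^ (q - 1)) = ENNReal.ofReal (b ^ q / q) := by
  have hint : IntervalIntegrable (fun s : ℝ => s ^ (q - 1)) volume 0 b :=
    intervalIntegral.intervalIntegrable_rpow' (by linarith)
  have hI : IntegrableOn (fun s : ℝ => s ^ (q - 1)) (Ioo 0 b) :=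
    ((intervalIntegrable_iff_integrableOn_Ioc_of_le hb).1 hint).mono_set Ioo_subset_Ioc_self
  rw [← ofReal_integral_eq_lintegral_ofReal hI
    ((ae_restrict_iff' measurableSet_Ioo).2 (ae_of_all _ fun s hs => Real.rpow_nonneg hs.1.le _)),
    ← integral_Ioc_eq_integral_Ioo, ← intervalIntegral.integral_of_le hb,
    integral_rpow (Or.inl (by linarith)), sub_add_cancel, Real.zero_rpow hq.ne', sub_zero]

/-- The value $y=\infty$ is included because `y` will also be the measure of a level set. -/
lemma lintegral_rpow_layer {q : ℝ} (hq : 0 < q) (y : ℝ≥0∞) :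
    ∫⁻ s in Ioi (0 : ℝ), {s : ℝ | ENNReal.ofReal s < y}.indicator
      (fun s => ENNReal.ofReal (s ^ (q - 1))) s = y ^ q / ENNReal.ofReal q := by
  have hm : MeasurableSet {s : ℝ | ENNReal.ofReal s < y} :=
    measurableSet_lt ENNReal.measurable_ofReal measurable_const
  rw [lintegral_indicator hm, Measure.restrict_restrict hm]
  induction y with
  | top =>
    rw [ENNReal.top_rpow_of_pos hq, ENNReal.top_div_of_ne_top ENNReal.ofReal_ne_top]
    refine ENNReal.eq_top_of_forall_nnreal_le fun r => ?_
    -- With $b=(rq)^{1/q}$ the integral over $(0,b)$ alone equals $r$, so the full integral exceeds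
    -- every finite bound.
    have hb : (0 : ℝ) ≤ (r * q) ^ (1 / q) := by positivity
    have h := lintegral_Ioo_rpow hq hb
    rw [← Real.rpow_mul (by positivity), one_div_mul_cancel hq.ne', Real.rpow_one,
      mul_div_assoc, div_self hq.ne', mul_one, ENNReal.ofReal_coe_nnreal] at h
    rw [← h]
    refine lintegral_mono_set fun s hs => ⟨?_, hs.1⟩
    simp
  | coe y =>
    have e : {s : ℝ | ENNReal.ofReal s < y} ∩ Ioi 0 = Ioo 0 (y : ℝ) := by
      ext s
      simp only [mem_inter_iff, mem_ofPred_eq, mem_Ioi, mem_Ioo]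
      constructor
      · rintro ⟨h1, h2⟩
        refine ⟨h2, ?_⟩
        rw [← ENNReal.ofReal_coe_nnreal] at h1
        exact (ENNReal.ofReal_lt_ofReal_iff_of_nonneg h2.le).1 h1
      · rintro ⟨h1, h2⟩
        refine ⟨?_, h1⟩
        rw [← ENNReal.ofReal_coe_nnreal]
        exact (ENNReal.ofReal_lt_ofReal_iff_of_nonneg h1.le).2 h2
    rw [e, lintegral_Ioo_rpow hq y.coe_nonneg, ENNReal.ofReal_div_of_pos hq,
      ← ENNReal.ofReal_rpow_of_nonneg y.coe_nonneg hq.le, ENNReal.ofReal_coe_nnreal]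

lemma lintegral_layer (y : ℝ≥0∞) :
    ∫⁻ s in Ioi (0 : ℝ), {s : ℝ | ENNReal.ofReal s < y}.indicator (fun _ => 1) s = y := by
  have h := lintegral_rpow_layer one_pos y
  simpa using h

/-! ### Distribution functions and rearrangements -/

section Rearrangement

variable {X : Type*} [MeasurableSpace X] (μ : Measure X)

/-- The decreasing rearrangement of a function. -/
noncomputable def rearr (f : X → ℝ≥0∞) (u : ℝ) : ℝ≥0∞ :=
  ∫⁻ s in Ioi (0 : ℝ), {s : ℝ | ENNReal.ofReal u < μ {x | ENNReal.ofReal s < f x}}.indicator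
    (fun _ => 1) s

lemma antitone_distrib (f : X → ℝ≥0∞) :
    Antitone fun s : ℝ => μ {x | ENNReal.ofReal s < f x} := fun _ _ h =>
  measure_mono fun _ hx => (ENNReal.ofReal_le_ofReal h).trans_lt hx

lemma measurable_distrib (f : X → ℝ≥0∞) :
    Measurable fun s : ℝ => μ {x | ENNReal.ofReal s < f x} :=
  (antitone_distrib μ f).measurable

lemma measurableSet_distrib_gt (f : X → ℝ≥0∞) :
    MeasurableSet {z : ℝ × ℝ | ENNReal.ofReal z.1 < μ {x | ENNReal.ofReal z.2 < f x}} :=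
  measurableSet_lt (ENNReal.measurable_ofReal.comp measurable_fst)
    ((measurable_distrib μ f).comp measurable_snd)

lemma measurable_rearr (f : X → ℝ≥0∞) : Measurable (rearr μ f) := by
  refine Measurable.lintegral_prod_right' (ν := volume.restrict (Ioi (0 : ℝ))) (f := fun z : ℝ × ℝ => {z : ℝ × ℝ |
    ENNReal.ofReal z.1 < μ {x | ENNReal.ofReal z.2 < f x}}.indicator (fun _ => 1) z) ?_
  exact measurable_const.indicator (measurableSet_distrib_gt μ f)

/-- The set of levels measured by `rearr` is an initial interval. If `s` were not in it, the whole
interval would lie to the left of `s` and its length could not exceed `s`. -/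
lemma lt_distrib_of_lt_rearr {f : X → ℝ≥0∞} {u s : ℝ}
    (h : ENNReal.ofReal s < rearr μ f u) :
    ENNReal.ofReal u < μ {x | ENNReal.ofReal s < f x} := by
  by_contra hn
  refine h.not_ge ?_
  have hsub : ∀ t : ℝ, {s : ℝ | ENNReal.ofReal u < μ {x | ENNReal.ofReal s < f x}}.indicator
      (fun _ => (1 : ℝ≥0∞)) t ≤ {t : ℝ | ENNReal.ofReal t < ENNReal.ofReal s}.indicator
      (fun _ => 1) t ∨ t ≤ 0 := by
    intro t
    by_cases ht : 0 < t
    · left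
      refine indicator_le_indicator_of_subset ?_ (fun _ => zero_le) t
      intro t' ht'
      by_contra hc
      simp only [mem_ofPred_eq, not_lt] at hc
      exact hn (lt_of_lt_of_le ht' (measure_mono fun x hx => hc.trans_lt hx))
    · exact Or.inr (not_lt.1 ht)
  calc rearr μ f u ≤ ∫⁻ t in Ioi (0 : ℝ),
        {t : ℝ | ENNReal.ofReal t < ENNReal.ofReal s}.indicator (fun _ => 1) t := by
        refine lintegral_mono_ae ((ae_restrict_iff' measurableSet_Ioi).2 (ae_of_all _ ?_))
        intro t ht
        exact (hsub t).resolve_right (not_le.2 ht)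
    _ = ENNReal.ofReal s := lintegral_layer _

lemma lintegral_mul_lintegral_eq_lintegral_prod {ν : Measure ℝ} [SFinite μ] [SFinite ν]
    {F G : X → ℝ → ℝ≥0∞} (hF : Measurable (Function.uncurry F))
    (hG : Measurable (Function.uncurry G)) :
    ∫⁻ y, (∫⁻ s, F y s ∂ν) * (∫⁻ t, G y t ∂ν) ∂μ =
      ∫⁻ z, ∫⁻ y, F y z.1 * G y z.2 ∂μ ∂(ν.prod ν) := by
  rw [← lintegral_lintegral_swap (f := fun y (z : ℝ × ℝ) => F y z.1 * G y z.2)]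
  · refine lintegral_congr fun y => ?_
    exact (lintegral_prod_mul (hF.comp measurable_prodMk_left).aemeasurable
      (hG.comp measurable_prodMk_left).aemeasurable).symm
  · refine Measurable.aemeasurable (Measurable.mul ?_ ?_)
    · exact hF.comp (measurable_fst.prodMk (measurable_fst.comp measurable_snd))
    · exact hG.comp (measurable_fst.prodMk (measurable_snd.comp measurable_snd))

/-- Hardy–Littlewood inequality: after writing each factor as an integral of indicators of its level
sets, it reduces to $\mu(A\cap B)\le\min(\mu(A),\mu(B))$. -/
lemma lintegral_mul_le_lintegral_rearr [SFinite μ] {f g : X → ℝ≥0∞} (hf : Measurable f)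
    (hg : Measurable g) :
    ∫⁻ x, f x * g x ∂μ ≤ ∫⁻ u in Ioi (0 : ℝ), rearr μ f u * rearr μ g u := by
  set ν : Measure ℝ := volume.restrict (Ioi 0) with hν
  have hmf : MeasurableSet {z : X × ℝ | ENNReal.ofReal z.2 < f z.1} :=
    measurableSet_lt (ENNReal.measurable_ofReal.comp measurable_snd) (hf.comp measurable_fst)
  have hmg : MeasurableSet {z : X × ℝ | ENNReal.ofReal z.2 < g z.1} :=
    measurableSet_lt (ENNReal.measurable_ofReal.comp measurable_snd) (hg.comp measurable_fst)
  have h1 : ∀ x, f x * g x =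
      (∫⁻ s, {s : ℝ | ENNReal.ofReal s < f x}.indicator (fun _ => 1) s ∂ν) *
      (∫⁻ s, {s : ℝ | ENNReal.ofReal s < g x}.indicator (fun _ => 1) s ∂ν) := by
    intro x
    rw [hν, lintegral_layer, lintegral_layer]
  simp_rw [h1]
  rw [lintegral_mul_lintegral_eq_lintegral_prod μ (F := fun x s => {s : ℝ | ENNReal.ofReal s < f x}.indicator (fun _ => 1) s)
    (G := fun x s => {s : ℝ | ENNReal.ofReal s < g x}.indicator (fun _ => 1) s)
    (measurable_const.indicator hmf) (measurable_const.indicator hmg)]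
  unfold rearr
  rw [lintegral_mul_lintegral_eq_lintegral_prod ν (ν := ν) (F := fun u s => {s : ℝ | ENNReal.ofReal u <
      μ {x | ENNReal.ofReal s < f x}}.indicator (fun _ => 1) s)
    (G := fun u s => {s : ℝ | ENNReal.ofReal u <
      μ {x | ENNReal.ofReal s < g x}}.indicator (fun _ => 1) s)
    (measurable_const.indicator (measurableSet_distrib_gt μ f))
    (measurable_const.indicator (measurableSet_distrib_gt μ g))]
  refine lintegral_mono fun z => ?_
  have e1 : ∀ x, {s : ℝ | ENNReal.ofReal s < f x}.indicator (fun _ => (1 : ℝ≥0∞)) z.1 *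
      {s : ℝ | ENNReal.ofReal s < g x}.indicator (fun _ => 1) z.2 =
      ({x | ENNReal.ofReal z.1 < f x} ∩ {x | ENNReal.ofReal z.2 < g x}).indicator
        (fun _ => 1) x := by
    intro x
    by_cases a : ENNReal.ofReal z.1 < f x <;> by_cases b : ENNReal.ofReal z.2 < g x <;>
      simp [indicator, a, b]
  have e2 : ∀ u : ℝ, {s : ℝ | ENNReal.ofReal u <
      μ {x | ENNReal.ofReal s < f x}}.indicator (fun _ => (1 : ℝ≥0∞)) z.1 *
      {s : ℝ | ENNReal.ofReal u < μ {x | ENNReal.ofReal s < g x}}.indicator (fun _ => 1) z.2 =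
      {u : ℝ | ENNReal.ofReal u < min (μ {x | ENNReal.ofReal z.1 < f x})
        (μ {x | ENNReal.ofReal z.2 < g x})}.indicator (fun _ => 1) u := by
    intro u
    by_cases a : ENNReal.ofReal u < μ {x | ENNReal.ofReal z.1 < f x} <;>
    by_cases b : ENNReal.ofReal u < μ {x | ENNReal.ofReal z.2 < g x} <;>
      simp [indicator, a, b]
  simp_rw [e1, e2]
  rw [hν, lintegral_layer, lintegral_indicator, setLIntegral_one]
  · exact le_min (measure_mono inter_subset_left) (measure_mono inter_subset_right)
  · exact (measurableSet_lt measurable_const hf).inter (measurableSet_lt measurable_const hg)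

/-- Expand $f^*(u)^q$ in layers, use that $s<f^*(u)$ forces $u<\mu\{f>s\}$, and integrate first in
$u$: the power $u^{q/p-1}$ contributes $(p/q)\,\mu\{f>s\}^{q/p}$. -/
lemma lintegral_rearr_rpow_le {p q : ℝ} (hp : 0 < p) (hq : 0 < q) (f : X → ℝ≥0∞) :
    ∫⁻ u in Ioi (0 : ℝ), rearr μ f u ^ q * ENNReal.ofReal (u ^ (q / p - 1)) ≤
      ENNReal.ofReal p * ∫⁻ s in Ioi (0 : ℝ),
        μ {x | ENNReal.ofReal s < f x} ^ (q / p) * ENNReal.ofReal (s ^ (q - 1)) := by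
  have hq' : ENNReal.ofReal q ≠ 0 := by simpa using hq
  have hpow : ∀ a : ℝ, Measurable fun s : ℝ => ENNReal.ofReal (s ^ a) := fun a => by fun_prop
  have h1 : ∀ u, rearr μ f u ^ q * ENNReal.ofReal (u ^ (q / p - 1)) =
      ∫⁻ s in Ioi (0 : ℝ), ENNReal.ofReal q * ENNReal.ofReal (u ^ (q / p - 1)) *
        {s : ℝ | ENNReal.ofReal s < rearr μ f u}.indicator
        (fun s => ENNReal.ofReal (s ^ (q - 1))) s := by
    intro u
    rw [lintegral_const_mul' _ _ (ENNReal.mul_ne_top ENNReal.ofReal_ne_top ENNReal.ofReal_ne_top),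
      lintegral_rpow_layer hq, mul_comm (ENNReal.ofReal q), mul_assoc,
      ENNReal.mul_div_cancel hq' ENNReal.ofReal_ne_top, mul_comm]
  calc _ ≤ ∫⁻ u in Ioi (0 : ℝ), ∫⁻ s in Ioi (0 : ℝ),
        ENNReal.ofReal q * ENNReal.ofReal (s ^ (q - 1)) *
        {z : ℝ × ℝ | ENNReal.ofReal z.1 < μ {x | ENNReal.ofReal z.2 < f x}}.indicator
          (fun z => ENNReal.ofReal (z.1 ^ (q / p - 1))) (u, s) := by
        simp_rw [h1]
        refine lintegral_mono fun u => lintegral_mono fun s => ?_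
        dsimp only
        by_cases h : ENNReal.ofReal s < rearr μ f u
        · have h' := lt_distrib_of_lt_rearr μ h
          rw [indicator_of_mem (show s ∈ {s : ℝ | ENNReal.ofReal s < rearr μ f u} from h),
            indicator_of_mem (show (u, s) ∈ {z : ℝ × ℝ | ENNReal.ofReal z.1 <
              μ {x | ENNReal.ofReal z.2 < f x}} from h')]
          exact le_of_eq (by ring)
        · rw [indicator_of_notMem (show s ∉ {s : ℝ | ENNReal.ofReal s < rearr μ f u} from h)]
          simp
    _ = ∫⁻ s in Ioi (0 : ℝ), ∫⁻ u in Ioi (0 : ℝ),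
        ENNReal.ofReal q * ENNReal.ofReal (s ^ (q - 1)) *
        {z : ℝ × ℝ | ENNReal.ofReal z.1 < μ {x | ENNReal.ofReal z.2 < f x}}.indicator
          (fun z => ENNReal.ofReal (z.1 ^ (q / p - 1))) (u, s) := by
        refine lintegral_lintegral_swap (Measurable.aemeasurable (Measurable.mul ?_ ?_))
        · exact (((hpow (q - 1)).comp measurable_snd).const_mul _)
        · exact ((hpow (q / p - 1)).comp measurable_fst).indicator (measurableSet_distrib_gt μ f)
    _ = ∫⁻ s in Ioi (0 : ℝ), ENNReal.ofReal p *
        (μ {x | ENNReal.ofReal s < f x} ^ (q / p) * ENNReal.ofReal (s ^ (q - 1))) := by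
        refine lintegral_congr fun s => ?_
        rw [lintegral_const_mul' _ _
          (ENNReal.mul_ne_top ENNReal.ofReal_ne_top ENNReal.ofReal_ne_top)]
        have := lintegral_rpow_layer (div_pos hq hp) (μ {x | ENNReal.ofReal s < f x})
        have e : ∀ u : ℝ, {z : ℝ × ℝ | ENNReal.ofReal z.1 <
            μ {x | ENNReal.ofReal z.2 < f x}}.indicator
            (fun z => ENNReal.ofReal (z.1 ^ (q / p - 1))) (u, s) =
            {u : ℝ | ENNReal.ofReal u < μ {x | ENNReal.ofReal s < f x}}.indicator
              (fun u => ENNReal.ofReal (u ^ (q / p - 1))) u := fun u => rfl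
        simp_rw [e]
        rw [this, ENNReal.ofReal_div_of_pos hp, ENNReal.div_eq_inv_mul, ENNReal.inv_div
          (Or.inl ENNReal.ofReal_ne_top) (Or.inl (by simpa using hp)), ENNReal.div_eq_inv_mul]
        calc _ = (ENNReal.ofReal q * (ENNReal.ofReal q)⁻¹) * (ENNReal.ofReal p *
              (μ {x | ENNReal.ofReal s < f x} ^ (q / p) * ENNReal.ofReal (s ^ (q - 1)))) := by ring
          _ = _ := by rw [ENNReal.mul_inv_cancel hq' ENNReal.ofReal_ne_top, one_mul]
    _ = _ := lintegral_const_mul' _ _ ENNReal.ofReal_ne_top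

/-- Hölder's inequality for Lorentz norms in terms of distribution functions. -/
lemma lintegral_mul_le_distrib [SFinite μ] {p q p' q' : ℝ} (hp : p.HolderConjugate p')
    (hq : q.HolderConjugate q') {f g : X → ℝ≥0∞} (hf : Measurable f) (hg : Measurable g) :
    ∫⁻ x, f x * g x ∂μ ≤
      (ENNReal.ofReal p * ∫⁻ s in Ioi (0 : ℝ),
        μ {x | ENNReal.ofReal s < f x} ^ (q / p) * ENNReal.ofReal (s ^ (q - 1))) ^ (1 / q) *
      (ENNReal.ofReal p' * ∫⁻ s in Ioi (0 : ℝ),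
        μ {x | ENNReal.ofReal s < g x} ^ (q' / p') * ENNReal.ofReal (s ^ (q' - 1))) ^ (1 / q') := by
  have hq0 := hq.pos
  have hq0' := hq.symm.pos
  have hpow : ∀ a : ℝ, Measurable fun s : ℝ => ENNReal.ofReal (s ^ a) := fun a => by fun_prop
  -- The weights $u^{1/p-1/q}$ and $u^{1/p'-1/q'}$ cancel, so they can be inserted into $\int
  -- f^*g^*$ before the ordinary Hölder inequality with exponents $q,q'$.
  have hsum : (1 / p - 1 / q) + (1 / p' - 1 / q') = 0 := by
    have h1 := hp.inv_add_inv_eq_one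
    have h2 := hq.inv_add_inv_eq_one
    simp only [one_div]
    linarith
  have pw : ∀ {P Q : ℝ}, 0 < Q → ∀ (y : ℝ≥0∞) {u : ℝ}, 0 < u →
      (y * ENNReal.ofReal (u ^ (1 / P - 1 / Q))) ^ Q =
        y ^ Q * ENNReal.ofReal (u ^ (Q / P - 1)) := by
    intro P Q hQ y u hu
    rw [ENNReal.mul_rpow_of_nonneg _ _ hQ.le,
      ENNReal.ofReal_rpow_of_pos (Real.rpow_pos_of_pos hu _), ← Real.rpow_mul hu.le]
    congr 4
    field_simp
  calc ∫⁻ x, f x * g x ∂μ ≤ ∫⁻ u in Ioi (0 : ℝ), rearr μ f u * rearr μ g u :=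
        lintegral_mul_le_lintegral_rearr μ hf hg
    _ = ∫⁻ u in Ioi (0 : ℝ), ((fun u => rearr μ f u * ENNReal.ofReal (u ^ (1 / p - 1 / q))) *
        (fun u => rearr μ g u * ENNReal.ofReal (u ^ (1 / p' - 1 / q')))) u := by
        refine setLIntegral_congr_fun measurableSet_Ioi fun u hu => ?_
        have hu : 0 < u := hu
        calc rearr μ f u * rearr μ g u = rearr μ f u * rearr μ g u *
              ENNReal.ofReal (u ^ (1 / p - 1 / q) * u ^ (1 / p' - 1 / q')) := by
              rw [← Real.rpow_add hu, hsum, Real.rpow_zero, ENNReal.ofReal_one, mul_one]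
          _ = _ := by
              rw [ENNReal.ofReal_mul (Real.rpow_nonneg hu.le _)]
              simp only [Pi.mul_apply]
              ring
    _ ≤ _ := ENNReal.lintegral_mul_le_Lp_mul_Lq _ hq
          ((measurable_rearr μ f).mul (hpow _)).aemeasurable
          ((measurable_rearr μ g).mul (hpow _)).aemeasurable
    _ ≤ _ := by
        refine mul_le_mul' (ENNReal.rpow_le_rpow ?_ (by positivity))
          (ENNReal.rpow_le_rpow ?_ (by positivity))
        · rw [setLIntegral_congr_fun measurableSet_Ioi fun u hu => pw hq0 _ hu]
          exact lintegral_rearr_rpow_le μ hp.pos hq0 f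
        · rw [setLIntegral_congr_fun measurableSet_Ioi fun u hu => pw hq0' _ hu]
          exact lintegral_rearr_rpow_le μ hp.symm.pos hq0' g

end Rearrangement

/-! ### Lorentz quasi-norms -/

section Lorentz

variable {n : ℕ} {p q : ℝ}

lemma lorentzNorm_mono_ae (hp : 0 < p) (hq : 0 < q) {f g : Rn n → ℝ}
    (h : ∀ᵐ x, |f x| ≤ |g x|) : lorentzNorm n p q f ≤ lorentzNorm n p q g := by
  refine mul_le_mul_right (ENNReal.rpow_le_rpow (lintegral_mono fun t => mul_le_mul_left
    (ENNReal.rpow_le_rpow (measure_mono_ae ?_) (by positivity)) _) (by positivity)) _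
  filter_upwards [h] with x hx hxt
  exact lt_of_lt_of_le hxt hx

lemma lorentzNorm_congr_abs_ae (hp : 0 < p) (hq : 0 < q) {f g : Rn n → ℝ}
    (h : ∀ᵐ x, |f x| = |g x|) : lorentzNorm n p q f = lorentzNorm n p q g :=
  le_antisymm (lorentzNorm_mono_ae hp hq (h.mono fun _ hx => hx.le))
    (lorentzNorm_mono_ae hp hq (h.mono fun _ hx => hx.ge))

lemma lorentzNorm_eq (hq : 0 < q) (f : Rn n → ℝ) :
    lorentzNorm n p q f = (ENNReal.ofReal p * ∫⁻ s in Ioi (0 : ℝ),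
      volume {x | ENNReal.ofReal s < ENNReal.ofReal |f x|} ^ (q / p) *
        ENNReal.ofReal (s ^ (q - 1))) ^ (1 / q) := by
  rw [ENNReal.mul_rpow_of_nonneg _ _ (by positivity)]
  unfold lorentzNorm
  congr 2
  refine setLIntegral_congr_fun measurableSet_Ioi fun t ht => ?_
  have ht : 0 < t := ht
  have e : {x : Rn n | t < |f x|} = {x | ENNReal.ofReal t < ENNReal.ofReal |f x|} := by
    ext x
    exact (ENNReal.ofReal_lt_ofReal_iff_of_nonneg ht.le).symm
  rw [e, Real.rpow_sub_one ht.ne']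

/-- Hölder's inequality for Lorentz norms. -/
lemma lintegral_abs_mul_le_lorentzNorm {p' q' : ℝ} (hp : p.HolderConjugate p')
    (hq : q.HolderConjugate q') {f g : Rn n → ℝ} (hf : AEStronglyMeasurable f volume)
    (hg : AEStronglyMeasurable g volume) :
    ∫⁻ x, ENNReal.ofReal |f x * g x| ≤ lorentzNorm n p q f * lorentzNorm n p' q' g := by
  rw [lorentzNorm_congr_abs_ae hp.pos hq.pos (hf.ae_eq_mk.mono fun _ h => congrArg abs h),
    lorentzNorm_congr_abs_ae hp.symm.pos hq.symm.pos (hg.ae_eq_mk.mono fun _ h => congrArg abs h),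
    lorentzNorm_eq hq.pos, lorentzNorm_eq hq.symm.pos]
  have hm : ∀ {f : Rn n → ℝ} (hf : AEStronglyMeasurable f volume),
      Measurable fun x => ENNReal.ofReal |hf.mk f x| := fun hf =>
    (continuous_abs.measurable.comp hf.stronglyMeasurable_mk.measurable).ennreal_ofReal
  refine le_trans (le_of_eq ?_) (lintegral_mul_le_distrib volume hp hq (hm hf) (hm hg))
  refine lintegral_congr_ae ?_
  filter_upwards [hf.ae_eq_mk, hg.ae_eq_mk] with x h1 h2
  rw [← h1, ← h2, abs_mul, ENNReal.ofReal_mul (abs_nonneg _)]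

lemma lorentzNorm_le_of_bound (hp : 0 < p) (hq : 0 < q) {f : Rn n → ℝ} {A : Set (Rn n)} {M : ℝ}
    (hM : 0 ≤ M) (h : ∀ x, |f x| ≤ M) (hA : ∀ x, x ∉ A → f x = 0) :
    lorentzNorm n p q f ≤ (ENNReal.ofReal p * (volume A ^ (q / p) *
      ENNReal.ofReal (M ^ q / q))) ^ (1 / q) := by
  rw [lorentzNorm_eq hq]
  refine ENNReal.rpow_le_rpow (mul_le_mul_right ?_ _) (by positivity)
  have hm : Measurable fun s : ℝ => ENNReal.ofReal (s ^ (q - 1)) := by fun_prop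
  rw [← lintegral_Ioo_rpow hq hM, ← lintegral_const_mul _ hm,
    ← lintegral_indicator measurableSet_Ioi, ← lintegral_indicator measurableSet_Ioo]
  refine lintegral_mono fun s => ?_
  dsimp only
  by_cases hs : 0 < s
  · by_cases hs' : s < M
    · rw [indicator_of_mem (show s ∈ Ioi (0 : ℝ) from hs),
        indicator_of_mem (show s ∈ Ioo 0 M from ⟨hs, hs'⟩)]
      refine mul_le_mul_left (ENNReal.rpow_le_rpow (measure_mono fun x hx => ?_)
        (by positivity)) _
      by_contra hxA
      simp [hA x hxA] at hx
    · rw [indicator_of_mem (show s ∈ Ioi (0 : ℝ) from hs)]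
      have : {x : Rn n | ENNReal.ofReal s < ENNReal.ofReal |f x|} = ∅ := by
        ext x
        simpa using ENNReal.ofReal_le_ofReal ((h x).trans (not_lt.1 hs'))
      rw [this, measure_empty, ENNReal.zero_rpow_of_pos (by positivity), zero_mul]
      exact zero_le
  · rw [indicator_of_notMem (show s ∉ Ioi (0 : ℝ) from hs)]
    exact zero_le

lemma lorentzNorm_lt_top_of_bound (hp : 0 < p) (hq : 0 < q) {f : Rn n → ℝ} {A : Set (Rn n)}
    {M : ℝ} (h : ∀ x, |f x| ≤ M) (hA : ∀ x, x ∉ A → f x = 0) (hvol : volume A ≠ ∞) :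
    lorentzNorm n p q f < ∞ := by
  have hM : 0 ≤ M := (abs_nonneg (f 0)).trans (h 0)
  refine (lorentzNorm_le_of_bound hp hq hM h hA).trans_lt ?_
  refine ENNReal.rpow_lt_top_of_nonneg (by positivity) (ENNReal.mul_ne_top ENNReal.ofReal_ne_top
    (ENNReal.mul_ne_top ?_ ENNReal.ofReal_ne_top))
  exact ENNReal.rpow_ne_top_of_nonneg (by positivity) hvol

lemma setLIntegral_Ioi_comp_mul {c : ℝ} (hc : 0 < c) (F : ℝ → ℝ≥0∞) :
    ∫⁻ t in Ioi (0 : ℝ), F t = ENNReal.ofReal c * ∫⁻ t in Ioi (0 : ℝ), F (c * t) := by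
  have himg : (fun t : ℝ => c * t) '' Ioi 0 = Ioi 0 := by
    ext t
    constructor
    · rintro ⟨u, hu, rfl⟩
      exact mul_pos hc hu
    · intro ht
      exact ⟨t / c, div_pos ht hc, mul_div_cancel₀ t hc.ne'⟩
  have h := lintegral_image_eq_lintegral_abs_deriv_mul (f := fun t : ℝ => c * t)
    (f' := fun _ => c) (s := Ioi 0) measurableSet_Ioi
    (fun x _ => by simpa using ((hasDerivAt_id x).const_mul c).hasDerivWithinAt)
    (fun x _ y _ hxy => mul_left_cancel₀ hc.ne' hxy) F
  rw [himg, abs_of_pos hc, lintegral_const_mul' _ _ ENNReal.ofReal_ne_top] at h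
  exact h

lemma lorentzNorm_const_mul (hq : 0 < q) {c : ℝ} (hc : 0 < c) (f : Rn n → ℝ) :
    lorentzNorm n p q (fun x => c * f x) = ENNReal.ofReal c * lorentzNorm n p q f := by
  rw [lorentzNorm_eq hq, lorentzNorm_eq hq, setLIntegral_Ioi_comp_mul hc]
  have e : ∀ t ∈ Ioi (0 : ℝ), volume {x : Rn n | ENNReal.ofReal (c * t) <
      ENNReal.ofReal |c * f x|} ^ (q / p) * ENNReal.ofReal ((c * t) ^ (q - 1)) =
      ENNReal.ofReal (c ^ (q - 1)) * (volume {x : Rn n | ENNReal.ofReal t <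
        ENNReal.ofReal |f x|} ^ (q / p) * ENNReal.ofReal (t ^ (q - 1))) := by
    intro t ht
    have ht : 0 < t := ht
    rw [Real.mul_rpow hc.le ht.le, ENNReal.ofReal_mul (p := c ^ (q - 1)) (by positivity)]
    simp_rw [abs_mul, abs_of_pos hc, ENNReal.ofReal_mul hc.le,
      ENNReal.mul_lt_mul_iff_right (show ENNReal.ofReal c ≠ 0 by simpa using hc)
        ENNReal.ofReal_ne_top]
    ring
  rw [setLIntegral_congr_fun measurableSet_Ioi e, lintegral_const_mul' _ _ ENNReal.ofReal_ne_top]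
  have e2 : ENNReal.ofReal c * ENNReal.ofReal (c ^ (q - 1)) = ENNReal.ofReal c ^ q := by
    rw [← ENNReal.ofReal_mul hc.le, Real.rpow_sub_one hc.ne', mul_div_cancel₀ _ hc.ne',
      ENNReal.ofReal_rpow_of_pos hc]
  rw [← mul_assoc (ENNReal.ofReal c), e2, mul_left_comm, ENNReal.mul_rpow_of_nonneg _ _
    (by positivity), ← ENNReal.rpow_mul, mul_one_div_cancel hq.ne', ENNReal.rpow_one]

/-- Dominated convergence in $L^{p,q}$. On a set of finite measure pointwise convergence implies
convergence in measure, so each distribution function tends to zero, and all are dominated by that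
of `b`. -/
lemma tendsto_lorentzNorm_zero (hp : 0 < p) (hq : 0 < q) {b : Rn n → ℝ} {h : ℕ → Rn n → ℝ}
    {A : Set (Rn n)} (hA : volume A ≠ ∞) (hb : lorentzNorm n p q b ≠ ∞)
    (hbA : ∀ x, x ∉ A → b x = 0) (hm : ∀ k, AEStronglyMeasurable (h k) volume)
    (hle : ∀ k x, |h k x| ≤ |b x|) (hlim : ∀ x, Tendsto (fun k => h k x) atTop (𝓝 0)) :
    Tendsto (fun k => lorentzNorm n p q (h k)) atTop (𝓝 0) := by
  have hp' : ENNReal.ofReal p ≠ 0 := by simpa using hp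
  have hmeas : ∀ t : ℝ, 0 < t → Tendsto (fun k => volume {x : Rn n | t < |h k x|}) atTop
      (𝓝 0) := by
    intro t ht
    have : IsFiniteMeasure (volume.restrict A) := ⟨by simpa using hA.lt_top⟩
    have h1 := tendstoInMeasure_of_tendsto_ae (μ := volume.restrict A) (f := h) (g := fun _ => 0)
      (fun k => (hm k).restrict) (ae_of_all _ hlim) (ENNReal.ofReal t) (by simpa using ht)
    refine tendsto_of_tendsto_of_tendsto_of_le_of_le tendsto_const_nhds h1 (fun k => zero_le) ?_
    intro k
    refine le_trans (measure_mono fun x hx => ?_) (Measure.le_restrict_apply _ _)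
    have hx : t < |h k x| := hx
    refine ⟨?_, ?_⟩
    · simp only [mem_ofPred_eq, edist_dist, Real.dist_eq, sub_zero]
      exact ENNReal.ofReal_le_ofReal hx.le
    · by_contra hxA
      have := hle k x
      rw [hbA x hxA, abs_zero] at this
      linarith
  have hfin : ∫⁻ t in Ioi (0 : ℝ), volume {x : Rn n | t < |b x|} ^ (q / p) *
      ENNReal.ofReal (t ^ q / t) ≠ ∞ := by
    intro htop
    apply hb
    rw [lorentzNorm, htop, ENNReal.top_rpow_of_pos (by positivity), ENNReal.mul_top]
    exact (ENNReal.rpow_pos (pos_iff_ne_zero.2 hp') ENNReal.ofReal_ne_top).ne'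
  have hint : Tendsto (fun k => ∫⁻ t in Ioi (0 : ℝ), volume {x : Rn n | t < |h k x|} ^ (q / p) *
      ENNReal.ofReal (t ^ q / t)) atTop (𝓝 (∫⁻ t in Ioi (0 : ℝ), 0)) := by
    refine tendsto_lintegral_of_dominated_convergence' _ (fun k => ?_) (fun k => ?_) hfin ?_
    · refine Measurable.aemeasurable (Measurable.mul (Measurable.pow_const ?_ _) (by fun_prop))
      exact Antitone.measurable fun a b hab => measure_mono fun x hx => lt_of_le_of_lt hab hx
    · refine ae_of_all _ fun t => ?_
      refine mul_le_mul_left (ENNReal.rpow_le_rpow (measure_mono fun x hx => ?_)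
        (by positivity)) _
      exact lt_of_lt_of_le hx (hle k x)
    · refine (ae_restrict_iff' measurableSet_Ioi).2 (ae_of_all _ fun t ht => ?_)
      have h1 := ((ENNReal.continuous_rpow_const (y := q / p)).tendsto 0).comp (hmeas t ht)
      rw [ENNReal.zero_rpow_of_pos (by positivity)] at h1
      have h2 := ENNReal.Tendsto.mul_const (b := ENNReal.ofReal (t ^ q / t)) h1
        (Or.inr ENNReal.ofReal_ne_top)
      rw [zero_mul] at h2
      exact h2
  rw [lintegral_zero] at hint
  have h1 := ((ENNReal.continuous_rpow_const (y := 1 / q)).tendsto 0).comp hint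
  rw [ENNReal.zero_rpow_of_pos (by positivity)] at h1
  have h2 := ENNReal.Tendsto.const_mul (a := ENNReal.ofReal p ^ (1 / q)) h1
    (Or.inr (ENNReal.rpow_ne_top_of_nonneg (by positivity) ENNReal.ofReal_ne_top))
  rw [mul_zero] at h2
  exact h2

/-! ### Dyadic level sets -/

/-- On $(2^j,2^{j+1}]$ the distribution function is at most its value at $2^j$, and
$t^q/t\le(2\cdot2^j)^q/2^j$ on an interval of length $2^j$. -/
lemma lorentzNorm_le_dyadic (hp : 0 < p) (hq : 1 < q) (f : Rn n → ℝ) :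
    lorentzNorm n p q f ≤ (ENNReal.ofReal p * (ENNReal.ofReal (2 ^ q) *
      ∑' j : ℤ, ENNReal.ofReal (((2 : ℝ) ^ j) ^ q) *
        volume {x : Rn n | (2 : ℝ) ^ j < |f x|} ^ (q / p))) ^ (1 / q) := by
  have hq0 : 0 < q := by linarith
  rw [lorentzNorm, ← ENNReal.mul_rpow_of_nonneg _ _ (by positivity)]
  refine ENNReal.rpow_le_rpow (mul_le_mul_right ?_ _) (by positivity)
  have hcov : Ioi (0 : ℝ) ⊆ ⋃ j : ℤ, Ioc ((2 : ℝ) ^ j) ((2 : ℝ) ^ (j + 1)) := by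
    intro t ht
    obtain ⟨j, hj⟩ := exists_mem_Ioc_zpow (show 0 < t from ht) one_lt_two
    exact mem_iUnion.2 ⟨j, hj⟩
  refine (lintegral_mono_set hcov).trans ((lintegral_iUnion_le _ _).trans ?_)
  rw [← ENNReal.tsum_mul_left]
  refine ENNReal.tsum_le_tsum fun j => ?_
  have h2 : (0 : ℝ) < 2 ^ j := by positivity
  have hj : (2 : ℝ) ^ (j + 1) = 2 * 2 ^ j := by rw [zpow_add_one₀ two_ne_zero, mul_comm]
  calc _ ≤ ∫⁻ t in Ioc ((2 : ℝ) ^ j) (2 ^ (j + 1)),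
        volume {x : Rn n | (2 : ℝ) ^ j < |f x|} ^ (q / p) *
          ENNReal.ofReal ((2 * 2 ^ j) ^ q / 2 ^ j) := by
        refine setLIntegral_mono' measurableSet_Ioc fun t ht => ?_
        rw [hj] at ht
        have ht0 : 0 < t := h2.trans ht.1
        have h1 := ht.1
        have h3 := ht.2
        gcongr
    _ = _ := by
        rw [setLIntegral_const, Real.volume_Ioc, hj,
          show (2 : ℝ) * 2 ^ j - 2 ^ j = 2 ^ j by ring, mul_assoc,
          ← ENNReal.ofReal_mul (by positivity), div_mul_cancel₀ _ h2.ne',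
          Real.mul_rpow two_pos.le h2.le, ENNReal.ofReal_mul (by positivity)]
        ring

lemma sum_zpow_two_le {F : Finset ℤ} {J : ℤ} (h : ∀ j ∈ F, j ≤ J) :
    ∑ j ∈ F, (2 : ℝ) ^ j ≤ 2 ^ (J + 1) := by
  induction F using Finset.induction_on_max generalizing J with
  | empty => simp only [Finset.sum_empty]; positivity
  | insert a s hs ih =>
    rw [Finset.sum_insert fun ha => lt_irrefl _ (hs a ha)]
    have h1 := ih (J := a - 1) fun x hx => by have := hs x hx; omega
    have h2 : (2 : ℝ) ^ (a + 1) ≤ 2 ^ (J + 1) :=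
      zpow_le_zpow_right₀ one_le_two (by have := h a (Finset.mem_insert_self _ _); omega)
    rw [sub_add_cancel] at h1
    rw [zpow_add_one₀ two_ne_zero] at h2
    linarith

lemma sum_filter_zpow_two_le (F : Finset ℤ) {y : ℝ} (hy : 0 ≤ y) :
    ∑ j ∈ F with (2 : ℝ) ^ j < y, (2 : ℝ) ^ j ≤ 2 * y := by
  rcases (F.filter fun j : ℤ => (2 : ℝ) ^ j < y).eq_empty_or_nonempty with h | h
  · rw [h, Finset.sum_empty]
    positivity
  · have hm := Finset.max'_mem _ h
    have h1 := sum_zpow_two_le (F := F.filter fun j : ℤ => (2 : ℝ) ^ j < y)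
      (J := Finset.max' _ h) (fun j hj => Finset.le_max' _ j hj)
    have h2 := (Finset.mem_filter.1 hm).2
    rw [zpow_add_one₀ two_ne_zero] at h1
    linarith

/-- A maximum of multiples of indicators of a decreasing family of sets. -/
noncomputable def levelMax (F : Finset ℤ) (A : ℤ → Set (Rn n)) (hA : ∀ j, MeasurableSet (A j))
    (c : ℤ → NNReal) : SimpleFunc (Rn n) NNReal :=
  F.sup fun j => SimpleFunc.piecewise (A j) (hA j) (SimpleFunc.const _ (c j))
    (SimpleFunc.const _ 0)

lemma lt_levelMax_iff {F : Finset ℤ} {A : ℤ → Set (Rn n)} {hA : ∀ j, MeasurableSet (A j)}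
    {c : ℤ → NNReal} {x : Rn n} {t : NNReal} :
    t < levelMax F A hA c x ↔ ∃ j ∈ F, x ∈ A j ∧ t < c j := by
  classical
  rw [levelMax, SimpleFunc.finset_sup_apply, Finset.lt_sup_iff]
  refine exists_congr fun j => and_congr_right fun _ => ?_
  by_cases h : x ∈ A j <;> simp [SimpleFunc.piecewise_apply, h]

lemma le_levelMax {F : Finset ℤ} {A : ℤ → Set (Rn n)} {hA : ∀ j, MeasurableSet (A j)}
    {c : ℤ → NNReal} {x : Rn n} {j : ℤ} (hj : j ∈ F) (hx : x ∈ A j) :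
    c j ≤ levelMax F A hA c x := by
  by_contra h
  exact absurd (lt_levelMax_iff.2 ⟨j, hj, hx, not_le.1 h⟩) (lt_irrefl _)

/-- Taking a maximum rather than a sum keeps the superlevel sets explicit: since the $A_j$ decrease,
the set above level $s$ is the $A_m$ with the smallest index $m$ such that $c_m>s$. Its measure to
the power $q/p$ is a single term of the sum over $j$ with $c_j>s$, whatever the size of $q/p$. -/
lemma lorentzNorm_levelMax_le (hp : 0 < p) (hq : 0 < q) {F : Finset ℤ} {A : ℤ → Set (Rn n)}
    {hA : ∀ j, MeasurableSet (A j)} (hanti : Antitone A) (c : ℤ → NNReal) :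
    lorentzNorm n p q (fun x => levelMax F A hA c x) ≤
      (ENNReal.ofReal p * ((ENNReal.ofReal q)⁻¹ *
        ∑ j ∈ F, (c j : ℝ≥0∞) ^ q * volume (A j) ^ (q / p))) ^ (1 / q) := by
  rw [lorentzNorm_eq hq]
  refine ENNReal.rpow_le_rpow (mul_le_mul_right ?_ _) (by positivity)
  have hmw : Measurable fun s : ℝ => ENNReal.ofReal (s ^ (q - 1)) := by fun_prop
  have hlt : ∀ y : ℝ≥0∞, MeasurableSet {s : ℝ | ENNReal.ofReal s < y} := fun y =>
    measurableSet_lt ENNReal.measurable_ofReal measurable_const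
  calc _ ≤ ∫⁻ s in Ioi (0 : ℝ), ∑ j ∈ F, volume (A j) ^ (q / p) *
        {s : ℝ | ENNReal.ofReal s < c j}.indicator (fun s => ENNReal.ofReal (s ^ (q - 1))) s := by
        refine setLIntegral_mono' measurableSet_Ioi fun s hs => ?_
        have hs : 0 < s := hs
        classical
        rcases (F.filter fun j => ENNReal.ofReal s < c j).eq_empty_or_nonempty with h | h
        · have : {x : Rn n | ENNReal.ofReal s < ENNReal.ofReal |(levelMax F A hA c x : ℝ)|} = ∅ := by
            ext x
            simp only [mem_ofPred_eq, mem_empty_iff_false, iff_false, NNReal.abs_eq,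
              ENNReal.ofReal_coe_nnreal]
            intro hx
            obtain ⟨j, hj, -, hj'⟩ := lt_levelMax_iff.1 (ENNReal.coe_lt_coe.1 hx)
            have : j ∈ F.filter fun j => ENNReal.ofReal s < c j :=
              Finset.mem_filter.2 ⟨hj, ENNReal.coe_lt_coe.2 hj'⟩
            simp [h] at this
          rw [this, measure_empty, ENNReal.zero_rpow_of_pos (by positivity), zero_mul]
          exact zero_le
        · set m := (F.filter fun j => ENNReal.ofReal s < c j).min' h with hm
          have hmem := Finset.mem_filter.1 (Finset.min'_mem _ h)
          refine le_trans ?_ (Finset.single_le_sum (fun _ _ => zero_le) hmem.1)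
          rw [indicator_of_mem (show s ∈ {s : ℝ | ENNReal.ofReal s < _} from hmem.2)]
          gcongr
          intro x hx
          simp only [mem_ofPred_eq, NNReal.abs_eq, ENNReal.ofReal_coe_nnreal] at hx
          obtain ⟨j, hj, hxj, hj'⟩ := lt_levelMax_iff.1 (ENNReal.coe_lt_coe.1 hx)
          exact hanti (Finset.min'_le _ _
            (Finset.mem_filter.2 ⟨hj, ENNReal.coe_lt_coe.2 hj'⟩)) hxj
    _ = ∑ j ∈ F, volume (A j) ^ (q / p) * ((c j : ℝ≥0∞) ^ q / ENNReal.ofReal q) := by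
        rw [lintegral_finsetSum _ fun j _ => (hmw.indicator (hlt _)).const_mul _]
        refine Finset.sum_congr rfl fun j _ => ?_
        rw [lintegral_const_mul _ (hmw.indicator (hlt _)), lintegral_rpow_layer hq]
    _ = _ := by
        rw [Finset.mul_sum]
        refine Finset.sum_congr rfl fun j _ => ?_
        rw [ENNReal.div_eq_inv_mul, mul_comm, mul_assoc]

/-- At a point $x$, each $c_j$ with $x\in A_j$ is at most the maximum, and the corresponding powers
$2^j$ lie below $|g(x)|$ and hence sum to at most $2|g(x)|$. -/
lemma sum_mul_le_lintegral_levelMax {F : Finset ℤ} {g : Rn n → ℝ} (hg : Measurable g)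
    {A : ℤ → Set (Rn n)} {hA : ∀ j, MeasurableSet (A j)}
    (hAg : ∀ j, ∀ x ∈ A j, (2 : ℝ) ^ j < |g x|) (c : ℤ → NNReal) :
    ∑ j ∈ F, ENNReal.ofReal ((2 : ℝ) ^ j) * c j * volume (A j) ≤
      2 * ∫⁻ x, ENNReal.ofReal |levelMax F A hA c x * g x| := by
  classical
  have hm : Measurable fun x => ENNReal.ofReal |levelMax F A hA c x * g x| :=
    ((measurable_coe_nnreal_real.comp (levelMax F A hA c).measurable).mul hg).abs.ennreal_ofReal
  calc _ = ∫⁻ x, ∑ j ∈ F, (A j).indicator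
        (fun _ => ENNReal.ofReal ((2 : ℝ) ^ j) * c j) x := by
        rw [lintegral_finsetSum _ fun j _ => measurable_const.indicator (hA j)]
        refine Finset.sum_congr rfl fun j _ => ?_
        rw [lintegral_indicator (hA j), setLIntegral_const]
    _ ≤ ∫⁻ x, 2 * ENNReal.ofReal |levelMax F A hA c x * g x| := by
        refine lintegral_mono fun x => ?_
        dsimp only
        have h1 : ∀ j ∈ F, (A j).indicator (fun _ => ENNReal.ofReal ((2 : ℝ) ^ j) * c j) x ≤
            ENNReal.ofReal (if (2 : ℝ) ^ j < |g x| then (2 : ℝ) ^ j * levelMax F A hA c x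
              else 0) := by
          intro j hj
          by_cases hx : x ∈ A j
          · rw [indicator_of_mem hx, if_pos (hAg j x hx), ENNReal.ofReal_mul (by positivity),
              ENNReal.ofReal_coe_nnreal]
            gcongr
            exact le_levelMax hj hx
          · rw [indicator_of_notMem hx]
            exact zero_le
        refine (Finset.sum_le_sum h1).trans ?_
        rw [← ENNReal.ofReal_sum_of_nonneg (fun j _ => by positivity), ← Finset.sum_filter,
          ← Finset.sum_mul, show (2 : ℝ≥0∞) * ENNReal.ofReal |levelMax F A hA c x * g x| =
            ENNReal.ofReal (2 * |levelMax F A hA c x * g x|) by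
            rw [ENNReal.ofReal_mul two_pos.le, ENNReal.ofReal_ofNat], abs_mul, NNReal.abs_eq]
        refine ENNReal.ofReal_le_ofReal ?_
        have := mul_le_mul_of_nonneg_right (sum_filter_zpow_two_le F (abs_nonneg (g x)))
          (levelMax F A hA c x).coe_nonneg
        linarith
    _ = _ := lintegral_const_mul _ hm

end Lorentz

/-! ### Dual characterisation of the Lorentz quasi-norm -/

section Norming

variable {n : ℕ} {p q p' q' : ℝ}

/-- The constant in the dual characterisation of the Lorentz quasi-norm. -/
noncomputable def normingConst (p q p' q' : ℝ) : ℝ≥0∞ :=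
  (ENNReal.ofReal p * ENNReal.ofReal (2 ^ q)) ^ (1 / q) *
    (2 * (ENNReal.ofReal p' * (ENNReal.ofReal q')⁻¹) ^ (1 / q'))

lemma normingConst_ne_top (hq : 0 < q) (hq' : 0 < q') : normingConst p q p' q' ≠ ∞ := by
  refine ENNReal.mul_ne_top (ENNReal.rpow_ne_top_of_nonneg (by positivity)
    (ENNReal.mul_ne_top ENNReal.ofReal_ne_top ENNReal.ofReal_ne_top))
    (ENNReal.mul_ne_top (by simp) (ENNReal.rpow_ne_top_of_nonneg (by positivity)
      (ENNReal.mul_ne_top ENNReal.ofReal_ne_top ?_)))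
  simpa using hq'

/-- Finiteness of `S` allows division by $S^{1/q'}$. It is the reason for working with finite
partial sums below. -/
lemma le_rpow_of_le_mul_rpow (hq : q.HolderConjugate q') {S T : ℝ≥0∞} (hS : S ≠ ∞)
    (h : S ≤ T * S ^ (1 / q')) : S ≤ T ^ q := by
  rcases eq_or_ne S 0 with rfl | hS0
  · exact zero_le
  have e : S = S ^ (1 / q) * S ^ (1 / q') := by
    rw [← ENNReal.rpow_add _ _ hS0 hS, one_div, one_div, hq.inv_add_inv_eq_one, ENNReal.rpow_one]
  have h1 : S ^ (1 / q') ≠ 0 := (ENNReal.rpow_pos (pos_iff_ne_zero.2 hS0) hS).ne'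
  have h2 : S ^ (1 / q') ≠ ∞ := ENNReal.rpow_ne_top_of_nonneg
    (one_div_nonneg.2 hq.symm.nonneg) hS
  have h3 : S ^ (1 / q) ≤ T := by
    rw [← ENNReal.mul_le_mul_iff_left h1 h2, ← e]
    exact h
  calc S = (S ^ (1 / q)) ^ q := by
        rw [← ENNReal.rpow_mul, one_div_mul_cancel hq.pos.ne', ENNReal.rpow_one]
    _ ≤ _ := ENNReal.rpow_le_rpow h3 hq.nonneg

/-- The Lorentz quasi-norm of `g χ_K` is controlled by testing against simple functions. -/
lemma lorentzNorm_indicator_le_of_forall_simpleFunc (hp : p.HolderConjugate p')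
    (hq : q.HolderConjugate q') {g : Rn n → ℝ} (hg : Measurable g) {K : Set (Rn n)}
    (hK : MeasurableSet K) (hKvol : volume K ≠ ∞) {D : ℝ≥0∞}
    (h : ∀ φ : SimpleFunc (Rn n) NNReal, (∀ x, x ∉ K → φ x = 0) →
      ∫⁻ x, ENNReal.ofReal |φ x * g x| ≤ D * lorentzNorm n p' q' (fun x => φ x)) :
    lorentzNorm n p q (K.indicator g) ≤ normingConst p q p' q' * D := by
  have hp0 := hp.pos
  have hq0 := hq.pos
  have hp0' := hp.symm.pos
  have hq0' := hq.symm.pos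
  set A : ℤ → Set (Rn n) := fun j => {x | (2 : ℝ) ^ j < |K.indicator g x|} with hAdef
  have hA : ∀ j, MeasurableSet (A j) := fun j =>
    measurableSet_lt measurable_const (hg.indicator hK).abs
  have hAK : ∀ j, A j ⊆ K := by
    intro j x hx
    by_contra hxK
    have hx : (2 : ℝ) ^ j < |K.indicator g x| := hx
    rw [indicator_of_notMem hxK, abs_zero] at hx
    exact absurd hx (not_lt.2 (by positivity))
  have hAg : ∀ j, ∀ x ∈ A j, (2 : ℝ) ^ j < |g x| := by
    intro j x hx
    have h1 : (2 : ℝ) ^ j < |K.indicator g x| := hx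
    rwa [indicator_of_mem (hAK j hx)] at h1
  have hanti : Antitone A := fun i j hij x hx =>
    lt_of_le_of_lt (zpow_le_zpow_right₀ (one_le_two (α := ℝ)) hij)
      (show (2 : ℝ) ^ j < |K.indicator g x| from hx)
  have hvol : ∀ j, volume (A j) ≠ ∞ := fun j => measure_ne_top_of_subset (hAK j) hKvol
  set m : ℤ → NNReal := fun j => (volume (A j)).toNNReal with hm
  have hmv : ∀ j, volume (A j) = m j := fun j => (ENNReal.coe_toNNReal (hvol j)).symm
  -- The extremal coefficients: with $m_j=|A_j|$ they make both the pairing term $2^jc_jm_j$ and the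
  -- norm term $c_j^{q'}m_j^{q'/p'}$ equal to $e_j=2^{jq}m_j^{q/p}$, the $j$-th term of the dyadic
  -- sum for the Lorentz norm of `g` on `K`.
  set c : ℤ → NNReal := fun j => ((2 : NNReal) ^ j) ^ (q - 1) * m j ^ (q / p - 1) with hc
  set e : ℤ → NNReal := fun j => ((2 : NNReal) ^ j) ^ q * m j ^ (q / p) with he
  have h2 : ∀ j : ℤ, (2 : NNReal) ^ j ≠ 0 := fun j => by positivity
  have h2c : ∀ j : ℤ, ENNReal.ofReal ((2 : ℝ) ^ j) = ((2 : NNReal) ^ j : NNReal) := by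
    intro j
    rw [← ENNReal.ofReal_coe_nnreal]
    push_cast
    rfl
  have e1 : ∀ j, (2 : NNReal) ^ j * c j * m j = e j := by
    intro j
    -- When $m_j=0$ the value assigned to $m_j^{q/p-1}$ is irrelevant: the factor $m_j$ annihilates
    -- it.
    rcases eq_or_ne (m j) 0 with h0 | h0
    · simp only [hc, he, h0]
      rw [mul_zero, NNReal.zero_rpow (by positivity), mul_zero]
    · simp only [hc, he]
      rw [NNReal.rpow_sub_one h0, NNReal.rpow_sub_one (h2 j)]
      field_simp
  have e2 : ∀ j, c j ^ q' * m j ^ (q' / p') = e j := by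
    intro j
    rcases eq_or_ne (m j) 0 with h0 | h0
    · simp only [he, h0]
      rw [NNReal.zero_rpow (by positivity), NNReal.zero_rpow (by positivity), mul_zero, mul_zero]
    · simp only [hc, he]
      have i1 : (q - 1) * q' = q := hq.sub_one_mul_conj
      have i2 : (q / p - 1) * q' + q' / p' = q / p := by
        have := hp.symm.inv_add_inv_eq_one
        have h3 : 1 / p' = 1 - 1 / p := by simp only [one_div]; linarith
        calc _ = (q / p - 1) * q' + q' * (1 / p') := by ring
          _ = ((q - 1) * q') / p := by rw [h3]; ring
          _ = _ := by rw [i1]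
      rw [NNReal.mul_rpow, ← NNReal.rpow_mul, ← NNReal.rpow_mul, i1, mul_assoc,
        ← NNReal.rpow_add h0, i2]
  set C : ℝ≥0∞ := (ENNReal.ofReal p' * (ENNReal.ofReal q')⁻¹) ^ (1 / q') with hC
  -- Testing `g` against the maximum over $F$ gives $S\le2CD\,S^{1/q'}$ for $S=\sum_{j\in F}e_j$,
  -- and $S^{1/q'}$ is absorbed. The bound does not depend on $F$.
  have hsum : ∀ F : Finset ℤ, ∑ j ∈ F, (e j : ℝ≥0∞) ≤ (2 * C * D) ^ q := by
    intro F
    refine le_rpow_of_le_mul_rpow hq (ENNReal.sum_ne_top.2 fun _ _ => ENNReal.coe_ne_top) ?_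
    calc ∑ j ∈ F, (e j : ℝ≥0∞) = ∑ j ∈ F, ENNReal.ofReal ((2 : ℝ) ^ j) * c j * volume (A j) := by
          refine Finset.sum_congr rfl fun j _ => ?_
          rw [h2c, hmv, ← e1]
          push_cast
          rfl
      _ ≤ 2 * ∫⁻ x, ENNReal.ofReal |levelMax F A hA c x * g x| :=
          sum_mul_le_lintegral_levelMax hg hAg c
      _ ≤ 2 * (D * lorentzNorm n p' q' (fun x => levelMax F A hA c x)) := by
          refine mul_le_mul_right (h _ fun x hx => ?_) _
          by_contra hne
          obtain ⟨j, -, hj, -⟩ := lt_levelMax_iff.1 (pos_iff_ne_zero.2 hne)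
          exact hx (hAK j hj)
      _ ≤ 2 * (D * (ENNReal.ofReal p' * ((ENNReal.ofReal q')⁻¹ *
            ∑ j ∈ F, (c j : ℝ≥0∞) ^ q' * volume (A j) ^ (q' / p'))) ^ (1 / q')) := by
          gcongr
          exact lorentzNorm_levelMax_le hp0' hq0' hanti c
      _ = 2 * C * D * (∑ j ∈ F, (e j : ℝ≥0∞)) ^ (1 / q') := by
          have : ∀ j ∈ F, (c j : ℝ≥0∞) ^ q' * volume (A j) ^ (q' / p') = e j := by
            intro j _
            rw [hmv, ← e2, ← ENNReal.coe_rpow_of_nonneg _ hq0'.le,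
              ← ENNReal.coe_rpow_of_nonneg _ (by positivity)]
            push_cast
            rfl
          rw [Finset.sum_congr rfl this, ← mul_assoc (ENNReal.ofReal p'),
            ENNReal.mul_rpow_of_nonneg _ _ (by positivity)]
          ring
  have htsum : ∑' j : ℤ, ENNReal.ofReal (((2 : ℝ) ^ j) ^ q) * volume (A j) ^ (q / p) ≤
      (2 * C * D) ^ q := by
    rw [ENNReal.tsum_eq_iSup_sum]
    refine iSup_le fun F => le_trans (le_of_eq (Finset.sum_congr rfl fun j _ => ?_)) (hsum F)
    rw [← ENNReal.ofReal_rpow_of_pos (by positivity), h2c, hmv,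
      ← ENNReal.coe_rpow_of_nonneg _ hq0.le, ← ENNReal.coe_rpow_of_nonneg _ (by positivity)]
    rfl
  calc _ ≤ _ := lorentzNorm_le_dyadic hp0 hq.lt (K.indicator g)
    _ ≤ (ENNReal.ofReal p * (ENNReal.ofReal (2 ^ q) * (2 * C * D) ^ q)) ^ (1 / q) := by
        gcongr
    _ = _ := by
        rw [← mul_assoc, ENNReal.mul_rpow_of_nonneg _ _ (by positivity), ← ENNReal.rpow_mul,
          mul_one_div_cancel hq0.ne', ENNReal.rpow_one, normingConst]
        ring

end Norming

/-! ### Bessel capacities -/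

section Capacity

variable {n : ℕ} {α s : ℝ}

lemma besselCap_mono {E F : Set (Rn n)} (h : E ⊆ F) : besselCap n α s E ≤ besselCap n α s F :=
  le_iInf fun f => le_iInf fun hf => le_iInf fun hF =>
    iInf_le_of_le f (iInf_le_of_le hf (iInf_le _ fun x hx => hF x (h hx)))

lemma measurable_uncurry_besselIntegrand (n : ℕ) (α : ℝ) :
    Measurable fun z : Rn n × ℝ => ENNReal.ofReal (besselIntegrand n α z.1 z.2) :=
  ((measurable_besselIntegrand n α).comp measurable_swap).ennreal_ofReal

lemma measurable_besselKernel (n : ℕ) (α : ℝ) : Measurable (besselKernel n α) :=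
  (measurable_uncurry_besselIntegrand n α).lintegral_prod_right'

lemma besselIntegrand_pos (n : ℕ) {α : ℝ} (hα : 0 < α) (x : Rn n) {t : ℝ} (ht : 0 < t) :
    0 < besselIntegrand n α x t := by
  have := Real.Gamma_pos_of_pos (half_pos hα)
  unfold besselIntegrand
  positivity

lemma besselKernel_pos (n : ℕ) {α : ℝ} (hα : 0 < α) (x : Rn n) : 0 < besselKernel n α x := by
  have hm : Measurable fun t => ENNReal.ofReal (besselIntegrand n α x t) :=
    ((measurable_besselIntegrand n α).comp (measurable_id.prodMk measurable_const)).ennreal_ofReal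
  rw [besselKernel, setLIntegral_pos_iff hm]
  have hsub : Ioi (0 : ℝ) ⊆
      (Function.support fun t => ENNReal.ofReal (besselIntegrand n α x t)) ∩ Ioi 0 := by
    intro t ht
    have h := (ENNReal.ofReal_pos.2 (besselIntegrand_pos n hα x (mem_Ioi.1 ht))).ne'
    exact mem_inter (Function.mem_support.2 h) ht
  refine lt_of_lt_of_le ?_ (measure_mono hsub)
  rw [Real.volume_Ioi]
  exact ENNReal.zero_lt_top

/-- Bounded sets have finite capacity. -/
lemma besselCap_ne_top (hα : 0 < α) (hs : 0 < s) {E : Set (Rn n)} (hE : Bornology.IsBounded E) :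
    besselCap n α s E ≠ ∞ := by
  obtain ⟨R, hR⟩ := hE.subset_closedBall 0
  set B : Set (Rn n) := Metric.closedBall 0 (R + 1)
  have hB : MeasurableSet B := measurableSet_closedBall
  set m : ℝ≥0∞ := ∫⁻ z in Metric.closedBall (0 : Rn n) 1, besselKernel n α z with hm
  have hm0 : 0 < m := by
    rw [hm, setLIntegral_pos_iff (measurable_besselKernel n α)]
    refine lt_of_lt_of_le (Metric.measure_closedBall_pos volume (0 : Rn n) one_pos)
      (measure_mono fun x hx => ⟨(besselKernel_pos n hα x).ne', hx⟩)
  -- The test function is $c\chi_B$. For $x\in E$ the unit ball around $x$ lies in $B$, so its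
  -- potential at $x$ is at least $c\,m\ge1$.
  obtain ⟨c, hc⟩ : ∃ c : NNReal, 1 ≤ c * m := by
    rcases eq_or_ne m ∞ with h | h
    · exact ⟨1, by simp [h]⟩
    · refine ⟨m⁻¹.toNNReal, ?_⟩
      rw [ENNReal.coe_toNNReal (ENNReal.inv_ne_top.2 hm0.ne'), ENNReal.inv_mul_cancel hm0.ne' h]
  have hmeas : Measurable (B.indicator fun _ => (c : ℝ≥0∞)) := measurable_const.indicator hB
  refine ne_top_of_le_ne_top (b := ∫⁻ x, (B.indicator (fun _ => (c : ℝ≥0∞)) x) ^ s) ?_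
    (iInf_le_of_le _ (iInf_le_of_le hmeas (iInf_le _ ?_)))
  · have : ∀ x, (B.indicator (fun _ => (c : ℝ≥0∞)) x) ^ s =
        B.indicator (fun _ => (c : ℝ≥0∞) ^ s) x := by
      intro x
      by_cases hx : x ∈ B <;> simp [hx, hs]
    simp_rw [this]
    rw [lintegral_indicator hB, setLIntegral_const]
    exact ENNReal.mul_ne_top (ENNReal.rpow_ne_top_of_nonneg hs.le ENNReal.coe_ne_top)
      (isCompact_closedBall _ _).measure_lt_top.ne
  · intro x hx
    have hxR : ‖x‖ ≤ R := by simpa using hR hx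
    refine hc.trans ?_
    rw [besselPotential, ← lintegral_sub_left_eq_self _ x, hm,
      ← lintegral_const_mul _ (measurable_besselKernel n α),
      ← lintegral_indicator measurableSet_closedBall]
    refine lintegral_mono fun z => ?_
    by_cases hz : z ∈ Metric.closedBall (0 : Rn n) 1
    · have hz1 : ‖z‖ ≤ 1 := by simpa using hz
      have hxz : x - z ∈ B := by
        simp only [B, mem_closedBall_zero_iff]
        exact (norm_sub_le _ _).trans (add_le_add hxR hz1)
      rw [indicator_of_mem hz, indicator_of_mem hxz, sub_sub_cancel, mul_comm]
    · rw [indicator_of_notMem hz]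
      exact zero_le

end Capacity

/-! ### Heat kernel estimates for Bessel potentials -/

section CapacityVolume

variable {n : ℕ} {α s : ℝ}

/-- Jensen's inequality for the measure $k\,d\mu$, obtained from Hölder with $k=k^{1/s'}k^{1/s}$. -/
lemma rpow_lintegral_mul_le {X : Type*} [MeasurableSpace X] (μ : Measure X) (hs : 1 < s)
    {k f : X → ℝ≥0∞} (hk : Measurable k) (hf : Measurable f) :
    (∫⁻ y, k y * f y ∂μ) ^ s ≤ (∫⁻ y, k y ∂μ) ^ (s - 1) * ∫⁻ y, k y * f y ^ s ∂μ := by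
  have hs0 : 0 < s := by linarith
  have hc := Real.HolderConjugate.conjExponent hs
  set s' := s.conjExponent
  have hs' : 0 < s' := hc.symm.pos
  have h1 : ∀ y, k y * f y = ((fun y => k y ^ (1 / s') ) * fun y => k y ^ (1 / s) * f y) y := by
    intro y
    simp only [Pi.mul_apply]
    rw [← mul_assoc, ← ENNReal.rpow_add_of_nonneg _ _ (by positivity) (by positivity), one_div,
      one_div, add_comm, hc.inv_add_inv_eq_one, ENNReal.rpow_one]
  have h2 := ENNReal.lintegral_mul_le_Lp_mul_Lq μ hc.symm
    (f := fun y => k y ^ (1 / s')) (g := fun y => k y ^ (1 / s) * f y)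
    (hk.pow_const _).aemeasurable ((hk.pow_const _).mul hf).aemeasurable
  simp_rw [← h1] at h2
  calc _ ≤ _ := ENNReal.rpow_le_rpow h2 hs0.le
    _ = _ := by
      rw [ENNReal.mul_rpow_of_nonneg _ _ hs0.le, ← ENNReal.rpow_mul, ← ENNReal.rpow_mul,
        one_div_mul_cancel hs0.ne', ENNReal.rpow_one]
      have e1 : 1 / s' * s = s - 1 := by
        have := hc.inv_add_inv_eq_one
        have h3 : 1 / s' = 1 - 1 / s := by simp only [one_div]; linarith
        rw [h3]
        field_simp
      rw [e1]
      congr 2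
      · refine lintegral_congr fun y => ?_
        rw [← ENNReal.rpow_mul, one_div_mul_cancel hs'.ne', ENNReal.rpow_one]
      · funext y
        rw [ENNReal.mul_rpow_of_nonneg _ _ hs0.le, ← ENNReal.rpow_mul,
          one_div_mul_cancel hs0.ne', ENNReal.rpow_one]

/-- Young's inequality for convolution with an integrable kernel. -/
lemma lintegral_rpow_conv_le (hs : 1 < s) {k f : Rn n → ℝ≥0∞} (hk : Measurable k)
    (hf : Measurable f) :
    ∫⁻ x, (∫⁻ y, k (x - y) * f y) ^ s ≤ (∫⁻ x, k x) ^ s * ∫⁻ x, f x ^ s := by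
  have hkx : ∀ x : Rn n, Measurable fun y => k (x - y) := fun x => hk.comp (by fun_prop)
  have hm : Measurable fun z : Rn n × Rn n => k (z.1 - z.2) * f z.2 ^ s :=
    (hk.comp (by fun_prop)).mul ((hf.comp measurable_snd).pow_const _)
  calc _ ≤ ∫⁻ x, (∫⁻ y, k y) ^ (s - 1) * ∫⁻ y, k (x - y) * f y ^ s := by
        refine lintegral_mono fun x => (rpow_lintegral_mul_le volume hs (hkx x) hf).trans_eq ?_
        rw [lintegral_sub_left_eq_self (fun y => k y) x]
    _ = (∫⁻ y, k y) ^ (s - 1) * ((∫⁻ y, k y) * ∫⁻ y, f y ^ s) := by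
        rw [lintegral_const_mul _ hm.lintegral_prod_right', lintegral_lintegral_swap hm.aemeasurable,
          ← lintegral_const_mul _ (hf.pow_const _)]
        congr 1
        refine lintegral_congr fun y => ?_
        have hky : Measurable fun x => k (x - y) := hk.comp (by fun_prop)
        dsimp only
        rw [lintegral_mul_const _ hky, lintegral_sub_right_eq_self]
    _ = _ := by
        rw [← mul_assoc]
        congr 1
        nth_rw 2 [← ENNReal.rpow_one (∫⁻ y, k y)]
        rw [← ENNReal.rpow_add_of_nonneg _ _ (by linarith) one_pos.le, sub_add_cancel]

/-- The heat kernel. -/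
noncomputable def heatKernel (n : ℕ) (t : ℝ) (x : Rn n) : ℝ≥0∞ :=
  ENNReal.ofReal ((4 * Real.pi * t) ^ (-(n : ℝ) / 2) * Real.exp (-‖x‖ ^ 2 / (4 * t)))

lemma measurable_uncurry_heatKernel (n : ℕ) :
    Measurable fun z : ℝ × Rn n => heatKernel n z.1 z.2 := by
  unfold heatKernel
  fun_prop

lemma measurable_heatKernel (n : ℕ) (t : ℝ) : Measurable (heatKernel n t) :=
  (measurable_uncurry_heatKernel n).comp (measurable_const.prodMk measurable_id)

lemma lintegral_heatKernel (n : ℕ) {t : ℝ} (ht : 0 < t) : ∫⁻ x, heatKernel n t x = 1 := by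
  unfold heatKernel
  rw [← ofReal_integral_eq_lintegral_ofReal (integrable_heat n ht)
    (ae_of_all _ fun x => by positivity), integral_heat_real n ht, ENNReal.ofReal_one]

/-- The smoothing bound $L^s\to L^\infty$: Jensen with the unit mass of the heat kernel, then its
supremum is at most $t^{-n/2}$. -/
lemma heatKernel_conv_le (hs : 1 < s) {f : Rn n → ℝ≥0∞} (hf : Measurable f) {t : ℝ}
    (ht : 0 < t) (x : Rn n) :
    ∫⁻ y, heatKernel n t (x - y) * f y ≤
      ENNReal.ofReal (t ^ (-(n / (2 * s)) : ℝ)) * (∫⁻ y, f y ^ s) ^ (1 / s) := by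
  have hs0 : 0 < s := by linarith
  have hk : Measurable fun y => heatKernel n t (x - y) :=
    (measurable_heatKernel n t).comp (by fun_prop)
  have h1 := rpow_lintegral_mul_le volume hs hk hf
  rw [lintegral_sub_left_eq_self (heatKernel n t) x, lintegral_heatKernel n ht, ENNReal.one_rpow,
    one_mul] at h1
  have h2 : ∀ y, heatKernel n t y ≤ ENNReal.ofReal (t ^ (-(n : ℝ) / 2)) := by
    intro y
    refine ENNReal.ofReal_le_ofReal ?_
    calc _ ≤ (4 * Real.pi * t) ^ (-(n : ℝ) / 2) * 1 := by
          gcongr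
          rw [Real.exp_le_one_iff]
          have : 0 ≤ ‖y‖ ^ 2 / (4 * t) := by positivity
          rw [neg_div]
          linarith
      _ ≤ _ := by
          rw [mul_one]
          refine Real.rpow_le_rpow_of_nonpos ht ?_ ?_
          · have := Real.pi_gt_three
            nlinarith
          · have : (0 : ℝ) ≤ n := n.cast_nonneg
            linarith
  have h3 : ∫⁻ y, heatKernel n t (x - y) * f y ^ s ≤
      ENNReal.ofReal (t ^ (-(n : ℝ) / 2)) * ∫⁻ y, f y ^ s := by
    rw [← lintegral_const_mul _ (hf.pow_const _)]
    exact lintegral_mono fun y => mul_le_mul_left (h2 _) _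
  have h4 := ENNReal.rpow_le_rpow (h1.trans h3) (one_div_nonneg.2 hs0.le)
  rw [← ENNReal.rpow_mul, mul_one_div_cancel hs0.ne', ENNReal.rpow_one,
    ENNReal.mul_rpow_of_nonneg _ _ (one_div_nonneg.2 hs0.le),
    ENNReal.ofReal_rpow_of_pos (by positivity), ← Real.rpow_mul ht.le] at h4
  have e : -(n : ℝ) / 2 * (1 / s) = -(n / (2 * s)) := by ring
  rwa [e] at h4

/-- The weight in the representation of the Bessel kernel by heat kernels. -/
noncomputable def besselWeight (α t : ℝ) : ℝ :=
  t ^ (α / 2 - 1) * Real.exp (-t) / Real.Gamma (α / 2)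

lemma measurable_besselWeight (α : ℝ) : Measurable (besselWeight α) := by
  unfold besselWeight
  fun_prop

lemma ofReal_besselIntegrand (hα : 0 < α) (x : Rn n) {t : ℝ} (ht : 0 < t) :
    ENNReal.ofReal (besselIntegrand n α x t) =
      ENNReal.ofReal (besselWeight α t) * heatKernel n t x := by
  have := Real.Gamma_pos_of_pos (half_pos hα)
  rw [heatKernel, ← ENNReal.ofReal_mul (by unfold besselWeight; positivity)]
  rfl

lemma rpow_mul_exp_neg_le {a t : ℝ} (ha : 0 ≤ a) (ht : 0 < t) : t ^ a * Real.exp (-t) ≤ a ^ a := by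
  rcases ha.eq_or_lt with rfl | ha
  · simp [ht.le]
  · have h1 : t / a ≤ Real.exp (t / a) := by linarith [Real.add_one_le_exp (t / a)]
    have h2 := Real.rpow_le_rpow (by positivity) h1 ha.le
    rw [← Real.exp_mul, div_mul_cancel₀ _ ha.ne', Real.div_rpow ht.le ha.le,
      div_le_iff₀ (by positivity)] at h2
    rw [Real.exp_neg, ← div_eq_mul_inv, div_le_iff₀ (Real.exp_pos _), mul_comm]
    exact h2

/-- The constant in the power bound for the weight. -/
noncomputable def besselWeightConst (α β : ℝ) : ℝ :=
  ((α - β) / 2) ^ ((α - β) / 2) / Real.Gamma (α / 2)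

/-- The exponential absorbs the surplus power $t^{(\alpha-\beta)/2}$. The weight of order $\alpha$
is thus dominated by a Riesz weight of any smaller order $\beta$, which makes the subcritical range
$\beta s<n$ available even when $\alpha s=n$. -/
lemma besselWeight_le {β : ℝ} (hα : 0 < α) (hβ : β ≤ α) {t : ℝ} (ht : 0 < t) :
    besselWeight α t ≤ besselWeightConst α β * t ^ (β / 2 - 1) := by
  have hG := Real.Gamma_pos_of_pos (half_pos hα)
  have h := rpow_mul_exp_neg_le (a := (α - β) / 2) (by linarith) ht
  have e : t ^ (α / 2 - 1) = t ^ ((α - β) / 2) * t ^ (β / 2 - 1) := by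
    rw [← Real.rpow_add ht]
    ring_nf
  unfold besselWeight besselWeightConst
  rw [e, div_mul_eq_mul_div]
  refine (div_le_div_iff_of_pos_right hG).2 ?_
  calc _ = (t ^ ((α - β) / 2) * Real.exp (-t)) * t ^ (β / 2 - 1) := by ring
    _ ≤ _ := by gcongr

lemma besselWeightConst_nonneg {β : ℝ} (hα : 0 < α) (hβ : β ≤ α) : 0 ≤ besselWeightConst α β :=
  div_nonneg (Real.rpow_nonneg (by linarith) _) (Real.Gamma_pos_of_pos (half_pos hα)).le

lemma lintegral_Ioi_rpow {η τ : ℝ} (hη : 0 < η) (hτ : 0 < τ) :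
    ∫⁻ t in Ioi τ, ENNReal.ofReal (t ^ (-η - 1)) = ENNReal.ofReal (τ ^ (-η) / η) := by
  rw [← ofReal_integral_eq_lintegral_ofReal (integrableOn_Ioi_rpow_of_lt (by linarith) hτ)
    ((ae_restrict_iff' measurableSet_Ioi).2 (ae_of_all _ fun t ht =>
      Real.rpow_nonneg (hτ.trans ht).le _)), integral_Ioi_rpow_of_lt (by linarith) hτ]
  congr 1
  rw [sub_add_cancel, neg_div_neg_eq]

/-- The part of the Bessel kernel that comes from the times in `T`. -/
noncomputable def truncKernel (n : ℕ) (α : ℝ) (T : Set ℝ) (x : Rn n) : ℝ≥0∞ :=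
  ∫⁻ t in T, ENNReal.ofReal (besselWeight α t) * heatKernel n t x

lemma measurable_weight_mul_heatKernel (n : ℕ) (α : ℝ) :
    Measurable fun z : ℝ × Rn n => ENNReal.ofReal (besselWeight α z.1) * heatKernel n z.1 z.2 :=
  ((measurable_besselWeight α).comp measurable_fst).ennreal_ofReal.mul
    (measurable_uncurry_heatKernel n)

attribute [irreducible] heatKernel besselWeight

lemma Measurable.besselWeight_mul_heatKernel {Z : Type*} [MeasurableSpace Z] {u : Z → ℝ}
    {v : Z → Rn n} (hu : Measurable u) (hv : Measurable v) (α : ℝ) :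
    Measurable fun z => ENNReal.ofReal (besselWeight α (u z)) * heatKernel n (u z) (v z) :=
  ((measurable_besselWeight α).comp hu).ennreal_ofReal.mul
    ((measurable_uncurry_heatKernel n).comp (hu.prodMk hv))

lemma measurable_truncKernel (n : ℕ) (α : ℝ) (T : Set ℝ) : Measurable (truncKernel n α T) :=
  (measurable_weight_mul_heatKernel n α).lintegral_prod_left'

lemma lintegral_truncKernel (n : ℕ) (α : ℝ) {T : Set ℝ} (hT : MeasurableSet T)
    (hT0 : T ⊆ Ioi 0) :
    ∫⁻ x, truncKernel n α T x = ∫⁻ t in T, ENNReal.ofReal (besselWeight α t) := by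
  unfold truncKernel
  have hm : Measurable fun z : Rn n × ℝ =>
      ENNReal.ofReal (besselWeight α z.2) * heatKernel n z.2 z.1 :=
    measurable_snd.besselWeight_mul_heatKernel measurable_fst α
  rw [lintegral_lintegral_swap hm.aemeasurable]
  refine setLIntegral_congr_fun hT fun t ht => ?_
  rw [lintegral_const_mul _ (measurable_heatKernel n t), lintegral_heatKernel n (hT0 ht), mul_one]

lemma truncKernel_conv (n : ℕ) (α : ℝ) (T : Set ℝ) {f : Rn n → ℝ≥0∞} (hf : Measurable f)
    (x : Rn n) :
    ∫⁻ y, truncKernel n α T (x - y) * f y =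
      ∫⁻ t in T, ENNReal.ofReal (besselWeight α t) * ∫⁻ y, heatKernel n t (x - y) * f y := by
  have hm : Measurable fun z : Rn n × ℝ =>
      ENNReal.ofReal (besselWeight α z.2) * heatKernel n z.2 (x - z.1) * f z.1 := by
    refine Measurable.mul ?_ (hf.comp measurable_fst)
    exact measurable_snd.besselWeight_mul_heatKernel (measurable_const.sub measurable_fst) α
  calc _ = ∫⁻ y, ∫⁻ t in T,
        ENNReal.ofReal (besselWeight α t) * heatKernel n t (x - y) * f y := by
        refine lintegral_congr fun y => ?_
        rw [truncKernel, lintegral_mul_const]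
        exact measurable_id.besselWeight_mul_heatKernel measurable_const α
    _ = ∫⁻ t in T, ∫⁻ y,
        ENNReal.ofReal (besselWeight α t) * heatKernel n t (x - y) * f y :=
        lintegral_lintegral_swap hm.aemeasurable
    _ = _ := by
        refine lintegral_congr fun t => ?_
        simp_rw [mul_assoc]
        rw [lintegral_const_mul]
        exact ((measurable_heatKernel n t).comp (by fun_prop)).mul hf

/-- Short times give a kernel of small mass, long times a kernel whose potentials are bounded; the
time `τ` balances the two contributions. -/
lemma besselKernel_eq_add (hα : 0 < α) {τ : ℝ} (hτ : 0 < τ) (x : Rn n) :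
    besselKernel n α x = truncKernel n α (Ioc 0 τ) x + truncKernel n α (Ioi τ) x := by
  have : besselKernel n α x = truncKernel n α (Ioi 0) x :=
    setLIntegral_congr_fun measurableSet_Ioi fun t ht => ofReal_besselIntegrand hα x ht
  rw [this, truncKernel, ← Ioc_union_Ioi_eq_Ioi hτ.le,
    lintegral_union measurableSet_Ioi (Ioc_disjoint_Ioi le_rfl)]
  rfl

/-- The distributional estimate for Bessel potentials. -/
lemma volume_le_of_one_le_besselPotential (hα : 0 < α) (hs : 1 < s) {β : ℝ} (hβ : 0 < β)
    (hβα : β ≤ α) (hβn : β * s < n) {f : Rn n → ℝ≥0∞} (hf : Measurable f) {E : Set (Rn n)}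
    (hE : ∀ x ∈ E, 1 ≤ besselPotential n α f x) {τ : ℝ} (hτ : 0 < τ)
    (hsmall : ENNReal.ofReal (besselWeightConst α β *
      (τ ^ (-((n / s - β) / 2)) / ((n / s - β) / 2))) * (∫⁻ x, f x ^ s) ^ (1 / s) ≤ 1 / 2) :
    volume E ≤ 2 ^ s * (ENNReal.ofReal (besselWeightConst α β * (τ ^ (β / 2) / (β / 2))) ^ s *
      ∫⁻ x, f x ^ s) := by
  have hs0 : 0 < s := by linarith
  have hη : 0 < (n / s - β) / 2 := by
    have : β < n / s := (lt_div_iff₀ hs0).2 hβn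
    linarith
  have hC := besselWeightConst_nonneg hα hβα
  set k := truncKernel n α (Ioc 0 τ) with hk
  have hkm : Measurable k := measurable_truncKernel n α _
  -- Long times: the smoothing bound and the weight bound leave $\int_\tau^\infty t^{-\eta-1}\,dt$
  -- with $\eta=(n/s-\beta)/2>0$. By `hsmall` this contributes at most $1/2$ to the potential at
  -- every point.
  have hlarge : ∀ x, ∫⁻ y, truncKernel n α (Ioi τ) (x - y) * f y ≤ 1 / 2 := by
    intro x
    refine le_trans ?_ hsmall
    rw [truncKernel_conv n α _ hf, ENNReal.ofReal_mul hC, ← lintegral_Ioi_rpow hη hτ,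
      ← lintegral_const_mul' _ _ ENNReal.ofReal_ne_top,
      ← lintegral_mul_const _ (by fun_prop)]
    refine setLIntegral_mono' measurableSet_Ioi fun t ht => ?_
    have ht0 : 0 < t := hτ.trans ht
    calc _ ≤ ENNReal.ofReal (besselWeightConst α β * t ^ (β / 2 - 1)) *
          (ENNReal.ofReal (t ^ (-(n / (2 * s)) : ℝ)) * (∫⁻ y, f y ^ s) ^ (1 / s)) :=
          mul_le_mul' (ENNReal.ofReal_le_ofReal (besselWeight_le hα hβα ht0))
            (heatKernel_conv_le hs hf ht0 x)
      _ = _ := by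
          rw [← mul_assoc, ← ENNReal.ofReal_mul (by positivity), mul_assoc (besselWeightConst α β),
            ← Real.rpow_add ht0, ENNReal.ofReal_mul hC]
          congr 4
          field_simp
          ring
  have hmass : ∫⁻ x, k x ≤ ENNReal.ofReal (besselWeightConst α β * (τ ^ (β / 2) / (β / 2))) := by
    rw [hk, lintegral_truncKernel n α measurableSet_Ioc Ioc_subset_Ioi_self,
      ENNReal.ofReal_mul hC, ← lintegral_Ioo_rpow (half_pos hβ) hτ.le,
      ← lintegral_const_mul' _ _ ENNReal.ofReal_ne_top, ← restrict_Ioo_eq_restrict_Ioc]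
    refine setLIntegral_mono' measurableSet_Ioo fun t ht => ?_
    rw [← ENNReal.ofReal_mul hC]
    exact ENNReal.ofReal_le_ofReal (besselWeight_le hα hβα ht.1)
  -- Consequently the short-time part must be at least $1/2$ on `E`, and Chebyshev's and Young's
  -- inequalities bound the volume.
  have hsub : E ⊆ {x | (1 / 2 : ℝ≥0∞) ^ s ≤ (∫⁻ y, k (x - y) * f y) ^ s} := by
    intro x hx
    have h1 := hE x hx
    have h2 : besselPotential n α f x =
        (∫⁻ y, k (x - y) * f y) + ∫⁻ y, truncKernel n α (Ioi τ) (x - y) * f y := by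
      have hkx : Measurable fun y => k (x - y) := hkm.comp (by fun_prop)
      have hadd := lintegral_add_left (μ := volume) (hkx.mul hf)
        (fun y => truncKernel n α (Ioi τ) (x - y) * f y)
      simp only [Pi.mul_apply] at hadd
      rw [← hadd]
      refine lintegral_congr fun y => ?_
      rw [besselKernel_eq_add hα hτ, add_mul]
    rw [h2] at h1
    refine ENNReal.rpow_le_rpow ?_ hs0.le
    by_contra hlt
    have := ENNReal.add_lt_add_of_lt_of_le
      (ne_top_of_le_ne_top (by simp) (hlarge x)) (not_le.1 hlt) (hlarge x)
    rw [ENNReal.add_halves] at this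
    exact absurd h1 (not_le.2 this)
  have hm : Measurable fun x => (∫⁻ y, k (x - y) * f y) ^ s := by
    refine Measurable.pow_const ?_ _
    exact Measurable.lintegral_prod_right' (f := fun z : Rn n × Rn n => k (z.1 - z.2) * f z.2)
      ((hkm.comp (by fun_prop)).mul (hf.comp measurable_snd))
  have hmk := mul_meas_ge_le_lintegral (μ := volume) hm ((1 / 2 : ℝ≥0∞) ^ s)
  have h2s : (2 : ℝ≥0∞) ^ s * (1 / 2 : ℝ≥0∞) ^ s = 1 := by
    rw [← ENNReal.mul_rpow_of_nonneg _ _ hs0.le, one_div,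
      ENNReal.mul_inv_cancel (by simp) (by simp), ENNReal.one_rpow]
  calc volume E ≤ 2 ^ s * ((1 / 2 : ℝ≥0∞) ^ s * volume E) := by rw [← mul_assoc, h2s, one_mul]
    _ ≤ 2 ^ s * ∫⁻ x, (∫⁻ y, k (x - y) * f y) ^ s := by
        gcongr
        exact (mul_le_mul_right (measure_mono hsub) _).trans hmk
    _ ≤ 2 ^ s * ((∫⁻ x, k x) ^ s * ∫⁻ x, f x ^ s) := by
        gcongr
        exact lintegral_rpow_conv_le hs hkm hf
    _ ≤ _ := by gcongr

end CapacityVolume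

/-! ### Lower bounds for the capacity by the volume -/

section CapacityVolume

variable {n : ℕ} {α s : ℝ}

lemma le_mul_besselCap {a C : ℝ≥0∞} (hC0 : C ≠ 0) (hC : C ≠ ∞) {E : Set (Rn n)}
    (h : ∀ f : Rn n → ℝ≥0∞, Measurable f → (∀ x ∈ E, 1 ≤ besselPotential n α f x) →
      a ≤ C * ∫⁻ x, f x ^ s) : a ≤ C * besselCap n α s E := by
  rw [← ENNReal.div_le_iff' hC0 hC]
  refine le_iInf fun f => le_iInf fun hf => le_iInf fun hE => ?_
  rw [ENNReal.div_le_iff' hC0 hC]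
  exact h f hf hE

lemma lintegral_besselKernel_ne_top (n : ℕ) (hα : 0 < α) : ∫⁻ x, besselKernel n α x ≠ ∞ := by
  have h1 : ∀ x, besselKernel n α x = truncKernel n α (Ioi 0) x := fun x =>
    setLIntegral_congr_fun measurableSet_Ioi fun t ht => ofReal_besselIntegrand hα x ht
  simp_rw [h1]
  rw [lintegral_truncKernel n α measurableSet_Ioi subset_rfl]
  have hG := (Real.GammaIntegral_convergent (half_pos hα)).div_const (Real.Gamma (α / 2))
  refine ne_top_of_le_ne_top hG.2.ne (lintegral_mono fun t => ?_)
  refine le_trans (le_of_eq ?_) (Real.ofReal_le_enorm _)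
  unfold besselWeight
  ring_nf

/-- Convolution with the integrable kernel $G_\alpha$ is bounded on $L^s$, and Chebyshev's
inequality at level $1$ does the rest. -/
lemma volume_le_besselCap (n : ℕ) (hα : 0 < α) (hs : 1 < s) :
    ∃ C : ℝ≥0∞, C ≠ ∞ ∧ ∀ E : Set (Rn n), volume E ≤ C * besselCap n α s E := by
  have hs0 : 0 < s := by linarith
  set M := ∫⁻ x, besselKernel n α x with hM
  have hMs : M ^ s ≠ ∞ :=
    ENNReal.rpow_ne_top_of_nonneg hs0.le (lintegral_besselKernel_ne_top n hα)
  have hk := measurable_besselKernel n α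
  -- The maximum with $1$ keeps the constant nonzero, as the passage to the infimum divides by it.
  refine ⟨max (M ^ s) 1, by simp [hMs], fun E => le_mul_besselCap (by simp) (by simp [hMs]) ?_⟩
  intro f hf hE
  have hm : Measurable fun x => besselPotential n α f x ^ s := by
    refine Measurable.pow_const ?_ _
    exact Measurable.lintegral_prod_right'
      (f := fun z : Rn n × Rn n => besselKernel n α (z.1 - z.2) * f z.2)
      ((hk.comp (by fun_prop)).mul (hf.comp measurable_snd))
  have hsub : E ⊆ {x | 1 ≤ besselPotential n α f x ^ s} := fun x hx =>
    ENNReal.one_le_rpow (hE x hx) hs0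
  calc volume E ≤ volume {x | 1 ≤ besselPotential n α f x ^ s} := measure_mono hsub
    _ ≤ ∫⁻ x, besselPotential n α f x ^ s := by
        have := mul_meas_ge_le_lintegral (μ := volume) hm 1
        rwa [one_mul] at this
    _ ≤ M ^ s * ∫⁻ x, f x ^ s := lintegral_rpow_conv_le hs hk hf
    _ ≤ _ := mul_le_mul_left (le_max_left _ _) _

lemma volume_eq_zero_of_besselCap_eq_zero (hα : 0 < α) (hs : 1 < s) {E : Set (Rn n)}
    (h : besselCap n α s E = 0) : volume E = 0 := by
  obtain ⟨C, -, hC⟩ := volume_le_besselCap n hα hs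
  have := hC E
  rwa [h, mul_zero, nonpos_iff_eq_zero] at this

lemma besselWeightConst_pos {β : ℝ} (hα : 0 < α) (hβ : β ≤ α) : 0 < besselWeightConst α β := by
  refine div_pos ?_ (Real.Gamma_pos_of_pos (half_pos hα))
  rcases hβ.eq_or_lt with rfl | h
  · simp
  · exact Real.rpow_pos_of_pos (by linarith) _

/-- Sobolev type lower bound for the capacity in terms of the volume. -/
lemma volume_rpow_le_besselCap (hn : 0 < n) (hα : 0 < α) (hs : 1 < s) {δ : ℝ} (hδ : 0 < δ)
    (hδ1 : δ ≤ 1) (hδn : (n - α * s) / n ≤ δ) :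
    ∃ C : ℝ≥0∞, C ≠ ∞ ∧ ∀ E : Set (Rn n), volume E ^ δ ≤ C * besselCap n α s E := by
  rcases hδ1.eq_or_lt with rfl | hδ1
  · simpa using volume_le_besselCap n hα hs
  have hs0 : 0 < s := by linarith
  have hn0 : (0 : ℝ) < n := by exact_mod_cast hn
  -- The order for which $(n-\beta s)/n=\delta$, so that `δ` is the Sobolev exponent of $\beta$. The
  -- hypothesis on `δ` says exactly that $\beta\le\alpha$; $\delta=1$ was treated apart because it
  -- would give $\beta=0$.
  set β := (1 - δ) * n / s with hβdef
  have hβ : 0 < β := div_pos (mul_pos (by linarith) hn0) hs0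
  have hβα : β ≤ α := by
    rw [div_le_iff₀ hn0] at hδn
    rw [hβdef, div_le_iff₀ hs0]
    nlinarith
  have hβs : β * s = (1 - δ) * n := by rw [hβdef]; field_simp
  have hβn : β * s < n := by
    rw [hβs]
    nlinarith
  set η := (n / s - β) / 2 with hη
  have hηe : η = δ * n / (2 * s) := by rw [hη, hβdef]; field_simp; ring
  have hη0 : 0 < η := by rw [hηe]; positivity
  have hCw := besselWeightConst_pos hα hβα
  set A := besselWeightConst α β / η with hA
  set B := besselWeightConst α β / (β / 2) with hB
  have hA0 : 0 < A := div_pos hCw hη0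
  have hB0 : 0 < B := div_pos hCw (half_pos hβ)
  set D := 2 ^ s * B ^ s * (2 * A) ^ (β * s / (2 * η)) with hD
  have hD0 : 0 < D := by positivity
  refine ⟨ENNReal.ofReal (D ^ δ), ENNReal.ofReal_ne_top, fun E =>
    le_mul_besselCap (by simpa using by positivity) ENNReal.ofReal_ne_top fun f hf hE => ?_⟩
  have key := fun τ hτ => volume_le_of_one_le_besselPotential hα hs hβ hβα hβn hf hE (τ := τ) hτ
  rcases eq_or_ne (∫⁻ x, f x ^ s) ∞ with htop | htop
  · rw [htop, ENNReal.mul_top (by simpa using by positivity)]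
    exact le_top
  rcases eq_or_ne (∫⁻ x, f x ^ s) 0 with hzero | hzero
  · have h1 := key 1 one_pos (by
      rw [hzero, ENNReal.zero_rpow_of_pos (by positivity), mul_zero]
      exact zero_le)
    rw [hzero, mul_zero, mul_zero, nonpos_iff_eq_zero] at h1
    rw [h1, ENNReal.zero_rpow_of_pos hδ]
    exact zero_le
  set φ := (∫⁻ x, f x ^ s).toReal with hφ
  have hφ0 : 0 < φ := ENNReal.toReal_pos hzero htop
  have hΦ : ∫⁻ x, f x ^ s = ENNReal.ofReal φ := (ENNReal.ofReal_toReal htop).symm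
  -- Solves $A\tau^{-\eta}\varphi^{1/s}=1/2$, which makes the long-time contribution exactly the
  -- permitted $1/2$. The resulting volume bound is $D\varphi^{1/\delta}$.
  set τ := (2 * A * φ ^ (1 / s)) ^ (1 / η) with hτ
  have hτ0 : 0 < τ := by positivity
  have h1 := key τ hτ0 (by
    rw [hΦ, ENNReal.ofReal_rpow_of_pos hφ0, ← ENNReal.ofReal_mul (by positivity)]
    have : besselWeightConst α β * (τ ^ (-η) / η) * φ ^ (1 / s) = 1 / 2 := by
      rw [hτ, ← Real.rpow_mul (by positivity), one_div_mul_eq_div, neg_div, div_self hη0.ne',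
        Real.rpow_neg (by positivity), Real.rpow_one]
      rw [hA]
      field_simp
    rw [this, ENNReal.ofReal_div_of_pos two_pos, ENNReal.ofReal_one, ENNReal.ofReal_ofNat])
  have h2 : volume E ≤ ENNReal.ofReal (D * φ ^ (1 / δ)) := by
    refine h1.trans (le_of_eq ?_)
    rw [hΦ, ENNReal.ofReal_rpow_of_pos (by positivity), ← ENNReal.ofReal_mul (by positivity),
      ← ENNReal.ofReal_ofNat, ENNReal.ofReal_rpow_of_pos two_pos,
      ← ENNReal.ofReal_mul (by positivity)]
    congr 1
    have e1 : besselWeightConst α β * (τ ^ (β / 2) / (β / 2)) = B * τ ^ (β / 2) := by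
      rw [hB]; ring
    have e2 : (τ ^ (β / 2)) ^ s = (2 * A) ^ (β * s / (2 * η)) * φ ^ (1 / δ - 1) := by
      rw [hτ, ← Real.rpow_mul (by positivity), ← Real.rpow_mul (by positivity),
        Real.mul_rpow (by positivity) (by positivity), ← Real.rpow_mul hφ0.le]
      congr 2
      · field_simp
      · rw [hηe, hβdef]
        field_simp
    rw [e1, Real.mul_rpow hB0.le (by positivity), e2, Real.rpow_sub_one hφ0.ne', hD]
    field_simp
  calc volume E ^ δ ≤ ENNReal.ofReal (D * φ ^ (1 / δ)) ^ δ := ENNReal.rpow_le_rpow h2 hδ.le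
    _ = _ := by
      rw [hΦ, ENNReal.ofReal_rpow_of_pos (by positivity), ← ENNReal.ofReal_mul (by positivity),
        Real.mul_rpow hD0.le (by positivity), ← Real.rpow_mul hφ0.le,
        one_div_mul_cancel hδ.ne', Real.rpow_one]

end CapacityVolume

/-- Passes to the infimum defining a block norm. The separate case `N = 0` and the restriction to
finite `c` avoid the products of zero and infinity. -/
lemma le_mul_of_forall_lt_le_mul {X N b : ℝ≥0∞} (hN : N ≠ ∞) (hb : b ≠ ∞)
    (h : ∀ c, b < c → c ≠ ∞ → X ≤ N * c) : X ≤ N * b := by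
  rcases eq_or_ne N 0 with rfl | hN0
  · have := h (b + 1) (ENNReal.lt_add_right hb one_ne_zero) (by simp [hb])
    simpa using this
  · rw [← ENNReal.div_le_iff' hN0 hN]
    refine le_of_forall_gt_imp_ge_of_dense fun c hc => ?_
    rcases eq_or_ne c ∞ with rfl | hct
    · exact le_top
    rw [ENNReal.div_le_iff' hN0 hN]
    exact h c hc hct

section Lorentz

variable {n : ℕ} {p q : ℝ}

lemma lorentzNorm_eq_zero_of_ae (hp : 0 < p) (hq : 0 < q) {f : Rn n → ℝ}
    (h : ∀ᵐ x, f x = 0) : lorentzNorm n p q f = 0 := by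
  have h0 : lorentzNorm n p q (fun _ : Rn n => (0 : ℝ)) = 0 := by
    have := lorentzNorm_le_of_bound hp hq (f := fun _ : Rn n => (0 : ℝ)) (A := ∅) le_rfl
      (by simp) (by simp)
    rw [measure_empty, ENNReal.zero_rpow_of_pos (by positivity), zero_mul, mul_zero,
      ENNReal.zero_rpow_of_pos (by positivity)] at this
    exact nonpos_iff_eq_zero.1 this
  rw [← h0]
  exact lorentzNorm_congr_abs_ae hp hq (h.mono fun x hx => by rw [hx])

end Lorentz

/-! ### Pairing of blocks with multipliers -/

section Blocks

variable {n : ℕ} {α s r p q r' p' q' : ℝ}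

lemma isBlock_iff (hr : r.HolderConjugate r') {b : Rn n → ℝ} :
    IsBlock n α s r' p' q' b ↔ AEStronglyMeasurable b volume ∧
      ∃ E : Set (Rn n), Bornology.IsBounded E ∧ {x | b x ≠ 0} ⊆ E ∧
        besselCap n α s E ^ (1 / r) * lorentzNorm n p' q' b ≤ 1 := by
  rw [IsBlock, hr.symm.conjExponent_eq]

/-- A function with bounded support has block norm at most its capacity-weighted Lorentz norm. -/
lemma blockNorm_le_of_support (hr : r.HolderConjugate r') (hq' : 0 < q') {F : MeasFun n}
    {f : Rn n → ℝ} (hF : F =ᵐ[volume] f) {E : Set (Rn n)}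
    (hE : Bornology.IsBounded E) (hfE : {x | f x ≠ 0} ⊆ E) :
    blockNorm n α s r' p' q' F ≤ besselCap n α s E ^ (1 / r) * lorentzNorm n p' q' f := by
  have hf : AEStronglyMeasurable f volume := F.aestronglyMeasurable.congr hF
  refine le_of_forall_gt_imp_ge_of_dense fun c hc => ?_
  rcases eq_or_ne c ∞ with rfl | hct
  · exact le_top
  have hc0 : 0 < c.toReal := ENNReal.toReal_pos (ne_bot_of_gt hc) hct
  -- For every `c` above the weighted norm, $c^{-1}f$ is a block, and $f$ is decomposed with the
  -- single nonzero coefficient $c$ at index $0$. Taking `c` strictly above the norm also covers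
  -- norm zero.
  set l : ℕ → ℝ := fun k => if k = 0 then c.toReal else 0 with hl
  have hd : IsBlockDecomp n α s r' p' q' F l (fun _ x => c.toReal⁻¹ * f x) := by
    refine ⟨?_, fun _ => ?_, ?_⟩
    · refine summable_of_ne_finset_zero (s := {0}) fun k hk => ?_
      simp only [Finset.mem_singleton] at hk
      simp [hl, hk]
    · rw [isBlock_iff hr]
      refine ⟨hf.const_mul _, E, hE, fun x hx => hfE ?_, ?_⟩
      · exact fun h0 => hx (by simp [h0])
      · rw [lorentzNorm_const_mul hq' (inv_pos.2 hc0), mul_left_comm,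
          ENNReal.ofReal_inv_of_pos hc0, ENNReal.ofReal_toReal hct, mul_comm,
          ← div_eq_mul_inv]
        exact ENNReal.div_le_of_le_mul (by rw [one_mul]; exact hc.le)
    · filter_upwards [hF] with x hx
      refine tendsto_const_nhds.congr' ?_
      filter_upwards [eventually_gt_atTop 0] with N hN
      rw [Finset.sum_eq_single_of_mem 0 (Finset.mem_range.2 hN)]
      · simp only [hl, if_true]
        rw [mul_inv_cancel_left₀ hc0.ne', hx]
      · intro k _ hk
        simp [hl, hk]
  refine hd.blockNorm_le.trans (le_of_eq ?_)
  rw [tsum_eq_single 0 fun k hk => by simp [hl, hk]]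
  simp only [hl, if_true]
  rw [abs_of_pos hc0, ENNReal.ofReal_toReal hct]

lemma exists_isBlockDecomp_lt {F : MeasFun n} {c : ℝ≥0∞} (h : blockNorm n α s r' p' q' F < c) :
    ∃ l b, IsBlockDecomp n α s r' p' q' F l b ∧ ∑' k, ENNReal.ofReal |l k| < c := by
  simp only [blockNorm, iInf_lt_iff] at h
  obtain ⟨l, b, hd, h⟩ := h
  exact ⟨l, b, hd, h⟩

/-- The supremum in `multNorm` omits compact sets of capacity zero, but these are Lebesgue null and
make the left side vanish. -/
lemma lorentzNorm_indicator_le_multNorm (hα : 0 < α) (hs : 1 < s) (hr : 0 < r) (hp : 0 < p)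
    (hq : 0 < q) (g : MeasFun n) {K : Set (Rn n)} (hK : IsCompact K) :
    lorentzNorm n p q (K.indicator g) ≤ multNorm n α s r p q g * besselCap n α s K ^ (1 / r) := by
  rcases eq_or_ne (besselCap n α s K) 0 with h0 | h0
  · have hv := volume_eq_zero_of_besselCap_eq_zero hα hs h0
    rw [lorentzNorm_eq_zero_of_ae hp hq]
    · exact zero_le
    · filter_upwards [measure_eq_zero_iff_ae_notMem.1 hv] with x hx
      exact indicator_of_notMem hx _
  · have ht := besselCap_ne_top hα (by linarith : 0 < s) hK.isBounded
    have h1 : besselCap n α s K ^ (1 / r) ≠ 0 :=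
      (ENNReal.rpow_pos (pos_iff_ne_zero.2 h0) ht).ne'
    have h2 : besselCap n α s K ^ (1 / r) ≠ ∞ := ENNReal.rpow_ne_top_of_nonneg (by positivity) ht
    rw [← ENNReal.div_le_iff h1 h2]
    exact le_iSup₂_of_le K hK (le_iSup_of_le h0 le_rfl)

/-- By inner regularity an increasing sequence of compact sets exhausts `T` up to a null set. This
bridges multipliers, tested only on compact sets, and blocks, which live on arbitrary bounded sets.
-/
lemma setLIntegral_le_of_forall_isCompact {h : Rn n → ℝ≥0∞} {T : Set (Rn n)}
    (hT : NullMeasurableSet T volume) (hTv : volume T ≠ ∞) {D : ℝ≥0∞}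
    (hD : ∀ K, IsCompact K → K ⊆ T → ∫⁻ x in K, h x ≤ D) : ∫⁻ x in T, h x ≤ D := by
  obtain ⟨S, hST, hS, hSe⟩ := hT.exists_measurable_subset_ae_eq
  have hSv : volume S ≠ ∞ := measure_ne_top_of_subset hST hTv
  have : ∀ k : ℕ, ∃ K ⊆ S, IsCompact K ∧ volume (S \ K) < ((k : ℝ≥0∞) + 1)⁻¹ := fun k =>
    hS.exists_isCompact_sdiff_lt hSv (by simp)
  choose K hKS hK hKv using this
  have hae : (⋃ k, Set.accumulate K k : Set (Rn n)) =ᵐ[volume] T := by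
    rw [Set.iUnion_accumulate]
    refine EventuallyEq.trans ((LE.le.eventuallyLE (iUnion_subset hKS)).antisymm ?_) hSe
    refine ae_le_set.2 ?_
    refine le_antisymm (ge_of_tendsto' (ENNReal.tendsto_inv_nat_nhds_zero.comp
      (tendsto_add_atTop_nat 1)) fun k => ?_) zero_le
    refine (measure_mono (sdiff_subset_sdiff_right (subset_iUnion K k))).trans ((hKv k).le.trans ?_)
    simp
  rw [← setLIntegral_congr hae, setLIntegral_iUnion_of_directed _
    (Set.monotone_accumulate.directed_le)]
  refine iSup_le fun k => hD _ (isCompact_accumulate hK k) ?_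
  refine (Set.accumulate_subset_iUnion k).trans (iUnion_subset fun k => (hKS k).trans hST)

/-- Hölder's inequality between a block and a multiplier. -/
lemma IsBlock.lintegral_mul_le (hα : 0 < α) (hs : 1 < s) (hr : r.HolderConjugate r')
    (hp : p.HolderConjugate p') (hq : q.HolderConjugate q') {b : Rn n → ℝ}
    (hb : IsBlock n α s r' p' q' b) (g : MeasFun n) :
    ∫⁻ x, ENNReal.ofReal |b x * g x| ≤ multNorm n α s r p q g := by
  obtain ⟨hbm, E, hE, hbE, hle⟩ := (isBlock_iff hr).1 hb
  -- The set `E` need not be measurable, so integration takes place on the null measurable set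
  -- $\{b\ne0\}\subseteq E$, and `E` enters only through monotonicity of the capacity.
  set T : Set (Rn n) := {x | b x ≠ 0} with hT
  have hTm : NullMeasurableSet T volume :=
    hbm.aemeasurable.nullMeasurable (measurableSet_singleton 0).compl
  have hTv : volume T ≠ ∞ := ((hE.subset hbE).measure_lt_top).ne
  have h1 : ∫⁻ x, ENNReal.ofReal |b x * g x| = ∫⁻ x in T, ENNReal.ofReal |b x * g x| := by
    refine (setLIntegral_eq_of_support_subset ?_).symm
    intro x hx
    by_contra h0
    have h0 : b x = 0 := not_not.1 h0
    simp [h0] at hx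
  rw [h1]
  refine setLIntegral_le_of_forall_isCompact hTm hTv fun K hK hKT => ?_
  have hcap : besselCap n α s K ≤ besselCap n α s E := besselCap_mono (hKT.trans hbE)
  calc ∫⁻ x in K, ENNReal.ofReal |b x * g x|
      = ∫⁻ x, ENNReal.ofReal |K.indicator g x * b x| := by
        rw [← lintegral_indicator hK.measurableSet]
        refine lintegral_congr fun x => ?_
        by_cases hx : x ∈ K <;> simp [hx, mul_comm]
    _ ≤ lorentzNorm n p q (K.indicator g) * lorentzNorm n p' q' b :=
        lintegral_abs_mul_le_lorentzNorm hp hq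
          (g.aestronglyMeasurable.indicator hK.measurableSet) hbm
    _ ≤ (multNorm n α s r p q g * besselCap n α s E ^ (1 / r)) * lorentzNorm n p' q' b := by
        refine mul_le_mul_left ((lorentzNorm_indicator_le_multNorm hα hs hr.pos hp.pos hq.pos g
          hK).trans ?_) _
        exact mul_le_mul_right (ENNReal.rpow_le_rpow hcap (one_div_nonneg.2 hr.nonneg)) _
    _ ≤ multNorm n α s r p q g * 1 := by
        rw [mul_assoc]
        exact mul_le_mul_right hle _
    _ = _ := mul_one _

/-- Hölder's inequality between block spaces and multiplier spaces. -/
lemma lintegral_mul_le_multNorm_mul_blockNorm (hα : 0 < α) (hs : 1 < s)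
    (hr : r.HolderConjugate r') (hp : p.HolderConjugate p') (hq : q.HolderConjugate q')
    {F g : MeasFun n} (hg : multNorm n α s r p q g < ∞)
    (hF : blockNorm n α s r' p' q' F < ∞) :
    ∫⁻ x, ENNReal.ofReal |F x * g x| ≤ multNorm n α s r p q g * blockNorm n α s r' p' q' F := by
  refine le_mul_of_forall_lt_le_mul hg.ne hF.ne fun c hc _ => ?_
  obtain ⟨l, b, ⟨-, hb, hlim⟩, hlt⟩ := exists_isBlockDecomp_lt hc
  -- Only the upper bound $|Fg|\le\sum_k|\lambda_k||b_kg|$ is needed, and almost everywhere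
  -- convergence of the partial sums suffices for it.
  calc ∫⁻ x, ENNReal.ofReal |F x * g x|
      ≤ ∫⁻ x, ∑' k, ENNReal.ofReal |l k| * ENNReal.ofReal |b k x * g x| := by
        refine lintegral_mono_ae ?_
        filter_upwards [hlim] with x hx
        have h1 := ENNReal.tendsto_ofReal (hx.mul_const (g x)).abs
        refine le_of_tendsto' h1 fun N => ?_
        calc ENNReal.ofReal |(∑ k ∈ Finset.range N, l k * b k x) * g x|
            ≤ ENNReal.ofReal (∑ k ∈ Finset.range N, |l k| * |b k x * g x|) := by
              refine ENNReal.ofReal_le_ofReal ?_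
              rw [Finset.sum_mul]
              refine (Finset.abs_sum_le_sum_abs _ _).trans (le_of_eq ?_)
              refine Finset.sum_congr rfl fun k _ => ?_
              rw [mul_assoc, abs_mul]
          _ = ∑ k ∈ Finset.range N, ENNReal.ofReal |l k| * ENNReal.ofReal |b k x * g x| := by
              rw [ENNReal.ofReal_sum_of_nonneg fun _ _ => by positivity]
              exact Finset.sum_congr rfl fun k _ => ENNReal.ofReal_mul (abs_nonneg _)
          _ ≤ _ := ENNReal.sum_le_tsum _
    _ = ∑' k, ENNReal.ofReal |l k| * ∫⁻ x, ENNReal.ofReal |b k x * g x| := by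
        rw [lintegral_tsum fun k => ?_]
        · exact tsum_congr fun k => lintegral_const_mul' _ _ ENNReal.ofReal_ne_top
        · exact (((hb k).1.aemeasurable.mul g.aestronglyMeasurable.aemeasurable).abs
            |>.ennreal_ofReal).const_mul _
    _ ≤ ∑' k, ENNReal.ofReal |l k| * multNorm n α s r p q g :=
        ENNReal.tsum_le_tsum fun k =>
          mul_le_mul_right ((hb k).lintegral_mul_le hα hs hr hp hq g) _
    _ = multNorm n α s r p q g * ∑' k, ENNReal.ofReal |l k| := by
        rw [ENNReal.tsum_mul_right, mul_comm]
    _ ≤ _ := mul_le_mul_right hlt.le _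

end Blocks

/-! ### Testing multipliers on simple functions; the Köthe dual -/

section Testing

variable {n : ℕ} {α s r p q r' p' q' : ℝ}

/-- The norming property on each compact set, with the power of the capacity carried along; `D`
becomes either the Köthe norm or the norm of a functional. -/
lemma multNorm_le_of_forall_simpleFunc (hα : 0 < α) (hs : 1 < s) (hr : 0 < r)
    (hp : p.HolderConjugate p') (hq : q.HolderConjugate q') (g : MeasFun n) {D : ℝ≥0∞}
    (h : ∀ K : Set (Rn n), IsCompact K → ∀ φ : SimpleFunc (Rn n) NNReal,
      (∀ x, x ∉ K → φ x = 0) → ∫⁻ x, ENNReal.ofReal |φ x * g x| ≤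
        D * (besselCap n α s K ^ (1 / r) * lorentzNorm n p' q' (fun x => φ x))) :
    multNorm n α s r p q g ≤ normingConst p q p' q' * D := by
  refine iSup_le fun K => iSup_le fun hK => iSup_le fun hK0 => ?_
  have ht := besselCap_ne_top hα (by linarith : 0 < s) hK.isBounded
  have h1 : besselCap n α s K ^ (1 / r) ≠ 0 := (ENNReal.rpow_pos (pos_iff_ne_zero.2 hK0) ht).ne'
  have h2 : besselCap n α s K ^ (1 / r) ≠ ∞ := ENNReal.rpow_ne_top_of_nonneg (by positivity) ht
  rw [ENNReal.div_le_iff h1 h2, mul_assoc]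
  refine lorentzNorm_indicator_le_of_forall_simpleFunc hp hq g.stronglyMeasurable.measurable
    hK.measurableSet hK.measure_lt_top.ne fun φ hφ => ?_
  rw [mul_assoc]
  exact h K hK φ hφ

lemma SimpleFunc.lorentzNorm_lt_top (hp : 0 < p) (hq : 0 < q) (ψ : SimpleFunc (Rn n) ℝ)
    {A : Set (Rn n)} (hA : ∀ x, x ∉ A → ψ x = 0) (hv : volume A ≠ ∞) :
    lorentzNorm n p q ψ < ∞ := by
  obtain ⟨C, hC⟩ := ψ.exists_forall_norm_le
  exact lorentzNorm_lt_top_of_bound hp hq hC hA hv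

lemma weighted_lorentzNorm_lt_top (hα : 0 < α) (hs : 1 < s) (hr : 0 < r) {E : Set (Rn n)}
    (hE : Bornology.IsBounded E) {f : Rn n → ℝ} (hf : lorentzNorm n p q f < ∞) :
    besselCap n α s E ^ (1 / r) * lorentzNorm n p q f < ∞ :=
  ENNReal.mul_lt_top (ENNReal.rpow_lt_top_of_nonneg (by positivity)
    (besselCap_ne_top hα (by linarith) hE)) hf

/-- Homogeneity: `F` is divided by a number above its block norm rather than by the norm itself,
which might vanish. -/
lemma lintegral_mul_le_kotheNorm_mul_blockNorm {F g : MeasFun n}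
    (hg : kotheNorm n (blockNorm n α s r' p' q') g ≠ ∞)
    (hF : blockNorm n α s r' p' q' F < ∞) :
    ∫⁻ x, ENNReal.ofReal |F x * g x| ≤
      kotheNorm n (blockNorm n α s r' p' q') g * blockNorm n α s r' p' q' F := by
  refine le_mul_of_forall_lt_le_mul hg hF.ne fun c hc hct => ?_
  have hc0 : 0 < c.toReal := ENNReal.toReal_pos (ne_bot_of_gt hc) hct
  have h1 : blockNorm n α s r' p' q' (c.toReal⁻¹ • F) ≤ 1 := by
    refine (blockNorm_smul_le _ hF).trans ?_
    rw [abs_of_pos (inv_pos.2 hc0), ENNReal.ofReal_inv_of_pos hc0, ENNReal.ofReal_toReal hct,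
      mul_comm, ← div_eq_mul_inv]
    exact ENNReal.div_le_of_le_mul (by rw [one_mul]; exact hc.le)
  have h2 : ∫⁻ x, ENNReal.ofReal |g x * (c.toReal⁻¹ • F) x| ≤
      kotheNorm n (blockNorm n α s r' p' q') g :=
    le_iSup₂_of_le (f := fun (G : MeasFun n) (_ : blockNorm n α s r' p' q' G ≤ 1) =>
      ∫⁻ x, ENNReal.ofReal |g x * G x|) (c.toReal⁻¹ • F) h1 le_rfl
  have h3 : ∫⁻ x, ENNReal.ofReal |F x * g x| =
      c * ∫⁻ x, ENNReal.ofReal |g x * (c.toReal⁻¹ • F) x| := by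
    rw [← lintegral_const_mul' _ _ hct]
    refine lintegral_congr_ae ?_
    filter_upwards [AEEqFun.coeFn_smul c.toReal⁻¹ F] with x hx
    rw [hx, Pi.smul_apply, smul_eq_mul, ← ENNReal.ofReal_toReal hct,
      ← ENNReal.ofReal_mul hc0.le, ENNReal.toReal_ofReal hc0.le]
    congr 1
    rw [abs_mul, abs_mul, abs_mul, abs_of_pos (inv_pos.2 hc0)]
    field_simp
  rw [h3, mul_comm]
  exact mul_le_mul_left h2 _

/-- The multiplier space is the Köthe dual of the block space. -/
lemma isomorphic_multNorm_kotheNorm (hα : 0 < α) (hs : 1 < s) (hr : r.HolderConjugate r')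
    (hp : p.HolderConjugate p') (hq : q.HolderConjugate q') :
    Isomorphic n (multNorm n α s r p q) (kotheNorm n (blockNorm n α s r' p' q')) := by
  have hNt := normingConst_ne_top (p := p) (p' := p') hq.pos hq.symm.pos
  constructor
  · refine ⟨1, one_pos, fun g => ?_⟩
    rw [ENNReal.ofReal_one, one_mul]
    rcases eq_or_ne (multNorm n α s r p q g) ∞ with h | h
    · rw [h]
      exact le_top
    · refine iSup₂_le fun F hF => ?_
      have h1 := lintegral_mul_le_multNorm_mul_blockNorm hα hs hr hp hq h.lt_top
        (hF.trans_lt ENNReal.one_lt_top)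
      simp_rw [mul_comm (F _)] at h1
      exact h1.trans ((mul_le_mul_right hF _).trans_eq (mul_one _))
  · refine ⟨(normingConst p q p' q').toReal + 1, by positivity, fun g => ?_⟩
    have hC : normingConst p q p' q' ≤ ENNReal.ofReal ((normingConst p q p' q').toReal + 1) := by
      rw [ENNReal.ofReal_add ENNReal.toReal_nonneg zero_le_one, ENNReal.ofReal_toReal hNt]
      exact le_self_add
    rcases eq_or_ne (kotheNorm n (blockNorm n α s r' p' q') g) ∞ with h | h
    · rw [h, ENNReal.mul_top]
      · exact le_top
      · simpa using by positivity
    · refine (multNorm_le_of_forall_simpleFunc hα hs hr.pos hp hq g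
        (fun K hK φ hφ => ?_)).trans (mul_le_mul_left hC _)
      set ψ : SimpleFunc (Rn n) ℝ := φ.map (fun x : NNReal => (x : ℝ)) with hψ
      set F : MeasFun n := AEEqFun.mk ψ ψ.aestronglyMeasurable with hF
      have hFψ : F =ᵐ[volume] ψ := AEEqFun.coeFn_mk _ _
      have hψ0 : ∀ x, x ∉ K → ψ x = 0 := fun x hx => by simp [hψ, hφ x hx]
      have hle := blockNorm_le_of_support (α := α) (s := s) (p' := p') hr hq.symm.pos hFψ
        hK.isBounded (fun x hx => by_contra fun hxK => hx (hψ0 x hxK))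
      have hlt := weighted_lorentzNorm_lt_top hα hs hr.pos hK.isBounded
        (SimpleFunc.lorentzNorm_lt_top hp.symm.pos hq.symm.pos ψ hψ0 hK.measure_lt_top.ne)
      calc ∫⁻ x, ENNReal.ofReal |φ x * g x| = ∫⁻ x, ENNReal.ofReal |F x * g x| := by
            refine lintegral_congr_ae ?_
            filter_upwards [hFψ] with x hx
            rw [hx]
            rfl
        _ ≤ _ := lintegral_mul_le_kotheNorm_mul_blockNorm h (hle.trans_lt hlt)
        _ ≤ _ := mul_le_mul_right hle _

end Testing

/-! ### Multipliers as continuous functionals on block spaces -/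

section Pairing

variable {n : ℕ} {α s r p q r' p' q' : ℝ} [Fact (1 < p')] [Fact (1 < q')]

lemma BlockSpace.ext_ae {F G : BlockSpace n α s r' p' q'} (h : F.1 =ᵐ[volume] G.1) : F = G :=
  Subtype.ext (AEEqFun.ext h)

lemma BlockSpace.blockNorm_lt_top (F : BlockSpace n α s r' p' q') :
    blockNorm n α s r' p' q' F.1 < ∞ :=
  blockNorm_lt_top_iff.2 F.2

lemma BlockSpace.ofReal_norm (F : BlockSpace n α s r' p' q') :
    ENNReal.ofReal ‖F‖ = blockNorm n α s r' p' q' F.1 := by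
  rw [BlockSpace.norm_def, ENNReal.ofReal_toReal F.blockNorm_lt_top.ne]

lemma BlockSpace.coe_add (F G : BlockSpace n α s r' p' q') :
    (F + G).1 =ᵐ[volume] fun x => F.1 x + G.1 x :=
  AEEqFun.coeFn_add F.1 G.1

lemma BlockSpace.coe_sub (F G : BlockSpace n α s r' p' q') :
    (F - G).1 =ᵐ[volume] fun x => F.1 x - G.1 x :=
  AEEqFun.coeFn_sub F.1 G.1

lemma BlockSpace.coe_smul (c : ℝ) (F : BlockSpace n α s r' p' q') :
    (c • F).1 =ᵐ[volume] fun x => c * F.1 x :=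
  AEEqFun.coeFn_smul c F.1

/-- Functions with bounded support and finite Lorentz norm belong to the block space. -/
lemma exists_blockSpace_ae_eq (hα : 0 < α) (hs : 1 < s) (hr : r.HolderConjugate r')
    {f : Rn n → ℝ} (hf : AEStronglyMeasurable f volume)
    {E : Set (Rn n)} (hE : Bornology.IsBounded E) (hfE : ∀ x, x ∉ E → f x = 0)
    (hfin : lorentzNorm n p' q' f < ∞) :
    ∃ F : BlockSpace n α s r' p' q', F.1 =ᵐ[volume] f ∧
      ENNReal.ofReal ‖F‖ ≤ besselCap n α s E ^ (1 / r) * lorentzNorm n p' q' f := by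
  have hq' : 0 < q' := zero_lt_one.trans (Fact.out : 1 < q')
  have hFf : (AEEqFun.mk f hf : MeasFun n) =ᵐ[volume] f := AEEqFun.coeFn_mk _ _
  have hle := blockNorm_le_of_support (α := α) (s := s) (p' := p') hr hq' hFf hE
    (fun x hx => by_contra fun hxE => hx (hfE x hxE))
  have hlt := hle.trans_lt (weighted_lorentzNorm_lt_top hα hs hr.pos hE hfin)
  let F : BlockSpace n α s r' p' q' := ⟨AEEqFun.mk f hf, blockNorm_lt_top_iff.1 hlt⟩
  refine ⟨F, hFf, ?_⟩
  rw [F.ofReal_norm]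
  exact hle

lemma BlockSpace.lintegral_mul_le (hα : 0 < α) (hs : 1 < s)
    (hr : r.HolderConjugate r') (hp : p.HolderConjugate p') (hq : q.HolderConjugate q')
    (F : BlockSpace n α s r' p' q') {g : MeasFun n} (hg : multNorm n α s r p q g < ∞) :
    ∫⁻ x, ENNReal.ofReal |F.1 x * g x| ≤
      ENNReal.ofReal ((multNorm n α s r p q g).toReal * ‖F‖) := by
  rw [ENNReal.ofReal_mul ENNReal.toReal_nonneg, ENNReal.ofReal_toReal hg.ne, F.ofReal_norm]
  exact lintegral_mul_le_multNorm_mul_blockNorm hα hs hr hp hq hg F.blockNorm_lt_top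

lemma BlockSpace.integrable_mul (hα : 0 < α) (hs : 1 < s)
    (hr : r.HolderConjugate r') (hp : p.HolderConjugate p') (hq : q.HolderConjugate q')
    (F : BlockSpace n α s r' p' q') {g : MeasFun n} (hg : multNorm n α s r p q g < ∞) :
    Integrable fun x => F.1 x * g x := by
  refine ⟨F.1.aestronglyMeasurable.mul g.aestronglyMeasurable, ?_⟩
  have := F.lintegral_mul_le hα hs hr hp hq hg
  simp_rw [← Real.enorm_eq_ofReal_abs] at this
  exact this.trans_lt ENNReal.ofReal_lt_top

lemma BlockSpace.abs_integral_mul_le (hα : 0 < α) (hs : 1 < s)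
    (hr : r.HolderConjugate r') (hp : p.HolderConjugate p') (hq : q.HolderConjugate q')
    (F : BlockSpace n α s r' p' q') {g : MeasFun n} (hg : multNorm n α s r p q g < ∞) :
    |∫ x, F.1 x * g x| ≤ (multNorm n α s r p q g).toReal * ‖F‖ := by
  have h1 := F.lintegral_mul_le hα hs hr hp hq hg
  have h2 := norm_integral_le_lintegral_norm (μ := volume) (fun x => F.1 x * g x)
  refine h2.trans (ENNReal.toReal_le_of_le_ofReal (by positivity) ?_)
  exact h1

lemma exists_represents (hα : 0 < α) (hs : 1 < s)
    (hr : r.HolderConjugate r') (hp : p.HolderConjugate p') (hq : q.HolderConjugate q')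
    {g : MeasFun n} (hg : multNorm n α s r p q g < ∞) :
    ∃ L : BlockSpace n α s r' p' q' →L[ℝ] ℝ, Represents g L := by
  have hI := fun F : BlockSpace n α s r' p' q' => F.integrable_mul hα hs hr hp hq hg
  let L₀ : BlockSpace n α s r' p' q' →ₗ[ℝ] ℝ :=
    { toFun := fun F => ∫ x, F.1 x * g x
      map_add' := fun F G => by
        rw [← integral_add (hI F) (hI G)]
        refine integral_congr_ae ?_
        filter_upwards [F.coe_add G] with x hx
        rw [hx, add_mul]
      map_smul' := fun c F => by
        rw [RingHom.id_apply, smul_eq_mul, ← integral_const_mul]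
        refine integral_congr_ae ?_
        filter_upwards [F.coe_smul c] with x hx
        rw [hx, mul_assoc] }
  exact ⟨L₀.mkContinuous (multNorm n α s r p q g).toReal
    fun F => F.abs_integral_mul_le hα hs hr hp hq hg, fun F => ⟨hI F, rfl⟩⟩

lemma Represents.norm_le (hα : 0 < α) (hs : 1 < s)
    (hr : r.HolderConjugate r') (hp : p.HolderConjugate p') (hq : q.HolderConjugate q')
    {g : MeasFun n} {L : BlockSpace n α s r' p' q' →L[ℝ] ℝ} (hL : Represents g L)
    (hg : multNorm n α s r p q g < ∞) : ‖L‖ ≤ (multNorm n α s r p q g).toReal := by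
  refine L.opNorm_le_bound ENNReal.toReal_nonneg fun F => ?_
  rw [(hL F).2]
  exact F.abs_integral_mul_le hα hs hr hp hq hg

/-- A multiplier is controlled by its action on simple functions. -/
lemma multNorm_le_of_forall_integral_eq (hα : 0 < α) (hs : 1 < s)
    (hr : r.HolderConjugate r') (hp : p.HolderConjugate p') (hq : q.HolderConjugate q')
    {g : MeasFun n} {L : BlockSpace n α s r' p' q' →L[ℝ] ℝ}
    (h : ∀ (K : Set (Rn n)), IsCompact K → ∀ ψ : SimpleFunc (Rn n) ℝ,
      (∀ x, x ∉ K → ψ x = 0) → ∀ F : BlockSpace n α s r' p' q', F.1 =ᵐ[volume] ψ →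
      Integrable (fun x => ψ x * g x) ∧ L F = ∫ x, ψ x * g x) :
    multNorm n α s r p q g ≤ normingConst p q p' q' * ENNReal.ofReal ‖L‖ := by
  refine multNorm_le_of_forall_simpleFunc hα hs hr.pos hp hq g fun K hK φ hφ => ?_
  have hgm : MeasurableSet {x | 0 ≤ g x} :=
    measurableSet_le measurable_const g.stronglyMeasurable.measurable
  -- A sign of `g` with values $\pm1$ everywhere. Multiplying `φ` by it keeps the function simple
  -- and its Lorentz norm unchanged, and turns the pairing with `g` into $\int\varphi|g|$.
  set σ : SimpleFunc (Rn n) ℝ := SimpleFunc.piecewise {x | 0 ≤ g x} hgm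
    (SimpleFunc.const _ 1) (SimpleFunc.const _ (-1)) with hσ
  set ψ : SimpleFunc (Rn n) ℝ := φ.map (fun x : NNReal => (x : ℝ)) * σ with hψ
  have hσ' : ∀ x, σ x * g x = |g x| ∧ |σ x| = 1 := by
    classical
    intro x
    rw [hσ, SimpleFunc.piecewise_apply]
    split_ifs with h0
    · have h0 : 0 ≤ g x := h0
      simp [abs_of_nonneg h0]
    · have h0 : g x < 0 := not_le.1 h0
      simp [abs_of_neg h0]
  have hψx : ∀ x, ψ x = φ x * σ x := fun x => rfl
  have hψg : ∀ x, ψ x * g x = |φ x * g x| := fun x => by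
    rw [hψx, mul_assoc, (hσ' x).1, abs_mul, NNReal.abs_eq]
  have hψ0 : ∀ x, x ∉ K → ψ x = 0 := fun x hx => by rw [hψx, hφ x hx]; simp
  have hnorm : lorentzNorm n p' q' ψ = lorentzNorm n p' q' (fun x => φ x) :=
    lorentzNorm_congr_abs_ae hp.symm.pos hq.symm.pos
      (ae_of_all _ fun x => by rw [hψx, abs_mul, (hσ' x).2, mul_one])
  obtain ⟨F, hF, hFn⟩ := exists_blockSpace_ae_eq hα hs hr ψ.aestronglyMeasurable hK.isBounded hψ0
    (SimpleFunc.lorentzNorm_lt_top hp.symm.pos hq.symm.pos ψ hψ0 hK.measure_lt_top.ne)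
  obtain ⟨hint, heq⟩ := h K hK ψ hψ0 F hF
  simp_rw [hψg] at hint heq
  rw [← ofReal_integral_eq_lintegral_ofReal hint (ae_of_all _ fun x => abs_nonneg _), ← heq]
  calc ENNReal.ofReal (L F) ≤ ENNReal.ofReal (‖L‖ * ‖F‖) :=
        ENNReal.ofReal_le_ofReal ((le_abs_self _).trans (L.le_opNorm F))
    _ = ENNReal.ofReal ‖L‖ * ENNReal.ofReal ‖F‖ := ENNReal.ofReal_mul (norm_nonneg _)
    _ ≤ _ := by
        rw [← hnorm]
        exact mul_le_mul_right hFn _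

lemma Represents.multNorm_le (hα : 0 < α) (hs : 1 < s)
    (hr : r.HolderConjugate r') (hp : p.HolderConjugate p') (hq : q.HolderConjugate q')
    {g : MeasFun n} {L : BlockSpace n α s r' p' q' →L[ℝ] ℝ} (hL : Represents g L) :
    multNorm n α s r p q g ≤ normingConst p q p' q' * ENNReal.ofReal ‖L‖ := by
  refine multNorm_le_of_forall_integral_eq hα hs hr hp hq fun K _ ψ _ F hF => ?_
  have he : (fun x => F.1 x * g x) =ᵐ[volume] fun x => ψ x * g x := by
    filter_upwards [hF] with x hx
    rw [hx]
  exact ⟨(hL F).1.congr he, (hL F).2.trans (integral_congr_ae he)⟩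

end Pairing

/-! ### Radon–Nikodym density of a functional -/

section Representation

variable {n : ℕ} {α s r p q r' p' q' : ℝ} [Fact (1 < p')] [Fact (1 < q')]

/-- The bound tends to zero with $|A\cap B_R|$ for fixed $R$; this is what makes the set function
below countably additive. -/
lemma exists_blockSpace_indicator (hα : 0 < α) (hs : 1 < s) (hr : r.HolderConjugate r')
    {A : Set (Rn n)} (hA : MeasurableSet A) (R : ℝ) :
    ∃ F : BlockSpace n α s r' p' q',
      F.1 =ᵐ[volume] (A ∩ Metric.closedBall 0 R).indicator (fun _ => (1 : ℝ)) ∧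
      ENNReal.ofReal ‖F‖ ≤ besselCap n α s (Metric.closedBall 0 R : Set (Rn n)) ^ (1 / r) *
        (ENNReal.ofReal p' * (volume (A ∩ Metric.closedBall 0 R) ^ (q' / p') *
          ENNReal.ofReal (1 ^ q' / q'))) ^ (1 / q') := by
  have hp' : 0 < p' := zero_lt_one.trans (Fact.out : 1 < p')
  have hq' : 0 < q' := zero_lt_one.trans (Fact.out : 1 < q')
  set B : Set (Rn n) := Metric.closedBall 0 R
  have hB : Bornology.IsBounded B := Metric.isBounded_closedBall
  have hbd : ∀ x, |(A ∩ B).indicator (fun _ => (1 : ℝ)) x| ≤ 1 := by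
    intro x
    by_cases hx : x ∈ A ∩ B <;> simp only [hx, indicator_of_mem, indicator_of_notMem,
      not_false_eq_true] <;> simp
  have h0 : ∀ x, x ∉ A ∩ B → (A ∩ B).indicator (fun _ => (1 : ℝ)) x = 0 := fun x hx =>
    indicator_of_notMem hx _
  have hvol : volume (A ∩ B) ≠ ∞ :=
    measure_ne_top_of_subset inter_subset_right hB.measure_lt_top.ne
  obtain ⟨F, hF, hFn⟩ := exists_blockSpace_ae_eq (α := α) (s := s) hα hs hr
    (aestronglyMeasurable_const.indicator (hA.inter measurableSet_closedBall)) hB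
    (fun x hx => h0 x fun h => hx h.2) (lorentzNorm_lt_top_of_bound hp' hq' hbd h0 hvol)
  refine ⟨F, hF, hFn.trans (mul_le_mul_right ?_ _)⟩
  exact lorentzNorm_le_of_bound hp' hq' zero_le_one hbd h0

/-- The measure is $A\mapsto L(\chi_{A\cap B_R})$. Finite additivity is linearity; countable
additivity holds because the tail of a disjoint union has small volume in the ball, hence an
indicator of small block norm. -/
lemma exists_signedMeasure (hα : 0 < α) (hs : 1 < s) (hr : r.HolderConjugate r')
    (L : BlockSpace n α s r' p' q' →L[ℝ] ℝ) (R : ℝ) :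
    ∃ ν : SignedMeasure (Rn n), ∀ A, MeasurableSet A → ∀ F : BlockSpace n α s r' p' q',
      F.1 =ᵐ[volume] (A ∩ Metric.closedBall 0 R).indicator (fun _ => (1 : ℝ)) → ν A = L F := by
  classical
  have hp' : 0 < p' := zero_lt_one.trans (Fact.out : 1 < p')
  have hq' : 0 < q' := zero_lt_one.trans (Fact.out : 1 < q')
  set B : Set (Rn n) := Metric.closedBall 0 R with hBdef
  have hBm : MeasurableSet B := measurableSet_closedBall
  have hBv : volume B ≠ ∞ := Metric.isBounded_closedBall.measure_lt_top.ne
  set Ψ : ℝ≥0∞ → ℝ≥0∞ := fun v => besselCap n α s B ^ (1 / r) *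
    (ENNReal.ofReal p' * (v ^ (q' / p') * ENNReal.ofReal (1 ^ q' / q'))) ^ (1 / q') with hΨ
  have hΨ0 : Tendsto Ψ (𝓝 0) (𝓝 0) := by
    have hc : besselCap n α s B ^ (1 / r) ≠ ∞ := ENNReal.rpow_ne_top_of_nonneg
      (one_div_nonneg.2 hr.nonneg) (besselCap_ne_top hα (by linarith) Metric.isBounded_closedBall)
    have h1 := ((ENNReal.continuous_rpow_const (y := q' / p')).tendsto 0)
    have h2 := ENNReal.Tendsto.mul_const (b := ENNReal.ofReal (1 ^ q' / q')) h1
      (Or.inr ENNReal.ofReal_ne_top)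
    have h3 := ENNReal.Tendsto.const_mul (a := ENNReal.ofReal p') h2
      (Or.inr ENNReal.ofReal_ne_top)
    have h4 := ENNReal.Tendsto.const_mul (a := besselCap n α s B ^ (1 / r))
      (((ENNReal.continuous_rpow_const (y := 1 / q')).tendsto _).comp h3) (Or.inr hc)
    rw [ENNReal.zero_rpow_of_pos (by positivity), zero_mul, mul_zero,
      ENNReal.zero_rpow_of_pos (by positivity), mul_zero] at h4
    exact h4
  have hex : ∀ A : Set (Rn n), MeasurableSet A → ∃ F : BlockSpace n α s r' p' q',
      F.1 =ᵐ[volume] (A ∩ B).indicator (fun _ => (1 : ℝ)) ∧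
      ENNReal.ofReal ‖F‖ ≤ Ψ (volume (A ∩ B)) := fun A hA =>
    exists_blockSpace_indicator hα hs hr hA R
  choose! e he heΨ using hex
  have hadd : ∀ A A' : Set (Rn n), MeasurableSet A → MeasurableSet A' → Disjoint A A' →
      e (A ∪ A') = e A + e A' := by
    intro A A' hA hA' hd
    refine BlockSpace.ext_ae ?_
    filter_upwards [he _ (hA.union hA'), he _ hA, he _ hA', (e A).coe_add (e A')] with x h1 h2 h3 h4
    rw [h4, h1, h2, h3, union_inter_distrib_right, indicator_union_of_disjoint
      (hd.mono inter_subset_left inter_subset_left)]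
  have hempty : e ∅ = 0 := by
    have := hadd ∅ ∅ MeasurableSet.empty MeasurableSet.empty (disjoint_empty _)
    rw [empty_union] at this
    simpa using this
  have hsum : ∀ (f : ℕ → Set (Rn n)), (∀ i, MeasurableSet (f i)) →
      Pairwise (Function.onFun Disjoint f) → ∀ t : Finset ℕ,
      e (⋃ i ∈ t, f i) = ∑ i ∈ t, e (f i) := by
    intro f hf hd t
    induction t using Finset.induction_on with
    | empty => simpa using hempty
    | insert a t ha ih =>
      rw [Finset.sum_insert ha, ← ih, Finset.set_biUnion_insert]
      refine hadd _ _ (hf a) (Finset.measurableSet_biUnion _ fun i _ => hf i) ?_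
      rw [disjoint_iUnion₂_right]
      exact fun i hi => hd (fun h => ha (h ▸ hi))
  refine ⟨⟨fun A => if MeasurableSet A then L (e A) else 0, ?_, ?_, ?_⟩, ?_⟩
  · simp [hempty]
  · intro A hA
    simp [hA]
  · intro f hf hd
    simp only [hf, if_true, MeasurableSet.iUnion hf]
    -- By continuity of `L`, the convergence may be checked in the block space, where the error of a
    -- partial sum is the indicator of the remaining union.
    refine L.hasSum (?_ : HasSum (fun i => e (f i)) (e (⋃ i, f i)))
    rw [HasSum, tendsto_iff_norm_sub_tendsto_zero]
    have hfin : ∑' i, volume (f i ∩ B) ≠ ∞ := by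
      rw [← measure_iUnion (fun i j hij => (hd hij).mono inter_subset_left inter_subset_left)
        fun i => (hf i).inter hBm]
      exact measure_ne_top_of_subset (iUnion_subset fun i => inter_subset_right) hBv
    have htail := hΨ0.comp (tendsto_of_tendsto_of_tendsto_of_le_of_le tendsto_const_nhds
      (ENNReal.tendsto_tsum_compl_atTop_zero hfin)
      (f := fun t : Finset ℕ => volume ((⋃ i : {i // i ∉ t}, f i) ∩ B))
      (fun _ => zero_le) fun t => by
        dsimp only
        rw [iUnion_inter]
        exact measure_iUnion_le _)
    have htail' := (ENNReal.tendsto_toReal ENNReal.zero_ne_top).comp htail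
    rw [ENNReal.toReal_zero] at htail'
    refine squeeze_zero' (Eventually.of_forall fun _ => norm_nonneg _) ?_ htail'
    -- The majorant is eventually finite, which is needed to pass from it to its real value.
    have hΨfin : ∀ᶠ t in (atTop : Filter (Finset ℕ)),
        Ψ (volume ((⋃ i : {i // i ∉ t}, f i) ∩ B)) < 1 :=
      htail.eventually (gt_mem_nhds one_pos)
    filter_upwards [hΨfin] with t ht
    have hU : MeasurableSet (⋃ i : {i // i ∉ t}, f i) := MeasurableSet.iUnion fun i => hf i
    have hsplit : (⋃ i, f i) = (⋃ i ∈ t, f i) ∪ ⋃ i : {i // i ∉ t}, f i := by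
      ext x
      simp only [mem_iUnion, mem_union]
      constructor
      · rintro ⟨i, hi⟩
        by_cases h : i ∈ t
        · exact Or.inl ⟨i, h, hi⟩
        · exact Or.inr ⟨⟨i, h⟩, hi⟩
      · rintro (⟨i, -, hi⟩ | ⟨i, hi⟩)
        · exact ⟨i, hi⟩
        · exact ⟨i, hi⟩
    have hdis : Disjoint (⋃ i ∈ t, f i) (⋃ i : {i // i ∉ t}, f i) := by
      rw [disjoint_iUnion₂_left]
      intro i hi
      rw [disjoint_iUnion_right]
      exact fun j => hd fun h => j.2 (h ▸ hi)
    rw [hsplit, hadd _ _ (Finset.measurableSet_biUnion _ fun i _ => hf i) hU hdis, hsum f hf hd,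
      sub_add_cancel_left, norm_neg]
    have h1 := heΨ _ hU
    exact (ENNReal.ofReal_le_iff_le_toReal (ht.trans ENNReal.one_lt_top).ne).1 h1
  · intro A hA F hF
    change (if MeasurableSet A then L (e A) else 0) = L F
    rw [if_pos hA]
    exact congrArg L (BlockSpace.ext_ae ((he A hA).trans hF.symm))

/-- Radon–Nikodym: on a null set the indicator is the zero element of the block space, so the signed
measure is absolutely continuous. -/
lemma exists_density_on_closedBall (hα : 0 < α) (hs : 1 < s) (hr : r.HolderConjugate r')
    (L : BlockSpace n α s r' p' q' →L[ℝ] ℝ) (R : ℝ) :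
    ∃ g : Rn n → ℝ, Measurable g ∧ Integrable g ∧ ∀ A, MeasurableSet A →
      ∀ F : BlockSpace n α s r' p' q',
      F.1 =ᵐ[volume] (A ∩ Metric.closedBall 0 R).indicator (fun _ => (1 : ℝ)) →
      L F = ∫ x in A, g x := by
  obtain ⟨ν, hν⟩ := exists_signedMeasure hα hs hr L R
  have hac : ν ≪ᵥ (volume : Measure (Rn n)).toENNRealVectorMeasure := by
    refine VectorMeasure.AbsolutelyContinuous.mk fun A hA h0 => ?_
    rw [Measure.toENNRealVectorMeasure_apply_measurable hA] at h0
    rw [hν A hA 0, map_zero]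
    have h1 : ((0 : BlockSpace n α s r' p' q').1 : Rn n → ℝ) =ᵐ[volume] 0 := AEEqFun.coeFn_zero
    filter_upwards [h1, measure_eq_zero_iff_ae_notMem.1 h0] with x hx hxA
    rw [hx, indicator_of_notMem fun h => hxA h.1]
    rfl
  have hrn := SignedMeasure.withDensityᵥ_rnDeriv_eq ν volume hac
  have hint := SignedMeasure.integrable_rnDeriv ν volume
  refine ⟨ν.rnDeriv volume, SignedMeasure.measurable_rnDeriv ν volume, hint, fun A hA F hF => ?_⟩
  rw [← hν A hA F hF, ← withDensityᵥ_apply hint hA, hrn]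

/-- Every functional on a block space has a locally integrable density on indicators. -/
lemma exists_density (hα : 0 < α) (hs : 1 < s) (hr : r.HolderConjugate r')
    (L : BlockSpace n α s r' p' q' →L[ℝ] ℝ) :
    ∃ g : Rn n → ℝ, Measurable g ∧ ∀ m : ℕ, IntegrableOn g (Metric.closedBall 0 m) ∧
      ∀ A, MeasurableSet A → ∀ F : BlockSpace n α s r' p' q',
      F.1 =ᵐ[volume] (A ∩ Metric.closedBall 0 m).indicator (fun _ => (1 : ℝ)) →
      L F = ∫ x in A ∩ Metric.closedBall 0 m, g x := by
  choose d hdm hdi hd using fun m : ℕ => exists_density_on_closedBall hα hs hr L (m : ℝ)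
  have hBm : ∀ m : ℕ, MeasurableSet (Metric.closedBall (0 : Rn n) m) := fun m =>
    measurableSet_closedBall
  have hd' : ∀ m : ℕ, ∀ A, MeasurableSet A → ∀ F : BlockSpace n α s r' p' q',
      F.1 =ᵐ[volume] (A ∩ Metric.closedBall 0 m).indicator (fun _ => (1 : ℝ)) →
      L F = ∫ x in A ∩ Metric.closedBall 0 m, d m x := by
    intro m A hA F hF
    refine hd m _ (hA.inter (hBm m)) F ?_
    rwa [inter_assoc, inter_self]
  -- Over $A\cap B_m$ both densities have integral $L(\chi_{A\cap B_m})$, so they agree almost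
  -- everywhere on the smaller ball.
  have hcons : ∀ m k : ℕ, m ≤ k → d m =ᵐ[volume.restrict (Metric.closedBall 0 m)] d k := by
    intro m k hmk
    refine Integrable.ae_eq_of_forall_setIntegral_eq _ _ (hdi m).integrableOn
      (hdi k).integrableOn fun A hA _ => ?_
    rw [Measure.restrict_restrict hA]
    obtain ⟨F, hF, -⟩ := exists_blockSpace_indicator (α := α) (s := s) (p' := p') (q' := q')
      hα hs hr hA (m : ℝ)
    rw [← hd' m A hA F hF]
    refine hd k _ (hA.inter (hBm m)) F ?_
    rwa [inter_assoc, inter_eq_self_of_subset_left (Metric.closedBall_subset_closedBall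
      (by exact_mod_cast hmk))]
  -- Each point uses the smallest ball of integer radius containing it; consistency over the
  -- countably many radii identifies `g` with each `d m` on its ball.
  set g : Rn n → ℝ := fun x => d ⌈‖x‖⌉₊ x with hg
  have hgm : Measurable g := by
    have h1 : Measurable fun z : ℕ × Rn n => d z.1 z.2 :=
      measurable_from_prod_countable_right hdm
    exact h1.comp ((Nat.measurable_ceil.comp measurable_norm).prodMk measurable_id)
  have hgd : ∀ m : ℕ, g =ᵐ[volume.restrict (Metric.closedBall 0 m)] d m := by
    intro m
    have hall : ∀ k : ℕ, ∀ᵐ x : Rn n, k ≤ m → x ∈ Metric.closedBall (0 : Rn n) k →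
        d k x = d m x := by
      intro k
      by_cases hk : k ≤ m
      · filter_upwards [(ae_restrict_iff' (hBm k)).1 (hcons k m hk)] with x hx _
        exact hx
      · exact ae_of_all _ fun x h => absurd h hk
    rw [EventuallyEq, ae_restrict_iff' (hBm m)]
    filter_upwards [ae_all_iff.2 hall] with x hx hxm
    refine hx _ ?_ ?_
    · rw [Nat.ceil_le]
      simpa using hxm
    · simpa using Nat.le_ceil ‖x‖
  refine ⟨g, hgm, fun m => ⟨((hdi m).integrableOn).congr_fun_ae (hgd m).symm, ?_⟩⟩
  intro A hA F hF
  rw [hd' m A hA F hF]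
  refine integral_congr_ae ?_
  exact EventuallyEq.symm (ae_restrict_of_ae_restrict_of_subset inter_subset_right (hgd m))

/-- Linear extension from indicators. Cutting off with `B.indicator` avoids carrying a support
condition through the induction on simple functions. -/
lemma integral_simpleFunc_mul_density (hα : 0 < α) (hs : 1 < s) (hr : r.HolderConjugate r')
    {L : BlockSpace n α s r' p' q' →L[ℝ] ℝ} {g : Rn n → ℝ} {B : Set (Rn n)}
    (hB : Bornology.IsBounded B) (hBm : MeasurableSet B) (hg : IntegrableOn g B)
    (hL : ∀ A, MeasurableSet A → ∀ F : BlockSpace n α s r' p' q',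
      F.1 =ᵐ[volume] (A ∩ B).indicator (fun _ => (1 : ℝ)) → L F = ∫ x in A ∩ B, g x)
    (ψ : SimpleFunc (Rn n) ℝ) :
    ∀ F : BlockSpace n α s r' p' q', F.1 =ᵐ[volume] B.indicator ψ →
      IntegrableOn (fun x => ψ x * g x) B ∧ L F = ∫ x in B, ψ x * g x := by
  classical
  have hp' : 0 < p' := zero_lt_one.trans (Fact.out : 1 < p')
  have hq' : 0 < q' := zero_lt_one.trans (Fact.out : 1 < q')
  have hex : ∀ ψ : SimpleFunc (Rn n) ℝ, ∃ F : BlockSpace n α s r' p' q',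
      F.1 =ᵐ[volume] B.indicator ψ := by
    intro ψ
    obtain ⟨C, hC⟩ := ψ.exists_forall_norm_le
    have hC0 : 0 ≤ C := (norm_nonneg _).trans (hC 0)
    have hbd : ∀ x, |B.indicator ψ x| ≤ C := by
      intro x
      by_cases hx : x ∈ B
      · rw [indicator_of_mem hx]; exact hC x
      · rw [indicator_of_notMem hx, abs_zero]; exact hC0
    have h0 : ∀ x, x ∉ B → B.indicator ψ x = 0 := fun x hx => indicator_of_notMem hx _
    obtain ⟨F, hF, -⟩ := exists_blockSpace_ae_eq (α := α) (s := s) (r := r) hα hs hr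
      (ψ.aestronglyMeasurable.indicator hBm) hB h0
      (lorentzNorm_lt_top_of_bound hp' hq' hbd h0 hB.measure_lt_top.ne)
    exact ⟨F, hF⟩
  induction ψ using SimpleFunc.induction with
  | const c hA =>
    rename_i A
    intro F hF
    obtain ⟨G, hG⟩ := hex (SimpleFunc.piecewise A hA (SimpleFunc.const _ 1) (SimpleFunc.const _ 0))
    have hG' : G.1 =ᵐ[volume] (A ∩ B).indicator (fun _ => (1 : ℝ)) := by
      refine hG.trans (ae_of_all _ fun x => ?_)
      by_cases hB : x ∈ B <;> by_cases hA : x ∈ A <;>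
        simp [hA, hB]
    have hFG : F = c • G := by
      refine BlockSpace.ext_ae ?_
      filter_upwards [hF, hG', G.coe_smul c] with x h1 h2 h3
      rw [h1, h3, h2]
      by_cases hB : x ∈ B <;> by_cases hA : x ∈ A <;>
        simp [hA, hB]
    have hfun : (fun x => SimpleFunc.piecewise A hA (SimpleFunc.const _ c)
        (SimpleFunc.const _ 0) x * g x) = A.indicator fun x => c * g x := by
      funext x
      by_cases hA : x ∈ A <;> simp [hA, SimpleFunc.piecewise_apply]
    rw [hfun]
    refine ⟨(hg.const_mul c).indicator hA, ?_⟩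
    rw [hFG, map_smul, smul_eq_mul, hL A hA G hG', setIntegral_indicator hA, inter_comm B A,
      integral_const_mul]
  | add hd h₁ h₂ =>
    rename_i f₁ f₂
    intro F hF
    obtain ⟨F₁, hF₁⟩ := hex f₁
    obtain ⟨F₂, hF₂⟩ := hex f₂
    have hFF : F = F₁ + F₂ := by
      refine BlockSpace.ext_ae ?_
      filter_upwards [hF, hF₁, hF₂, F₁.coe_add F₂] with x h1 h2 h3 h4
      rw [h1, h4, h2, h3]
      by_cases hx : x ∈ B <;> simp [hx]
    obtain ⟨i₁, e₁⟩ := h₁ F₁ hF₁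
    obtain ⟨i₂, e₂⟩ := h₂ F₂ hF₂
    have hfun : (fun x => (f₁ + f₂) x * g x) = fun x => f₁ x * g x + f₂ x * g x := by
      funext x
      rw [SimpleFunc.add_apply, add_mul]
    rw [hfun]
    refine ⟨i₁.add i₂, ?_⟩
    rw [hFF, map_add, e₁, e₂, integral_add i₁ i₂]

end Representation

/-! ### Density of simple functions; uniqueness and existence of the representing multiplier -/

section Density

variable {n : ℕ} {α s r p q r' p' q' : ℝ} [Fact (1 < p')] [Fact (1 < q')]

lemma BlockSpace.norm_le_of_isBlockDecomp {F : BlockSpace n α s r' p' q'} {l : ℕ → ℝ}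
    {b : ℕ → Rn n → ℝ} (h : IsBlockDecomp n α s r' p' q' F.1 l b) : ‖F‖ ≤ ∑' k, |l k| := by
  rw [BlockSpace.norm_def]
  refine ENNReal.toReal_le_of_le_ofReal (tsum_nonneg fun _ => abs_nonneg _) ?_
  rw [ENNReal.ofReal_tsum_of_nonneg (fun _ => abs_nonneg _) h.1]
  exact h.blockNorm_le

/-- Simple approximations $\varphi_k$ starting from $0$ satisfy $|b-\varphi_k|\le|b|$, so they keep
the bounded support, and dominated convergence makes the Lorentz norm of $b-\varphi_k$ tend to zero.
On a fixed ball this norm controls the block norm. -/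
lemma map_eq_zero_of_simpleFunc (hα : 0 < α) (hs : 1 < s) (hr : r.HolderConjugate r')
    {L : BlockSpace n α s r' p' q' →L[ℝ] ℝ}
    (hL : ∀ (m : ℕ) (ψ : SimpleFunc (Rn n) ℝ), (∀ x, x ∉ Metric.closedBall 0 (m : ℝ) → ψ x = 0) →
      ∀ F : BlockSpace n α s r' p' q', F.1 =ᵐ[volume] ψ → L F = 0)
    {b : Rn n → ℝ} (hb : Measurable b) {m : ℕ}
    (hbm : ∀ x, x ∉ Metric.closedBall 0 (m : ℝ) → b x = 0) (hfin : lorentzNorm n p' q' b < ∞)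
    {F : BlockSpace n α s r' p' q'} (hF : F.1 =ᵐ[volume] b) : L F = 0 := by
  have hp' : 0 < p' := zero_lt_one.trans (Fact.out : 1 < p')
  have hq' : 0 < q' := zero_lt_one.trans (Fact.out : 1 < q')
  set B : Set (Rn n) := Metric.closedBall 0 (m : ℝ)
  have hB : Bornology.IsBounded B := Metric.isBounded_closedBall
  have hBv : volume B ≠ ∞ := hB.measure_lt_top.ne
  set φ : ℕ → SimpleFunc (Rn n) ℝ := fun k => SimpleFunc.approxOn b hb univ 0 (mem_univ 0) k
  have hφle : ∀ k x, |b x - φ k x| ≤ |b x| := by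
    intro k x
    have := SimpleFunc.edist_approxOn_le hb (mem_univ (0 : ℝ)) x k
    rw [edist_comm, edist_comm 0, edist_dist, edist_dist,
      ENNReal.ofReal_le_ofReal_iff dist_nonneg, Real.dist_eq, Real.dist_eq, sub_zero] at this
    exact this
  have hφ0 : ∀ k x, x ∉ B → φ k x = 0 := by
    intro k x hx
    have := hφle k x
    rw [hbm x hx] at this
    simpa using this
  have hlim : ∀ x, Tendsto (fun k => b x - φ k x) atTop (𝓝 0) := by
    intro x
    have h1 := SimpleFunc.tendsto_approxOn hb (mem_univ (0 : ℝ)) (x := x) (by simp)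
    have h2 := h1.const_sub (b x)
    rwa [sub_self] at h2
  have hl0 := tendsto_lorentzNorm_zero (q := q') hp' hq' hBv hfin.ne hbm
    (fun k => hb.aestronglyMeasurable.sub (φ k).aestronglyMeasurable) hφle hlim
  have hcap : besselCap n α s B ^ (1 / r) ≠ ∞ := ENNReal.rpow_ne_top_of_nonneg
    (one_div_nonneg.2 hr.nonneg) (besselCap_ne_top hα (by linarith) hB)
  have hc0 := ENNReal.Tendsto.const_mul hl0 (Or.inr hcap)
  rw [mul_zero] at hc0
  have hbound : ∀ k, ENNReal.ofReal |L F| ≤ ENNReal.ofReal ‖L‖ *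
      (besselCap n α s B ^ (1 / r) * lorentzNorm n p' q' fun x => b x - φ k x) := by
    intro k
    obtain ⟨G, hG, -⟩ := exists_blockSpace_ae_eq (α := α) (s := s) (r := r) hα hs hr
      (φ k).aestronglyMeasurable hB (hφ0 k)
      (SimpleFunc.lorentzNorm_lt_top hp' hq' (φ k) (hφ0 k) hBv)
    have hFG : (F - G).1 =ᵐ[volume] fun x => b x - φ k x := by
      filter_upwards [hF, hG, F.coe_sub G] with x h1 h2 h3
      rw [h3, h1, h2]
    have hle := blockNorm_le_of_support (α := α) (s := s) (p' := p') hr hq' hFG hB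
      (fun x hx => by_contra fun hxB => hx (by
        rw [hbm x hxB, hφ0 k x hxB, sub_zero]))
    rw [← BlockSpace.ofReal_norm] at hle
    have e : L F = L (F - G) := by rw [map_sub, hL m (φ k) (hφ0 k) G hG, sub_zero]
    rw [e]
    refine (ENNReal.ofReal_le_ofReal (L.le_opNorm _)).trans ?_
    rw [ENNReal.ofReal_mul (norm_nonneg _)]
    exact mul_le_mul_right hle _
  have hz := ge_of_tendsto' (ENNReal.Tendsto.const_mul hc0 (Or.inr ENNReal.ofReal_ne_top)) hbound
  rw [mul_zero, nonpos_iff_eq_zero, ENNReal.ofReal_eq_zero] at hz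
  exact abs_eq_zero.1 (le_antisymm hz (abs_nonneg _))

/-- Replaces a block by a Borel function that vanishes off a ball everywhere and has finite Lorentz
norm, as the approximation by simple functions requires. -/
lemma IsBlock.exists_blockSpace (hα : 0 < α) (hs : 1 < s) (hr : r.HolderConjugate r')
    {b : Rn n → ℝ} (hb : IsBlock n α s r' p' q' b) :
    ∃ (m : ℕ) (b₀ : Rn n → ℝ) (F : BlockSpace n α s r' p' q'), Measurable b₀ ∧
      (∀ x, x ∉ Metric.closedBall 0 (m : ℝ) → b₀ x = 0) ∧ lorentzNorm n p' q' b₀ < ∞ ∧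
      F.1 =ᵐ[volume] b₀ ∧ F.1 =ᵐ[volume] b := by
  have hp' : 0 < p' := zero_lt_one.trans (Fact.out : 1 < p')
  have hq' : 0 < q' := zero_lt_one.trans (Fact.out : 1 < q')
  obtain ⟨hbm, E, hE, hbE, hle⟩ := (isBlock_iff hr).1 hb
  have hfin : lorentzNorm n p' q' b < ∞ := by
    -- If the capacity of `E` vanishes, the block inequality does not by itself bound the Lorentz
    -- norm, because $0\cdot\infty=0$; but then `E` is null and `b` vanishes almost everywhere.
    rcases eq_or_ne (besselCap n α s E) 0 with h0 | h0
    · have hv := volume_eq_zero_of_besselCap_eq_zero hα hs h0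
      rw [lorentzNorm_eq_zero_of_ae hp' hq']
      · exact ENNReal.zero_lt_top
      · filter_upwards [measure_eq_zero_iff_ae_notMem.1 hv] with x hx
        exact by_contra fun h => hx (hbE h)
    · by_contra htop
      rw [not_lt_top_iff.1 htop, ENNReal.mul_top (ENNReal.rpow_pos (pos_iff_ne_zero.2 h0)
        (besselCap_ne_top hα (by linarith) hE)).ne'] at hle
      exact absurd hle (by simp)
  obtain ⟨R, hR⟩ := hE.subset_closedBall 0
  obtain ⟨m, hm⟩ := exists_nat_ge R
  set B : Set (Rn n) := Metric.closedBall 0 (m : ℝ)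
  have hEB : E ⊆ B := hR.trans (Metric.closedBall_subset_closedBall hm)
  have hae : b =ᵐ[volume] B.indicator (hbm.mk b) := by
    filter_upwards [hbm.ae_eq_mk] with x hx
    by_cases hxB : x ∈ B
    · rw [indicator_of_mem hxB, hx]
    · rw [indicator_of_notMem hxB]
      exact by_contra fun h => hxB (hEB (hbE h))
  obtain ⟨F, hF, -⟩ := exists_blockSpace_ae_eq (α := α) (s := s) (r := r) hα hs hr hbm hE
    (fun x hx => by_contra fun h => hx (hbE h)) hfin
  refine ⟨m, B.indicator (hbm.mk b), F,
    hbm.stronglyMeasurable_mk.measurable.indicator measurableSet_closedBall,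
    fun x hx => indicator_of_notMem hx _, ?_, hF.trans hae, hF⟩
  rwa [← lorentzNorm_congr_abs_ae hp' hq' (hae.mono fun x hx => congrArg abs hx)]

/-- Simple functions with bounded support are dense in the block space. -/
lemma eq_zero_of_simpleFunc (hα : 0 < α) (hs : 1 < s) (hr : r.HolderConjugate r')
    {L : BlockSpace n α s r' p' q' →L[ℝ] ℝ}
    (hL : ∀ (m : ℕ) (ψ : SimpleFunc (Rn n) ℝ), (∀ x, x ∉ Metric.closedBall 0 (m : ℝ) → ψ x = 0) →
      ∀ F : BlockSpace n α s r' p' q', F.1 =ᵐ[volume] ψ → L F = 0) : L = 0 := by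
  ext F
  obtain ⟨l, b, hd⟩ := F.2
  -- A block series is only known to converge almost everywhere. Subtracting the first $N$ terms
  -- leaves a function with the shifted decomposition, whose norm is at most the tail of
  -- $\sum|\lambda_k|$; since `L` annihilates the blocks, its value is unchanged.
  have hrem : ∀ N : ℕ, ∃ G : BlockSpace n α s r' p' q',
      IsBlockDecomp n α s r' p' q' G.1 (fun k => l (k + N)) (fun k => b (k + N)) ∧ L G = L F := by
    intro N
    induction N with
    | zero => exact ⟨F, hd, rfl⟩
    | succ N ih =>
      obtain ⟨G, hG, hLG⟩ := ih
      obtain ⟨m, b₀, H, hb₀, hsupp, hfin, hH, hHb⟩ := (hd.2.1 N).exists_blockSpace hα hs hr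
      have hLH := map_eq_zero_of_simpleFunc hα hs hr hL hb₀ hsupp hfin hH
      refine ⟨G - l N • H, ⟨?_, fun k => hd.2.1 _, ?_⟩, ?_⟩
      · exact (summable_nat_add_iff (f := fun k => |l k|) (N + 1)).2 hd.1
      · filter_upwards [hG.2.2, G.coe_sub (l N • H), H.coe_smul (l N), hHb] with x h1 h2 h3 h4
        rw [h2, h3, h4]
        have h5 := (h1.comp (tendsto_add_atTop_nat 1)).sub_const (l N * b N x)
        refine h5.congr fun M => ?_
        simp only [Function.comp_apply]
        rw [Finset.sum_range_succ', zero_add, add_sub_cancel_right]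
        refine Finset.sum_congr rfl fun k _ => ?_
        rw [show k + 1 + N = k + (N + 1) by ring]
      · rw [map_sub, map_smul, hLH, smul_zero, sub_zero, hLG]
  have hbound : ∀ N : ℕ, |L F| ≤ ‖L‖ * ∑' k, |l (k + N)| := by
    intro N
    obtain ⟨G, hG, hLG⟩ := hrem N
    rw [← hLG]
    exact (L.le_opNorm G).trans (mul_le_mul_of_nonneg_left
      (BlockSpace.norm_le_of_isBlockDecomp hG) (norm_nonneg _))
  have h0 := (tendsto_sum_nat_add fun k => |l k|).const_mul ‖L‖
  rw [mul_zero] at h0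
  exact abs_eq_zero.1 (le_antisymm (ge_of_tendsto' h0 hbound) (abs_nonneg _))

lemma ae_eq_of_forall_ae_eq_closedBall {g₁ g₂ : Rn n → ℝ}
    (h : ∀ m : ℕ, g₁ =ᵐ[volume.restrict (Metric.closedBall 0 (m : ℝ))] g₂) :
    g₁ =ᵐ[volume] g₂ := by
  have h' : ∀ᵐ x : Rn n, ∀ m : ℕ, x ∈ Metric.closedBall (0 : Rn n) (m : ℝ) → g₁ x = g₂ x :=
    ae_all_iff.2 fun m => (ae_restrict_iff' measurableSet_closedBall).1 (h m)
  filter_upwards [h'] with x hx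
  obtain ⟨m, hm⟩ := exists_nat_ge ‖x‖
  exact hx m (by simpa using hm)

/-- Indicators of bounded measurable sets lie in the block space, so two representing functions have
equal integrals over all measurable parts of every ball. -/
lemma Represents.unique (hα : 0 < α) (hs : 1 < s) (hr : r.HolderConjugate r')
    {L : BlockSpace n α s r' p' q' →L[ℝ] ℝ} {g₁ g₂ : MeasFun n} (h₁ : Represents g₁ L)
    (h₂ : Represents g₂ L) : g₁ = g₂ := by
  refine AEEqFun.ext (ae_eq_of_forall_ae_eq_closedBall fun m => ?_)
  have key : ∀ (g : MeasFun n), Represents g L → ∀ A : Set (Rn n), MeasurableSet A →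
      ∀ F : BlockSpace n α s r' p' q',
      F.1 =ᵐ[volume] (A ∩ Metric.closedBall 0 (m : ℝ)).indicator (fun _ => (1 : ℝ)) →
      IntegrableOn g (A ∩ Metric.closedBall 0 (m : ℝ)) ∧
        L F = ∫ x in A ∩ Metric.closedBall 0 (m : ℝ), g x := by
    intro g hg A hA F hF
    have hm : MeasurableSet (A ∩ Metric.closedBall (0 : Rn n) (m : ℝ)) :=
      hA.inter measurableSet_closedBall
    have he : (fun x => F.1 x * g x) =ᵐ[volume]
        (A ∩ Metric.closedBall 0 (m : ℝ)).indicator g := by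
      filter_upwards [hF] with x hx
      rw [hx]
      by_cases h : x ∈ A ∩ Metric.closedBall 0 (m : ℝ) <;> simp only [h, indicator_of_mem,
        indicator_of_notMem, not_false_eq_true, one_mul, zero_mul]
    obtain ⟨h1, h2⟩ := hg F
    exact ⟨(integrable_indicator_iff hm).1 (h1.congr he),
      by rw [h2, integral_congr_ae he, integral_indicator hm]⟩
  have hI : ∀ g, Represents g L → IntegrableOn g (Metric.closedBall (0 : Rn n) (m : ℝ)) := by
    intro g hg
    obtain ⟨F, hF, -⟩ := exists_blockSpace_indicator (n := n) (α := α) (s := s) (p' := p')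
      (q' := q') hα hs hr MeasurableSet.univ (m : ℝ)
    have := (key g hg univ MeasurableSet.univ F hF).1
    rwa [univ_inter] at this
  refine Integrable.ae_eq_of_forall_setIntegral_eq _ _ (hI g₁ h₁) (hI g₂ h₂) fun A hA _ => ?_
  obtain ⟨F, hF, -⟩ := exists_blockSpace_indicator (n := n) (α := α) (s := s) (p' := p')
    (q' := q') hα hs hr hA (m : ℝ)
  rw [Measure.restrict_restrict hA, ← (key g₁ h₁ A hA F hF).2, ← (key g₂ h₂ A hA F hF).2]

/-- The density is first shown to represent `L` on simple functions only. The norming property needs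
no more to make it a multiplier, hence it represents some continuous functional, which must be `L`
by density. -/
lemma exists_multNorm_lt_top_represents (hα : 0 < α) (hs : 1 < s)
    (hr : r.HolderConjugate r') (hp : p.HolderConjugate p') (hq : q.HolderConjugate q')
    (L : BlockSpace n α s r' p' q' →L[ℝ] ℝ) :
    ∃ g : MeasFun n, multNorm n α s r p q g < ∞ ∧ Represents g L := by
  obtain ⟨g, hgm, hg⟩ := exists_density hα hs hr L
  set G : MeasFun n := AEEqFun.mk g hgm.aestronglyMeasurable
  have hG : G =ᵐ[volume] g := AEEqFun.coeFn_mk _ _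
  have key : ∀ (m : ℕ) (ψ : SimpleFunc (Rn n) ℝ),
      (∀ x, x ∉ Metric.closedBall 0 (m : ℝ) → ψ x = 0) →
      ∀ F : BlockSpace n α s r' p' q', F.1 =ᵐ[volume] ψ →
      Integrable (fun x => ψ x * G x) ∧ L F = ∫ x, ψ x * G x := by
    intro m ψ hψ F hF
    have hBm : MeasurableSet (Metric.closedBall (0 : Rn n) (m : ℝ)) := measurableSet_closedBall
    have hind : (Metric.closedBall (0 : Rn n) (m : ℝ)).indicator ψ = ψ :=
      indicator_eq_self.2 fun x hx => by_contra fun h => hx (hψ x h)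
    obtain ⟨h1, h2⟩ := integral_simpleFunc_mul_density hα hs hr Metric.isBounded_closedBall hBm
      (hg m).1 (hg m).2 ψ F (by rwa [hind])
    have hind2 : (Metric.closedBall (0 : Rn n) (m : ℝ)).indicator (fun x => ψ x * g x) =
        fun x => ψ x * g x :=
      indicator_eq_self.2 fun x hx => by_contra fun h => hx (by simp [hψ x h])
    have he : (fun x => ψ x * G x) =ᵐ[volume] fun x => ψ x * g x := by
      filter_upwards [hG] with x hx
      rw [hx]
    rw [← integrable_indicator_iff hBm, hind2] at h1
    rw [← integral_indicator hBm, hind2] at h2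
    exact ⟨h1.congr he.symm, h2.trans (integral_congr_ae he.symm)⟩
  have hN : multNorm n α s r p q G < ∞ := by
    refine (multNorm_le_of_forall_integral_eq hα hs hr hp hq (L := L)
      fun K hK ψ hψ F hF => ?_).trans_lt (ENNReal.mul_lt_top
        (normingConst_ne_top hq.pos hq.symm.pos).lt_top ENNReal.ofReal_lt_top)
    obtain ⟨R, hR⟩ := hK.isBounded.subset_closedBall 0
    obtain ⟨m, hm⟩ := exists_nat_ge R
    exact key m ψ (fun x hx => hψ x fun h =>
      hx (Metric.closedBall_subset_closedBall hm (hR h))) F hF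
  obtain ⟨M, hM⟩ := exists_represents hα hs hr hp hq hN
  have hLM : L - M = 0 := by
    refine eq_zero_of_simpleFunc hα hs hr fun m ψ hψ F hF => ?_
    rw [sub_apply, (key m ψ hψ F hF).2, (hM F).2, sub_eq_zero]
    refine integral_congr_ae ?_
    filter_upwards [hF] with x hx
    rw [hx]
  rw [sub_eq_zero] at hLM
  exact ⟨G, hN, hLM ▸ hM⟩

/-- The dual of the block space is the multiplier space. -/
lemma dualIsomorphic_multNorm (hα : 0 < α) (hs : 1 < s)
    (hr : r.HolderConjugate r') (hp : p.HolderConjugate p') (hq : q.HolderConjugate q') :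
    DualIsomorphic n α s r' p' q' (multNorm n α s r p q) := by
  refine ⟨fun L => ?_, fun g hg => exists_represents hα hs hr hp hq hg, ?_⟩
  · obtain ⟨g, hg, hgL⟩ := exists_multNorm_lt_top_represents hα hs hr hp hq L
    exact ⟨g, ⟨hg, hgL⟩, fun g' hg' => hg'.2.unique hα hs hr hgL⟩
  · set C := normingConst p q p' q'
    have hC : C ≠ ∞ := normingConst_ne_top hq.pos hq.symm.pos
    -- A constant that is at least $1$ and at least `C` serves both inequalities.
    refine ⟨C.toReal + 1, by positivity, fun g L hg hL => ⟨?_, ?_⟩⟩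
    · have h1 := ENNReal.toReal_mono (ENNReal.mul_ne_top hC ENNReal.ofReal_ne_top)
        (hL.multNorm_le hα hs hr hp hq)
      rw [ENNReal.toReal_mul, ENNReal.toReal_ofReal (norm_nonneg _)] at h1
      rw [inv_mul_le_iff₀ (by positivity)]
      nlinarith [norm_nonneg L]
    · have h1 := hL.norm_le hα hs hr hp hq hg
      have h2 : 0 ≤ (multNorm n α s r p q g).toReal := ENNReal.toReal_nonneg
      have h3 : 0 ≤ C.toReal := ENNReal.toReal_nonneg
      nlinarith

end Density

/-! ### Completeness of the block spaces -/

section Banach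

variable {n : ℕ} {α s r p q r' p' q' : ℝ}

/-- The indicator function of the closed ball of radius `m`. -/
noncomputable def ballIndicator (n m : ℕ) : MeasFun n :=
  AEEqFun.mk ((Metric.closedBall (0 : Rn n) (m : ℝ)).indicator fun _ => (1 : ℝ))
    (aestronglyMeasurable_const.indicator measurableSet_closedBall)

lemma coeFn_ballIndicator (n m : ℕ) : ballIndicator n m =ᵐ[volume]
    (Metric.closedBall (0 : Rn n) (m : ℝ)).indicator fun _ => (1 : ℝ) :=
  AEEqFun.coeFn_mk _ _

lemma lintegral_mul_ballIndicator (m : ℕ) (f : Rn n → ℝ) :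
    ∫⁻ x, ENNReal.ofReal |f x * ballIndicator n m x| =
      ∫⁻ x in Metric.closedBall (0 : Rn n) (m : ℝ), ENNReal.ofReal |f x| := by
  rw [← lintegral_indicator measurableSet_closedBall]
  refine lintegral_congr_ae ?_
  filter_upwards [coeFn_ballIndicator n m] with x hx
  rw [hx]
  by_cases h : x ∈ Metric.closedBall (0 : Rn n) (m : ℝ) <;> simp only [h, indicator_of_mem,
    indicator_of_notMem, not_false_eq_true, mul_one, mul_zero, abs_zero, ENNReal.ofReal_zero]

/-- The Lorentz norm of $\chi_{K\cap B}$ is at most a constant times $|K\cap B|^{1/p}$; raising the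
multiplier condition to the power $r$ gives the hypothesis `h`. -/
lemma multNorm_ballIndicator_lt_top (hr : 0 < r) (hp : 0 < p) (hq : 0 < q) (hα : 0 < α)
    (hs : 1 < s) (m : ℕ) {C : ℝ≥0∞} (hC : C ≠ ∞)
    (h : ∀ K : Set (Rn n), volume (K ∩ Metric.closedBall 0 (m : ℝ)) ^ (r / p) ≤
      C * besselCap n α s K) :
    multNorm n α s r p q (ballIndicator n m) < ∞ := by
  have hD : (ENNReal.ofReal p * ENNReal.ofReal (1 ^ q / q)) ^ (1 / q) * C ^ (1 / r) ≠ ∞ :=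
    ENNReal.mul_ne_top (ENNReal.rpow_ne_top_of_nonneg (by positivity)
      (ENNReal.mul_ne_top ENNReal.ofReal_ne_top ENNReal.ofReal_ne_top))
      (ENNReal.rpow_ne_top_of_nonneg (by positivity) hC)
  refine lt_of_le_of_lt (iSup_le fun K => iSup_le fun hK => iSup_le fun hK0 => ?_) hD.lt_top
  have ht := besselCap_ne_top hα (by linarith : 0 < s) hK.isBounded
  have h1 : besselCap n α s K ^ (1 / r) ≠ 0 := (ENNReal.rpow_pos (pos_iff_ne_zero.2 hK0) ht).ne'
  have h2 : besselCap n α s K ^ (1 / r) ≠ ∞ := ENNReal.rpow_ne_top_of_nonneg (by positivity) ht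
  rw [ENNReal.div_le_iff h1 h2]
  set B : Set (Rn n) := Metric.closedBall 0 (m : ℝ)
  have hae : ∀ᵐ x, |K.indicator (ballIndicator n m) x| =
      |(K ∩ B).indicator (fun _ => (1 : ℝ)) x| := by
    filter_upwards [coeFn_ballIndicator n m] with x hx
    rw [← indicator_indicator]
    by_cases hxK : x ∈ K
    · rw [indicator_of_mem hxK, indicator_of_mem hxK, hx]
    · rw [indicator_of_notMem hxK, indicator_of_notMem hxK]
  have hbd : ∀ x, |(K ∩ B).indicator (fun _ => (1 : ℝ)) x| ≤ 1 := by
    intro x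
    by_cases hx : x ∈ K ∩ B <;> simp only [hx, indicator_of_mem, indicator_of_notMem,
      not_false_eq_true] <;> simp
  rw [lorentzNorm_congr_abs_ae hp hq hae]
  calc _ ≤ _ := lorentzNorm_le_of_bound hp hq zero_le_one hbd fun x hx => indicator_of_notMem hx _
    _ = (ENNReal.ofReal p * ENNReal.ofReal (1 ^ q / q)) ^ (1 / q) *
        (volume (K ∩ B) ^ (r / p)) ^ (1 / r) := by
        rw [mul_left_comm, ENNReal.mul_rpow_of_nonneg _ _ (by positivity), ← ENNReal.rpow_mul,
          ← ENNReal.rpow_mul, mul_comm]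
        congr 2
        field_simp
    _ ≤ _ := by
        rw [mul_assoc, ← ENNReal.mul_rpow_of_nonneg _ _ (by positivity)]
        gcongr
        exact h K

variable [Fact (1 < p')] [Fact (1 < q')]

/-- Absolutely convergent series of block functions converge almost everywhere, to a block
function. -/
lemma exists_blockSpace_series (hα : 0 < α) (hs : 1 < s) (hr : r.HolderConjugate r')
    (hp : p.HolderConjugate p') (hq : q.HolderConjugate q')
    (hball : ∀ m : ℕ, multNorm n α s r p q (ballIndicator n m) < ∞)
    {w : ℕ → BlockSpace n α s r' p' q'} {c : ℕ → ℝ} (hc : Summable c) (hw : ∀ j, ‖w j‖ < c j) :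
    ∃ h : BlockSpace n α s r' p' q', (∀ᵐ x, HasSum (fun j => (w j).1 x) (h.1 x)) ∧
      ‖h‖ ≤ ∑' j, c j := by
  have hc0 : ∀ j, 0 ≤ c j := fun j => (norm_nonneg _).trans (hw j).le
  have hex : ∀ j, ∃ l b, IsBlockDecomp n α s r' p' q' (w j).1 l b ∧
      ∑' k, ENNReal.ofReal |l k| < ENNReal.ofReal (c j) := by
    intro j
    refine exists_isBlockDecomp_lt ?_
    rw [← BlockSpace.ofReal_norm]
    exact (ENNReal.ofReal_lt_ofReal_iff_of_nonneg (norm_nonneg _)).2 (hw j)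
  choose l b hd hl using hex
  have hsum : ∑' z : ℕ × ℕ, ENNReal.ofReal |l z.1 z.2| ≤ ENNReal.ofReal (∑' j, c j) := by
    rw [ENNReal.tsum_prod', ENNReal.ofReal_tsum_of_nonneg hc0 hc]
    exact ENNReal.tsum_le_tsum fun j => (hl j).le
  have hblock : ∀ z : ℕ × ℕ, IsBlock n α s r' p' q' (b z.1 z.2) := fun z => (hd z.1).2.1 z.2
  -- Pairing with the indicator of a ball bounds the $L^1$ norm of each block on the ball by one
  -- constant. The full double series is thus absolutely integrable on balls and converges
  -- absolutely almost everywhere.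
  have habs : ∀ m : ℕ, ∀ᵐ x ∂(volume.restrict (Metric.closedBall (0 : Rn n) (m : ℝ))),
      ∑' z : ℕ × ℕ, ENNReal.ofReal |l z.1 z.2 * b z.1 z.2 x| < ∞ := by
    intro m
    have hmeas : ∀ z : ℕ × ℕ, AEMeasurable (fun x => ENNReal.ofReal |l z.1 z.2 * b z.1 z.2 x|)
        (volume.restrict (Metric.closedBall (0 : Rn n) (m : ℝ))) := fun z =>
      (((hblock z).1.aemeasurable.restrict.const_mul _).abs).ennreal_ofReal
    refine ae_lt_top' (AEMeasurable.tsum hmeas) ?_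
    rw [lintegral_tsum hmeas]
    refine ne_top_of_le_ne_top (b := ENNReal.ofReal (∑' j, c j) *
      multNorm n α s r p q (ballIndicator n m))
      (ENNReal.mul_ne_top ENNReal.ofReal_ne_top (hball m).ne) ?_
    refine le_trans ?_ (mul_le_mul_left hsum _)
    rw [← ENNReal.tsum_mul_right]
    refine ENNReal.tsum_le_tsum fun z => ?_
    simp_rw [abs_mul, ENNReal.ofReal_mul (abs_nonneg (l z.1 z.2))]
    rw [lintegral_const_mul' _ _ ENNReal.ofReal_ne_top, ← lintegral_mul_ballIndicator]
    exact mul_le_mul_right ((hblock z).lintegral_mul_le hα hs hr hp hq _) _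
  have hsummable : ∀ᵐ x, Summable fun z : ℕ × ℕ => l z.1 z.2 * b z.1 z.2 x := by
    have h' : ∀ᵐ x : Rn n, ∀ m : ℕ, x ∈ Metric.closedBall (0 : Rn n) (m : ℝ) →
        ∑' z : ℕ × ℕ, ENNReal.ofReal |l z.1 z.2 * b z.1 z.2 x| < ∞ :=
      ae_all_iff.2 fun m => (ae_restrict_iff' measurableSet_closedBall).1 (habs m)
    filter_upwards [h'] with x hx
    obtain ⟨m, hm⟩ := exists_nat_ge ‖x‖
    have h1 := ENNReal.summable_toReal (hx m (by simpa using hm)).ne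
    refine Summable.of_norm (h1.congr fun z => ?_)
    rw [ENNReal.toReal_ofReal (abs_nonneg _), Real.norm_eq_abs]
  -- Absolute convergence permits enumerating the double series as one block decomposition, whose
  -- coefficient sum is at most $\sum_jc_j$.
  set e : ℕ ≃ ℕ × ℕ := Nat.pairEquiv.symm
  have hlim : ∀ᵐ x, Tendsto (fun N => ∑ i ∈ Finset.range N,
      l (e i).1 (e i).2 * b (e i).1 (e i).2 x) atTop
      (𝓝 (∑' z : ℕ × ℕ, l z.1 z.2 * b z.1 z.2 x)) := by
    filter_upwards [hsummable] with x hx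
    exact ((Equiv.hasSum_iff e).2 hx.hasSum).tendsto_sum_nat
  have hHm : AEStronglyMeasurable (fun x => ∑' z : ℕ × ℕ, l z.1 z.2 * b z.1 z.2 x) volume := by
    refine aestronglyMeasurable_of_tendsto_ae atTop (fun N => ?_) hlim
    exact Finset.aestronglyMeasurable_fun_sum _ fun i _ => (hblock (e i)).1.const_mul _
  set H : MeasFun n := AEEqFun.mk _ hHm
  have hH : H =ᵐ[volume] fun x => ∑' z : ℕ × ℕ, l z.1 z.2 * b z.1 z.2 x := AEEqFun.coeFn_mk _ _
  have htsum : ∑' i, ENNReal.ofReal |l (e i).1 (e i).2| =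
      ∑' z : ℕ × ℕ, ENNReal.ofReal |l z.1 z.2| :=
    e.tsum_eq fun z => ENNReal.ofReal |l z.1 z.2|
  have hdec : IsBlockDecomp n α s r' p' q' H (fun i => l (e i).1 (e i).2)
      (fun i => b (e i).1 (e i).2) := by
    refine ⟨?_, fun i => hblock (e i), ?_⟩
    · have h1 := ENNReal.summable_toReal (f := fun i => ENNReal.ofReal |l (e i).1 (e i).2|)
        (by rw [htsum]; exact ne_top_of_le_ne_top ENNReal.ofReal_ne_top hsum)
      refine h1.congr fun i => ?_
      rw [ENNReal.toReal_ofReal (abs_nonneg _)]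
    · filter_upwards [hlim, hH] with x h1 h2
      rw [h2]
      exact h1
  let h : BlockSpace n α s r' p' q' := ⟨H, _, _, hdec⟩
  refine ⟨h, ?_, ?_⟩
  · have hall : ∀ᵐ x : Rn n, ∀ j, Tendsto (fun N => ∑ k ∈ Finset.range N, l j k * b j k x) atTop
        (𝓝 ((w j).1 x)) := ae_all_iff.2 fun j => (hd j).2.2
    filter_upwards [hsummable, hall, hH] with x h1 h2 h3
    change HasSum (fun j => (w j).1 x) (H x)
    rw [h3]
    refine h1.hasSum.prod_fiberwise fun j => ?_
    have hj : Summable fun k => l j k * b j k x := h1.prod_factor j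
    have := tendsto_nhds_unique hj.hasSum.tendsto_sum_nat (h2 j)
    rw [← this]
    exact hj.hasSum
  · rw [BlockSpace.norm_def]
    refine ENNReal.toReal_le_of_le_ofReal (tsum_nonneg hc0) ?_
    exact hdec.blockNorm_le.trans (htsum.le.trans hsum)

/-- A block space is a Banach space if the indicators of balls are multipliers. -/
lemma isBanach_blockSpace (hα : 0 < α) (hs : 1 < s) (hr : r.HolderConjugate r')
    (hp : p.HolderConjugate p') (hq : q.HolderConjugate q')
    (hball : ∀ m : ℕ, multNorm n α s r p q (ballIndicator n m) < ∞) :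
    IsBanach (BlockSpace n α s r' p' q') := by
  constructor
  · intro F hF
    refine BlockSpace.ext_ae ((ae_eq_of_forall_ae_eq_closedBall fun m => ?_).trans
      AEEqFun.coeFn_zero.symm : F.1 =ᵐ[volume] (0 : MeasFun n))
    -- The pairing with the indicator of a ball is the $L^1$ norm on that ball, and it vanishes with
    -- the block norm.
    have h1 := F.lintegral_mul_le hα hs hr hp hq (hball m)
    rw [hF, mul_zero, ENNReal.ofReal_zero, nonpos_iff_eq_zero, lintegral_mul_ballIndicator,
      lintegral_eq_zero_iff' (F.1.aestronglyMeasurable.aemeasurable.restrict.abs.ennreal_ofReal)]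
      at h1
    filter_upwards [h1] with x hx
    simpa using hx
  · refine Metric.complete_of_convergent_controlled_sequences (fun N => (1 / 2 : ℝ) ^ N)
      (fun N => by positivity) fun u hu => ?_
    set w : ℕ → BlockSpace n α s r' p' q' := fun j => u (j + 1) - u j with hw
    have hwn : ∀ j, ‖w j‖ < (1 / 2 : ℝ) ^ j := fun j => by
      rw [hw, ← dist_eq_norm]
      exact hu j _ _ (Nat.le_succ j) le_rfl
    -- The differences $w_j$ have summable norms, so every tail $\sum_{j\ge N}w_j$ defines an
    -- element $h_N$ of norm at most $\sum_{j\ge N}2^{-j}$. Telescoping makes $u_N+h_N$ independent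
    -- of $N$; this constant is the limit.
    have hgeo : Summable fun j : ℕ => (1 / 2 : ℝ) ^ j := summable_geometric_two
    have hex : ∀ N : ℕ, ∃ h : BlockSpace n α s r' p' q',
        (∀ᵐ x, HasSum (fun j => (w (j + N)).1 x) (h.1 x)) ∧ ‖h‖ ≤ ∑' j, (1 / 2 : ℝ) ^ (j + N) :=
      fun N => exists_blockSpace_series hα hs hr hp hq hball
        ((summable_nat_add_iff (f := fun j : ℕ => (1 / 2 : ℝ) ^ j) N).2 hgeo) fun j => hwn _
    choose h hh hhn using hex
    have hstep : ∀ N, h N = w N + h (N + 1) := by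
      intro N
      refine BlockSpace.ext_ae ?_
      filter_upwards [hh N, hh (N + 1), (w N).coe_add (h (N + 1))] with x h1 h2 h3
      rw [h3]
      have h4 := (hasSum_nat_add_iff' (f := fun j => (w (j + N)).1 x) 1).2 h1
      have h5 : (fun j => (w (j + 1 + N)).1 x) = fun j => (w (j + (N + 1))).1 x := by
        funext j
        rw [show j + 1 + N = j + (N + 1) by ring]
      rw [h5] at h4
      have h6 := h4.unique h2
      rw [Finset.sum_range_one, zero_add] at h6
      linarith
    have hconst : ∀ N, u N + h N = u 0 + h 0 := by
      intro N
      induction N with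
      | zero => rfl
      | succ N ih =>
        rw [← ih, hstep N, ← add_assoc, add_sub_cancel]
    refine ⟨u 0 + h 0, ?_⟩
    rw [tendsto_iff_norm_sub_tendsto_zero]
    refine squeeze_zero (fun _ => norm_nonneg _) (fun N => ?_)
      (tendsto_sum_nat_add fun j : ℕ => (1 / 2 : ℝ) ^ j)
    rw [← hconst N, sub_add_cancel_left, norm_neg]
    exact hhn N

end Banach

theorem theorem1p2 (n : ℕ) (α s : ℝ) (hα : 0 < α) (hs : 1 < s) (hsn : s ≤ n / α)
    (p q : ℝ) [Fact (1 < p)] [Fact (1 < q)] :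
    -- `(B^{p',q'})* ≈ M^{p,q} ≈ (B^{p',q'})'`
    DualIsomorphic n α s q.conjExponent p.conjExponent q.conjExponent (multNorm n α s q p q) ∧
    Isomorphic n (multNorm n α s q p q)
      (kotheNorm n (blockNorm n α s q.conjExponent p.conjExponent q.conjExponent)) ∧
    -- `(𝓑^{p',q'})* ≈ 𝓜^{p,q} ≈ (𝓑^{p',q'})'`
    DualIsomorphic n α s p.conjExponent p.conjExponent q.conjExponent (multNorm n α s p p q) ∧
    Isomorphic n (multNorm n α s p p q)
      (kotheNorm n (blockNorm n α s p.conjExponent p.conjExponent q.conjExponent)) ∧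
    -- `B^{p',q'}` is a Banach space (if `(n - αs) / n ≤ q / p`), and so is `𝓑^{p',q'}`
    ((n - α * s) / n ≤ q / p →
      IsBanach (BlockSpace n α s q.conjExponent p.conjExponent q.conjExponent)) ∧
    IsBanach (BlockSpace n α s p.conjExponent p.conjExponent q.conjExponent) := by
  have hp : p.HolderConjugate p.conjExponent := Real.HolderConjugate.conjExponent Fact.out
  have hq : q.HolderConjugate q.conjExponent := Real.HolderConjugate.conjExponent Fact.out
  -- In dimension zero the hypothesis `hsn` would give $s\le0$.
  have hn : 0 < n := by
    rcases Nat.eq_zero_or_pos n with rfl | h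
    · rw [Nat.cast_zero, zero_div] at hsn
      linarith
    · exact h
  refine ⟨dualIsomorphic_multNorm hα hs hq hp hq, isomorphic_multNorm_kotheNorm hα hs hq hp hq,
    dualIsomorphic_multNorm hα hs hp hp hq, isomorphic_multNorm_kotheNorm hα hs hp hp hq,
    fun hpq => isBanach_blockSpace hα hs hq hp hq fun m => ?_,
    isBanach_blockSpace hα hs hp hp hq fun m => ?_⟩
  -- For $q/p\le1$ the Sobolev type bound applies with $\delta=q/p$. For $q/p>1$ the linear bound
  -- suffices, since $|K\cap B|^{q/p-1}\le|B|^{q/p-1}$.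
  · rcases le_or_gt (q / p) 1 with h1 | h1
    · obtain ⟨C, hC, h⟩ := volume_rpow_le_besselCap hn hα hs (div_pos hq.pos hp.pos) h1 hpq
      exact multNorm_ballIndicator_lt_top hq.pos hp.pos hq.pos hα hs m hC fun K =>
        (ENNReal.rpow_le_rpow (measure_mono inter_subset_left)
          (div_pos hq.pos hp.pos).le).trans (h K)
    · obtain ⟨C, hC, h⟩ := volume_le_besselCap n hα hs
      set B : Set (Rn n) := Metric.closedBall 0 (m : ℝ)
      have hBv : volume B ≠ ∞ := Metric.isBounded_closedBall.measure_lt_top.ne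
      refine multNorm_ballIndicator_lt_top hq.pos hp.pos hq.pos hα hs m
        (C := volume B ^ (q / p - 1) * C) (ENNReal.mul_ne_top
          (ENNReal.rpow_ne_top_of_nonneg (by linarith) hBv) hC) fun K => ?_
      calc volume (K ∩ B) ^ (q / p) = volume (K ∩ B) ^ (q / p - 1) * volume (K ∩ B) := by
            nth_rw 3 [← ENNReal.rpow_one (volume (K ∩ B))]
            rw [← ENNReal.rpow_add_of_nonneg _ _ (by linarith) zero_le_one, sub_add_cancel]
        _ ≤ volume B ^ (q / p - 1) * (C * besselCap n α s K) :=
            mul_le_mul' (ENNReal.rpow_le_rpow (measure_mono inter_subset_right) (by linarith))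
              ((measure_mono inter_subset_left).trans (h K))
        _ = _ := (mul_assoc _ _ _).symm
  -- Here $r=p$, so the required power of the volume is $1$ and no condition relating $p$ and $q$
  -- arises.
  · obtain ⟨C, hC, h⟩ := volume_le_besselCap n hα hs
    refine multNorm_ballIndicator_lt_top hp.pos hp.pos hq.pos hα hs m hC fun K => ?_
    rw [div_self hp.pos.ne', ENNReal.rpow_one]
    exact (measure_mono inter_subset_left).trans (h K)
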